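/- Let $-\infty<a<b<\infty$ and $0<\alpha<1$. For $\eta\in C_0^\infty((a,b))$, extended by zero to $\mathbb R$, put $${}^{-}D^{\alpha}\eta(x)=\frac{1}{\Gamma(1-\alpha)}\frac{d}{dx}\int_{-\infty}^{x}\frac{\eta(y)}{(x-y)^{\alpha}}\,dy,\qquad {}^{+}D^{\alpha}\eta(x)=\frac{-1}{\Gamma(1-\alpha)}\frac{d}{dx}\int_{x}^{\infty}\frac{\eta(y)}{(y-x)^{\alpha}}\,dy .$$ For $u\in L^1((a,b))$, a function $v\in L^1_{loc}((a,b))$ is the left (resp. right) weak fractional derivative ${}^{-}\mathcal D^{\alpha}u$ (resp. ${}^{+}\mathcal D^{\alpha}u$) of $u$ if $\int_a^b v\,\eta\,dx=\int_a^b u\;{}^{\pm}D^{\alpha}\eta\,dx$ for all $\eta\in C_0^\infty((a,b))$, with ${}^{+}D^\alpha$ for the left and ${}^{-}D^\alpha$ for the right derivative. Define $${}^{-}R^{\alpha}_{0}(f,g)(x)=\frac{-1}{\Gamma(-\alpha)}\int_{a}^{x}\frac{f(y)\,[g(x)-g(y)]}{(x-y)^{1+\alpha}}\,dy,\qquad {}^{+}R^{\alpha}_{0}(f,g)(x)=\frac{-1}{\Gamma(-\alpha)}\int_{x}^{b}\frac{f(y)\,[g(x)-g(y)]}{(y-x)^{1+\alpha}}\,dy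 .$$ **Theorem (chain rule).** Let $\varphi\in C^1(\mathbb R)$ with $\varphi(0)=0$, let $f\in C((a,b))\cap L^1((a,b))$, and suppose that ${}^{\pm}\mathcal D^{\alpha}f\in L^1_{loc}((a,b))$ exists. Let $g=\varphi(f)/f$, with the value $\varphi'(0)$ at the zeros of $f$. Then, for each of the two signs, the formula $${}^{\pm}\mathcal D^{\alpha}\varphi(f)(x)=\frac{\varphi(f)(x)}{f(x)}\;{}^{\pm}\mathcal D^{\alpha}f(x)+{}^{\pm}R^{\alpha}_{0}\Bigl(f,\frac{\varphi(f)}{f}\Bigr)(x)\qquad\text{for a.e. }x\in(a,b)$$ holds in the following sense. 1. If the weak derivative ${}^{\pm}\mathcal D^{\alpha}\varphi(f)$ exists, then for a.e. $x$ the remainder converges as an improper integral at its singularity (the limit, as $\varepsilon\to0^+$, of the integrals over the points $y$ of the domain of integration with $|x-y|>\varepsilon$), and the formula holds. In particular the formula holds with the Lebesgue integral at a.e. $x$ at which the integrand of the remainder is Lebesgue integrable. 2. If $\varphi(f)\in L^1((a,b))$, the integrand of the remainder is Lebesgue integrable in $y$ for a.e. $x$, and the integral of its absolute value is locally integrable in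 $x\in(a,b)$, then ${}^{\pm}\mathcal D^{\alpha}\varphi(f)$ exists and the formula holds with the Lebesgue integral. -/

import Mathlib

open MeasureTheory Set Filter Topology

noncomputable section

namespace WeakFrac

/-- The direction of a fractional operator: `left` is the sign `-`, `right` is the sign `+`. -/
inductive Side where
  | left : Side
  | right : Side

/-- The opposite direction. -/
def Side.opp : Side → Side
  | .left => .right
  | .right => .left

/-- The half-line over which a Liouville integral at `x` is taken. -/
def Side.ray : Side → ℝ → Set ℝ
  | .left, x => Iio x
  | .right, x => Ioi x

/-- The part of `(a, b)` that lies on the given side of `x`, for `x ∈ (a, b)`. -/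
def Side.part : Side → ℝ → ℝ → ℝ → Set ℝ
  | .left, a, _, x => Ioo a x
  | .right, _, b, x => Ioo x b

/-- The part of `(a, b)` on the given side of `x` at distance more than `ε` from `x`. -/
def Side.truncPart : Side → ℝ → ℝ → ℝ → ℝ → Set ℝ
  | .left, a, _, x, ε => Ioo a (x - ε)
  | .right, _, b, x, ε => Ioo (x + ε) b

/-- The Liouville fractional integral of order `σ` on the real line,
`Γ(σ)⁻¹ ∫ η(y) / |x - y|^(1 - σ) dy` over `y < x` (left) or `y > x` (right). -/
def liouvilleIntegral (s : Side) (σ : ℝ) (η : ℝ → ℝ) (x : ℝ) : ℝ :=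
  1 / Real.Gamma σ * ∫ y in s.ray x, η y / |x - y| ^ (1 - σ)

/-- The classical (Liouville) fractional derivative of order `α` on the real line, for
`0 < α < 1`: `d/dx` of the left integral of order `1 - α`, or `-d/dx` of the right one. -/
def liouvilleDeriv (s : Side) (α : ℝ) (η : ℝ → ℝ) (x : ℝ) : ℝ :=
  match s with
  | .left => deriv (liouvilleIntegral .left (1 - α) η) x
  | .right => -deriv (liouvilleIntegral .right (1 - α) η) x

/-- `v` is the weak fractional derivative of `u` on `(a, b)`, of order `α ∈ (0, 1)`, in the
direction `s`. A test function on `(a, b)` is given through its extension by zero. -/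
structure IsWeakFracDeriv (s : Side) (α a b : ℝ) (u v : ℝ → ℝ) : Prop where
  integrableOn : IntegrableOn u (Ioo a b)
  locallyIntegrableOn : LocallyIntegrableOn v (Ioo a b)
  integral_eq : ∀ η : ℝ → ℝ, ContDiff ℝ ((⊤ : ℕ∞) : WithTop ℕ∞) η → HasCompactSupport η →
    tsupport η ⊆ Ioo a b →
    ∫ x in Ioo a b, v x * η x = ∫ x in Ioo a b, u x * liouvilleDeriv s.opp α η x

/-- The integrand `f(y) [g(x) - g(y)] / |x - y|^(1 + α)` of the remainder. -/
def remainderIntegrand (α : ℝ) (f g : ℝ → ℝ) (x y : ℝ) : ℝ :=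
  f y * (g x - g y) / |x - y| ^ (1 + α)

/-- The remainder `R₀^α(f, g)(x)` as a Lebesgue integral (meaningful if the integrand is
integrable). -/
def remainder (s : Side) (α a b : ℝ) (f g : ℝ → ℝ) (x : ℝ) : ℝ :=
  -1 / Real.Gamma (-α) * ∫ y in s.part a b x, remainderIntegrand α f g x y

/-- `r` is the value of the remainder `R₀^α(f, g)(x)`, read as an improper integral: the limit
of the integrals over the points at distance more than `ε` from the singularity `x`. -/
def IsImproperRemainder (s : Side) (α a b : ℝ) (f g : ℝ → ℝ) (x r : ℝ) : Prop :=
  Tendsto (fun ε : ℝ => -1 / Real.Gamma (-α) *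
    ∫ y in s.truncPart a b x ε, remainderIntegrand α f g x y) (𝓝[>] 0) (𝓝 r)

open Classical in
/-- The quotient `φ(f) / f`, extended continuously by `φ'(0)` to the zeros of `f`
(where `φ(0) = 0`). -/
def quotient (φ f : ℝ → ℝ) (x : ℝ) : ℝ :=
  if f x = 0 then deriv φ 0 else φ (f x) / f x

end WeakFrac

end

open scoped ENNReal

noncomputable section

namespace WeakFrac

/-! Everything rests on the truncated Marchaud derivative `M_ε u(x) = ε^(-α) u(x) - α ∫_a^(x-ε) u(y)
(x-y)^(-1-α) dy` (`marchaudTrunc`). For a product it satisfies an exact identity, `M_ε(g f)(x) =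
g(x) M_ε f(x) + α ∫_a^(x-ε) f(y) (g(x) - g(y)) (x-y)^(-1-α) dy` (`marchaudTrunc_mul`). With `g =
φ(f)/f` this is the chain rule before the passage `ε → 0`, since `-1/Γ(-α) = α/Γ(1-α)`. It remains
to identify the limits.

If `v` is the left weak derivative of `u`, then `M_ε u → Γ(1-α) v` both a.e. and weakly against
continuous functions of compact support. Indeed Fubini and the lemma of du Bois-Reymond show that
the fractional integral of `u` of order `1 - α` is a.e. a constant plus a primitive of `Γ(1-α) v`.
As `v` need not be integrable up to `a`, one restarts at almost any `c > a`: the contribution of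
`(a, c)` is differentiated explicitly, and `∫_c^x u(y) (x-y)^(-α) dy = ∫_c^x h` with `h` integrable
near `c` (`localDensity`). Abel inversion gives `B u(x) = ∫_c^x h(z) (x-z)^(α-1) dz`, where `B =
Β(1-α, α)`. Inserting this in the truncated derivative based at `c` and exchanging integrals gives
`∫_0^∞ h(x - ε t) K(t) dt` with `K(t) = (t^α - (t-1)_+^α)/t ≥ 0` and `∫ K = B` (`marchaudTrunc_eq`,
`integral_marchaudKernel`). These are approximate identities: a decreasing integrable majorant of
`K` gives convergence at Lebesgue points, and moving the translation to the test function gives weak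
convergence.

If both weak derivatives exist, a.e. convergence of `M_ε f` and `M_ε(φ(f))` forces the truncated
remainders to converge, which is the first claim. For the second, `M_ε(φ(f))` is tested against a
smooth `η`. Integration by parts in the adjoint shows, for any integrable function, that the limit
is `Γ(1-α)` times its pairing with the right Liouville derivative of `η`. On the other side of the
product identity `g M_ε f` converges weakly, `η g` being continuous, and the remainder converges by
domination. The right-sided case follows by the reflection `x ↦ -x`. -/

/-! ### Fubini on a triangle, power integrals and the Beta constant -/

/-- Fubini's theorem on the triangle `c < z < y < T`. -/
theorem triangle_fubini {c T C : ℝ} {f : ℝ → ℝ} {G : ℝ → ℝ → ℝ}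
    (hf : IntegrableOn f (Ioo c T)) (hG : Measurable (Function.uncurry G))
    (hGi : ∀ z ∈ Ioo c T, IntegrableOn (fun y => G y z) (Ioo z T))
    (hC : ∀ z ∈ Ioo c T, ∫ y in Ioo z T, |G y z| ≤ C) :
    (∀ᵐ y ∂(volume.restrict (Ioo c T)), IntegrableOn (fun z => f z * G y z) (Ioo c y)) ∧
    IntegrableOn (fun y => ∫ z in Ioo c y, f z * G y z) (Ioo c T) ∧
    ∫ y in Ioo c T, ∫ z in Ioo c y, f z * G y z
      = ∫ z in Ioo c T, f z * ∫ y in Ioo z T, G y z := by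
  set μ : Measure ℝ := volume.restrict (Ioo c T) with hμ
  set Φ : ℝ × ℝ → ℝ := {p : ℝ × ℝ | p.1 < p.2}.indicator (fun p => f p.1 * G p.2 p.1) with hΦ
  have hS : MeasurableSet {p : ℝ × ℝ | p.1 < p.2} := measurableSet_lt measurable_fst measurable_snd
  have hmeas : AEStronglyMeasurable Φ (μ.prod μ) := by
    refine AEStronglyMeasurable.indicator ?_ hS
    refine (hf.aestronglyMeasurable.comp_fst (ν := μ)).mul ?_
    exact (hG.comp measurable_swap).aestronglyMeasurable
  have h1 : ∀ z, (fun y => Φ (z, y)) = (Ioi z).indicator (fun y => f z * G y z) := by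
    intro z; ext y; simp [hΦ, indicator]
  have h2 : ∀ y, (fun z => Φ (z, y)) = (Iio y).indicator (fun z => f z * G y z) := by
    intro y; ext z; simp [hΦ, indicator]
  have s1 : ∀ z ∈ Ioo c T, Ioo c T ∩ Ioi z = Ioo z T := by
    intro z hz; ext y; simp only [mem_inter_iff, mem_Ioo, mem_Ioi]
    exact ⟨fun h => ⟨h.2, h.1.2⟩, fun h => ⟨⟨hz.1.trans h.1, h.2⟩, h.1⟩⟩
  have s2 : ∀ y ∈ Ioo c T, Ioo c T ∩ Iio y = Ioo c y := by
    intro z hz; ext y; simp only [mem_inter_iff, mem_Ioo, mem_Iio]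
    exact ⟨fun h => ⟨h.1.1, h.2⟩, fun h => ⟨⟨h.1, h.2.trans hz.2⟩, h.2⟩⟩
  have hmem : ∀ᵐ z ∂μ, z ∈ Ioo c T := ae_restrict_mem measurableSet_Ioo
  have hint : Integrable Φ (μ.prod μ) := by
    rw [integrable_prod_iff hmeas]
    constructor
    · filter_upwards [hmem] with z hz
      rw [h1, integrable_indicator_iff measurableSet_Ioi, IntegrableOn, hμ,
        Measure.restrict_restrict measurableSet_Ioi, inter_comm, s1 z hz]
      exact (hGi z hz).const_mul _
    -- The bound `C` is uniform in `z`, so the inner integrals of `|Φ|` are dominated by `C |f(z)|`.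
    · refine Integrable.mono' (hf.norm.mul_const C) hmeas.norm.integral_prod_right' ?_
      filter_upwards [hmem] with z hz
      have : (fun y => ‖Φ (z, y)‖) = (Ioi z).indicator (fun y => |f z| * |G y z|) := by
        ext y
        rw [show Φ (z, y) = (Ioi z).indicator (fun y => f z * G y z) y from congrFun (h1 z) y,
          norm_indicator_eq_indicator_norm]
        simp
      rw [this, hμ, setIntegral_indicator measurableSet_Ioi, s1 z hz, integral_const_mul,
        norm_mul, Real.norm_eq_abs, Real.norm_eq_abs, abs_abs,
        abs_of_nonneg (integral_nonneg fun y => abs_nonneg _)]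
      exact mul_le_mul_of_nonneg_left (hC z hz) (abs_nonneg _)
  have e2 : ∀ᵐ y ∂μ, ∫ z, Φ (z, y) ∂μ = ∫ z in Ioo c y, f z * G y z := by
    filter_upwards [hmem] with y hy
    rw [h2, hμ, setIntegral_indicator measurableSet_Iio, s2 y hy]
  have e1 : ∀ᵐ z ∂μ, ∫ y, Φ (z, y) ∂μ = f z * ∫ y in Ioo z T, G y z := by
    filter_upwards [hmem] with z hz
    rw [h1, hμ, setIntegral_indicator measurableSet_Ioi, s1 z hz, integral_const_mul]
  refine ⟨?_, (integrable_congr e2).1 hint.integral_prod_right, ?_⟩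
  · filter_upwards [hmem, hint.prod_left_ae] with y hy h
    rw [h2, integrable_indicator_iff measurableSet_Iio, IntegrableOn, hμ,
        Measure.restrict_restrict measurableSet_Iio, inter_comm, s2 y hy] at h
    exact h
  · rw [← integral_congr_ae e2, ← integral_congr_ae e1]
    exact (integral_integral_swap (f := fun z y => Φ (z, y)) hint).symm

/-- The power `(T - z) ^ (p + 1) / (p + 1)` as an integral over `(z, T)`. -/
theorem integral_sub_rpow {z T p : ℝ} (hp : -1 < p) (hz : z ≤ T) :
    IntegrableOn (fun y => (y - z) ^ p) (Ioo z T) ∧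
    ∫ y in Ioo z T, (y - z) ^ p = (T - z) ^ (p + 1) / (p + 1) := by
  have hi : IntervalIntegrable (fun y => (y - z) ^ p) volume z T := by
    have := (intervalIntegral.intervalIntegrable_rpow' (a := 0) (b := T - z) hp).comp_sub_right z
    simpa using this
  refine ⟨((intervalIntegrable_iff_integrableOn_Ioo_of_le hz).1 hi), ?_⟩
  rw [← integral_Ioc_eq_integral_Ioo, ← intervalIntegral.integral_of_le hz,
    intervalIntegral.integral_comp_sub_right (fun y => y ^ p) z, integral_rpow (Or.inl hp)]
  rw [sub_self, Real.zero_rpow (by linarith), sub_zero]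

theorem integral_rsub_rpow {z T p : ℝ} (hp : -1 < p) (hz : z ≤ T) :
    IntegrableOn (fun y => (T - y) ^ p) (Ioo z T) ∧
    ∫ y in Ioo z T, (T - y) ^ p = (T - z) ^ (p + 1) / (p + 1) := by
  have hi : IntervalIntegrable (fun y => (T - y) ^ p) volume z T := by
    have := ((intervalIntegral.intervalIntegrable_rpow' (a := 0) (b := T - z) hp).comp_sub_left T).symm
    simpa using this
  refine ⟨((intervalIntegrable_iff_integrableOn_Ioo_of_le hz).1 hi), ?_⟩
  rw [← integral_Ioc_eq_integral_Ioo, ← intervalIntegral.integral_of_le hz,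
    intervalIntegral.integral_comp_sub_left (fun y => y ^ p) T, integral_rpow (Or.inl hp)]
  rw [sub_self, Real.zero_rpow (by linarith), sub_zero]

/-- The constant `Β(1 - α, α)`. -/
def betaConst (α : ℝ) : ℝ := ∫ y in Ioo (0 : ℝ) 1, y ^ (-α) * (1 - y) ^ (α - 1)

/-- Each factor is singular at one endpoint only; on the opposite half of the interval it is bounded
by its value at `1/2`, which is `2 ^ (1 - α)` or `2 ^ α`. -/
theorem integrableOn_betaConst {α : ℝ} (h0 : 0 < α) (h1 : α < 1) :
    IntegrableOn (fun y : ℝ => y ^ (-α) * (1 - y) ^ (α - 1)) (Ioo 0 1) := by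
  have A : IntegrableOn (fun y : ℝ => (2:ℝ) ^ (1 - α) * (y - 0) ^ (-α)
      + (2:ℝ) ^ α * (1 - y) ^ (α - 1)) (Ioo 0 1) :=
    ((integral_sub_rpow (by linarith) zero_le_one).1.const_mul _).add
      ((integral_rsub_rpow (by linarith) zero_le_one).1.const_mul _)
  refine Integrable.mono' A (by fun_prop) ?_
  filter_upwards [ae_restrict_mem measurableSet_Ioo] with y hy
  have p1 : 0 < y := hy.1
  have p2 : 0 < 1 - y := by linarith [hy.2]
  rw [Real.norm_of_nonneg (by positivity), sub_zero]
  rcases le_total y (1/2) with h | h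
  · have : (1 - y) ^ (α - 1) ≤ (2:ℝ) ^ (1 - α) := by
      calc (1 - y) ^ (α - 1) ≤ ((2:ℝ)⁻¹) ^ (α - 1) :=
            Real.rpow_le_rpow_of_nonpos (by norm_num) (by linarith) (by linarith)
        _ = (2:ℝ) ^ (1 - α) := by rw [Real.inv_rpow (by norm_num), ← Real.rpow_neg (by norm_num), neg_sub]
    have h3 : 0 ≤ (2:ℝ) ^ α * (1 - y) ^ (α - 1) := by positivity
    nlinarith [Real.rpow_pos_of_pos p1 (-α)]
  · have : y ^ (-α) ≤ (2:ℝ) ^ α := by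
      calc y ^ (-α) ≤ ((2:ℝ)⁻¹) ^ (-α) :=
            Real.rpow_le_rpow_of_nonpos (by norm_num) (by linarith) (by linarith)
        _ = (2:ℝ) ^ α := by rw [Real.inv_rpow (by norm_num), ← Real.rpow_neg (by norm_num), neg_neg]
    have h3 : 0 ≤ (2:ℝ) ^ (1 - α) * y ^ (-α) := by positivity
    nlinarith [Real.rpow_pos_of_pos p2 (α - 1)]

theorem betaConst_pos {α : ℝ} (h0 : 0 < α) (h1 : α < 1) : 0 < betaConst α := by
  refine (setIntegral_pos_iff_support_of_nonneg_ae ?_ (integrableOn_betaConst h0 h1)).2 ?_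
  · filter_upwards [ae_restrict_mem measurableSet_Ioo] with y hy
    have p1 : 0 < y := hy.1
    have p2 : 0 < 1 - y := by linarith [hy.2]
    simp only [Pi.zero_apply]; positivity
  · have : Ioo (0:ℝ) 1 ⊆ Function.support (fun y : ℝ => y ^ (-α) * (1 - y) ^ (α - 1)) ∩ Ioo 0 1 := by
      intro y hy
      have p1 : 0 < y := hy.1
      have p2 : 0 < 1 - y := by linarith [hy.2]
      exact ⟨(by positivity : y ^ (-α) * (1 - y) ^ (α - 1) ≠ 0), hy⟩
    refine lt_of_lt_of_le ?_ (measure_mono this)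
    simp

/-- The Beta integral over `(z, x)` does not depend on the interval. -/
theorem integral_beta {α z x : ℝ} (h0 : 0 < α) (h1 : α < 1) (hzx : z < x) :
    IntegrableOn (fun y => (x - y) ^ (α - 1) * (y - z) ^ (-α)) (Ioo z x) ∧
    ∫ y in Ioo z x, (x - y) ^ (α - 1) * (y - z) ^ (-α) = betaConst α := by
  have hd : 0 < x - z := by linarith
  have him : (fun t : ℝ => z + (x - z) * t) '' Ioo 0 1 = Ioo z x := by
    ext y; constructor
    · rintro ⟨t, ht, rfl⟩
      constructor <;> simp only <;> nlinarith [ht.1, ht.2]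
    · intro hy
      refine ⟨(y - z) / (x - z), ⟨div_pos (by linarith [hy.1]) hd, (div_lt_one hd).2 (by linarith [hy.2])⟩, ?_⟩
      field_simp; ring
  have hder : ∀ t ∈ Ioo (0:ℝ) 1,
      HasDerivWithinAt (fun t : ℝ => z + (x - z) * t) (x - z) (Ioo 0 1) t := by
    intro t _
    simpa using (((hasDerivAt_id t).const_mul (x - z)).const_add z).hasDerivWithinAt
  have hinj : InjOn (fun t : ℝ => z + (x - z) * t) (Ioo 0 1) := by
    intro s _ t _ h
    simpa [hd.ne'] using h
  have key : ∀ t ∈ Ioo (0:ℝ) 1, |x - z| • ((x - (z + (x - z) * t)) ^ (α - 1)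
      * ((z + (x - z) * t) - z) ^ (-α)) = t ^ (-α) * (1 - t) ^ (α - 1) := by
    intro t ht
    rw [abs_of_pos hd, show x - (z + (x - z) * t) = (x - z) * (1 - t) by ring,
      show z + (x - z) * t - z = (x - z) * t by ring,
      Real.mul_rpow hd.le (by linarith [ht.2]), Real.mul_rpow hd.le ht.1.le, smul_eq_mul]
    -- The exponents `α - 1` and `-α` add up to `-1`, and the Jacobian cancels exactly this power of
    -- the length.
    have : (x - z) * ((x - z) ^ (α - 1) * (x - z) ^ (-α)) = 1 := by
      rw [← Real.rpow_add hd, show α - 1 + -α = -1 by ring, Real.rpow_neg_one]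
      field_simp
    linear_combination (t ^ (-α) * (1 - t) ^ (α - 1)) * this
  rw [← him, integrableOn_image_iff_integrableOn_abs_deriv_smul measurableSet_Ioo hder hinj,
    integral_image_eq_integral_abs_deriv_smul measurableSet_Ioo hder hinj]
  exact ⟨(integrableOn_betaConst h0 h1).congr_fun (fun t ht => (key t ht).symm) measurableSet_Ioo,
    setIntegral_congr_fun measurableSet_Ioo key⟩

/-! ### Liouville derivatives of test functions and the weak derivative as a distributional one -/

/-- The integral `∫ u(y) (x - y) ^ p dy` over `(c, x)`. -/
def abelIntegral (c p : ℝ) (u : ℝ → ℝ) (x : ℝ) : ℝ := ∫ y in Ioo c x, u y * (x - y) ^ p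

theorem setIntegral_Ioi_comp_add (F : ℝ → ℝ) (x : ℝ) :
    ∫ y in Ioi x, F y = ∫ s in Ioi (0 : ℝ), F (x + s) := by
  have := (measurePreserving_add_left volume x).setIntegral_preimage_emb
    (measurableEmbedding_addLeft x) F (Ioi x)
  rw [← this]; congr 2; ext s; simp

/-- The shift `y = x + s` moves the dependence on `x` from the singular kernel to `η`, so that
differentiation under the integral falls on `η`. -/
theorem liouvilleIntegral_right (α : ℝ) (η : ℝ → ℝ) (x : ℝ) :
    liouvilleIntegral .right (1 - α) η x
      = 1 / Real.Gamma (1 - α) * ∫ s in Ioi (0 : ℝ), η (x + s) * s ^ (-α) := by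
  rw [liouvilleIntegral, Side.ray, setIntegral_Ioi_comp_add]
  congr 1
  refine setIntegral_congr_fun measurableSet_Ioi fun s hs => ?_
  have hs' : (0 : ℝ) < s := hs
  simp only [sub_add_cancel_left, abs_neg, abs_of_pos hs', sub_sub_cancel,
    Real.rpow_neg hs'.le, div_eq_mul_inv]

theorem exists_bound_deriv {η : ℝ → ℝ} (hη : ContDiff ℝ ((⊤ : ℕ∞) : WithTop ℕ∞) η)
    (hc : HasCompactSupport η) : ∃ M, 0 ≤ M ∧ ∀ x, |deriv η x| ≤ M := by
  obtain ⟨M, hM⟩ := hc.deriv.exists_bound_of_continuous (hη.continuous_deriv (by simp))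
  exact ⟨M, (norm_nonneg _).trans (hM 0), hM⟩

theorem deriv_eq_zero_of_notMem {η : ℝ → ℝ} {a b : ℝ} (hs : tsupport η ⊆ Ioo a b) {x : ℝ}
    (hx : x ∉ Ioo a b) : deriv η x = 0 := by
  have : x ∉ tsupport (deriv η) := fun h => hx (hs (tsupport_deriv_subset h))
  exact image_eq_zero_of_notMem_tsupport this

/-- The right Liouville derivative of a test function. -/
theorem liouvilleDeriv_right {α a b : ℝ} (h1 : α < 1) {η : ℝ → ℝ}
    (hη : ContDiff ℝ ((⊤ : ℕ∞) : WithTop ℕ∞) η) (hc : HasCompactSupport η)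
    (hs : tsupport η ⊆ Ioo a b) (y : ℝ) :
    liouvilleDeriv .right α η y
      = -(1 / Real.Gamma (1 - α)) * ∫ s in Ioi (0 : ℝ), deriv η (y + s) * s ^ (-α) := by
  obtain ⟨M, hM0, hM⟩ := exists_bound_deriv hη hc
  have hder : ∀ x, HasDerivAt η (deriv η x) x := fun x =>
    (hη.differentiable (by simp) x).hasDerivAt
  have hcont : Continuous η := hη.continuous
  have hcd : Continuous (deriv η) := hη.continuous_deriv (by simp)
  have hsup : ∀ x, b ≤ x → η x = 0 := fun x hx =>
    image_eq_zero_of_notMem_tsupport fun h => absurd (hs h).2 (not_lt.2 hx)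
  have hsupd : ∀ x, b ≤ x → deriv η x = 0 := fun x hx =>
    deriv_eq_zero_of_notMem hs fun h => absurd h.2 (not_lt.2 hx)
  have hrm : ∀ k : ℝ → ℝ, Continuous k → ∀ x, AEStronglyMeasurable
      (fun s : ℝ => k (x + s) * s ^ (-α)) (volume.restrict (Ioi 0)) := fun k hk x =>
    ((hk.comp (continuous_const.add continuous_id)).measurable.mul
      (measurable_id.pow_const _)).aestronglyMeasurable
  have hI : ∀ L : ℝ, IntegrableOn (fun s : ℝ => (Ioo 0 L).indicator (fun s => s ^ (-α)) s) (Ioi 0) := by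
    intro L
    refine Integrable.integrableOn ((integrable_indicator_iff measurableSet_Ioo).2 ?_)
    rcases le_total 0 L with h | h
    · simpa using (integral_sub_rpow (z := 0) (T := L) (p := -α) (by linarith) h).1
    · simp [Ioo_eq_empty (not_lt.2 h)]
  obtain ⟨M', hM'⟩ := hc.exists_bound_of_continuous hcont
  have hbd : ∀ (k : ℝ → ℝ) (N : ℝ), (∀ x, |k x| ≤ N) → (∀ x, b ≤ x → k x = 0) →
      ∀ x L, b ≤ x + L → ∀ s ∈ Ioi (0:ℝ), ‖k (x + s) * s ^ (-α)‖
        ≤ N * (Ioo 0 L).indicator (fun s => s ^ (-α)) s := by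
    intro k N hN hk x L hL s hs
    have hs' : (0:ℝ) < s := hs
    by_cases h : s < L
    · rw [indicator_of_mem (show s ∈ Ioo 0 L from ⟨hs', h⟩), norm_mul,
        Real.norm_of_nonneg (Real.rpow_nonneg hs'.le _)]
      exact mul_le_mul_of_nonneg_right (hN _) (Real.rpow_nonneg hs'.le _)
    · rw [hk _ (by linarith [not_lt.1 h]), indicator_of_notMem fun h' => h h'.2]; simp
  have key : HasDerivAt (fun x => ∫ s in Ioi (0 : ℝ), η (x + s) * s ^ (-α))
      (∫ s in Ioi (0 : ℝ), deriv η (y + s) * s ^ (-α)) y := by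
    -- The extra `1` in the cut-off `b - y + 1` serves all `x` in the unit ball around `y` at once:
    -- beyond it `x + s` has passed `b`.
    refine (hasDerivAt_integral_of_dominated_loc_of_deriv_le
      (bound := fun s => M * (Ioo 0 (b - y + 1)).indicator (fun s => s ^ (-α)) s)
      (F' := fun x s => deriv η (x + s) * s ^ (-α)) (Metric.ball_mem_nhds y one_pos)
      (Eventually.of_forall fun x => hrm η hcont x) ?_ (hrm _ hcd y) ?_
      ((hI _).const_mul _) ?_).2
    · refine Integrable.mono' ((hI (b - y)).const_mul M') (hrm η hcont y) ?_
      filter_upwards [ae_restrict_mem measurableSet_Ioi] with s hs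
      exact hbd η M' hM' hsup y _ (by linarith) s hs
    · filter_upwards [ae_restrict_mem measurableSet_Ioi] with s hs x hx
      have := abs_lt.1 (Real.dist_eq x y ▸ Metric.mem_ball.1 hx)
      exact hbd _ M hM hsupd x _ (by linarith) s hs
    · refine Eventually.of_forall fun s x _ => ?_
      exact ((hder (x + s)).comp_add_const x s).mul_const _
  have : liouvilleIntegral .right (1 - α) η = fun x => 1 / Real.Gamma (1 - α) *
      ∫ s in Ioi (0 : ℝ), η (x + s) * s ^ (-α) := funext (liouvilleIntegral_right α η)
  rw [liouvilleDeriv, this, (key.const_mul _).deriv]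
  ring

theorem integral_Ioi_shift_eq {α b y : ℝ} {k : ℝ → ℝ} (hk : ∀ x, b ≤ x → k x = 0) :
    ∫ s in Ioi (0 : ℝ), k (y + s) * s ^ (-α) = ∫ x in Ioo y b, k x * (x - y) ^ (-α) := by
  have := setIntegral_Ioi_comp_add (fun x => k x * (x - y) ^ (-α)) y
  simp only [add_sub_cancel_left] at this
  rw [← this]
  refine setIntegral_eq_of_subset_of_forall_sdiff_eq_zero measurableSet_Ioi
    (fun x hx => hx.1) fun x hx => ?_
  rw [hk x (not_lt.1 fun h => hx.2 ⟨hx.1, h⟩), zero_mul]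

/-- The weak derivative condition in terms of the fractional integral of order `1 - α`. -/
theorem IsWeakFracDeriv.integral_abelIntegral {α a b : ℝ} (h1 : α < 1)
    {u v : ℝ → ℝ} (hv : IsWeakFracDeriv .left α a b u v) {η : ℝ → ℝ}
    (hη : ContDiff ℝ ((⊤ : ℕ∞) : WithTop ℕ∞) η) (hc : HasCompactSupport η)
    (hs : tsupport η ⊆ Ioo a b) :
    ∫ x in Ioo a b, deriv η x * abelIntegral a (-α) u x
      = -∫ x in Ioo a b, (Real.Gamma (1 - α) * v x) * η x := by
  obtain ⟨M, hM0, hM⟩ := exists_bound_deriv hη hc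
  have hcd : Continuous (deriv η) := hη.continuous_deriv (by simp)
  have hG : 0 < Real.Gamma (1 - α) := Real.Gamma_pos_of_pos (by linarith)
  have hsupd : ∀ x, b ≤ x → deriv η x = 0 := fun x hx =>
    deriv_eq_zero_of_notMem hs fun h => absurd h.2 (not_lt.2 hx)
  have hI : ∀ z ∈ Ioo a b, IntegrableOn (fun y => M * (y - z) ^ (-α)) (Ioo z b) := fun z hz =>
    (integral_sub_rpow (by linarith) hz.2.le).1.const_mul M
  have hle : ∀ z, ∀ y ∈ Ioo z b, |deriv η y * (y - z) ^ (-α)| ≤ M * (y - z) ^ (-α) := by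
    intro z y hy
    have : 0 ≤ (y - z) ^ (-α) := Real.rpow_nonneg (by linarith [hy.1]) _
    rw [abs_mul, abs_of_nonneg this]
    exact mul_le_mul_of_nonneg_right (hM y) this
  have hGm : Measurable (Function.uncurry fun y z : ℝ => deriv η y * (y - z) ^ (-α)) :=
    (hcd.measurable.comp measurable_fst).mul
      ((measurable_fst.sub measurable_snd).pow_const _)
  have hGi : ∀ z ∈ Ioo a b, IntegrableOn (fun y => deriv η y * (y - z) ^ (-α)) (Ioo z b) := by
    intro z hz
    refine Integrable.mono' (hI z hz)
      (hGm.comp measurable_prodMk_right).aestronglyMeasurable ?_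
    filter_upwards [ae_restrict_mem measurableSet_Ioo] with y hy using hle z y hy
  -- Fubini moves the kernel from `deriv η` to `u`: the right Liouville derivative of `η` paired
  -- with `u` becomes `deriv η` paired with the left fractional integral of `u`. The constant bounds
  -- `M ∫ (y - z) ^ (-α) dy` over `(z, b)` uniformly in `z`.
  have hT := (triangle_fubini (C := M * ((b - a) ^ (1 - α) / (1 - α))) hv.integrableOn hGm hGi
    (fun z hz => ?_)).2.2
  · have e2 : ∀ x, u x * liouvilleDeriv Side.left.opp α η x = -(1 / Real.Gamma (1 - α)) *
        (u x * ∫ y in Ioo x b, deriv η y * (y - x) ^ (-α)) := by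
      intro x
      rw [Side.opp, liouvilleDeriv_right h1 hη hc hs, integral_Ioi_shift_eq hsupd]
      ring
    have e : ∫ x in Ioo a b, v x * η x = -(1 / Real.Gamma (1 - α)) *
        ∫ x in Ioo a b, u x * ∫ y in Ioo x b, deriv η y * (y - x) ^ (-α) := by
      rw [hv.integral_eq η hη hc hs, ← integral_const_mul]
      exact integral_congr_ae (Eventually.of_forall e2)
    have e' : ∫ x in Ioo a b, (Real.Gamma (1 - α) * v x) * η x
        = Real.Gamma (1 - α) * ∫ x in Ioo a b, v x * η x := by
      rw [← integral_const_mul]; congr 1; ext x; ring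
    have e3 : ∀ y, deriv η y * abelIntegral a (-α) u y
        = ∫ z in Ioo a y, u z * (deriv η y * (y - z) ^ (-α)) := by
      intro y; rw [abelIntegral, ← integral_const_mul]; congr 1; ext z; ring
    simp_rw [e3]
    rw [e', e, ← hT]
    field_simp
  · calc ∫ y in Ioo z b, |deriv η y * (y - z) ^ (-α)|
        ≤ ∫ y in Ioo z b, M * (y - z) ^ (-α) :=
          setIntegral_mono_on (hGi z hz).abs (hI z hz) measurableSet_Ioo (hle z)
      _ = M * ((b - z) ^ (1 - α) / (1 - α)) := by
          rw [integral_const_mul, (integral_sub_rpow (by linarith) hz.2.le).2]; ring_nf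
      _ ≤ _ := by
          have : (b - z) ^ (1 - α) ≤ (b - a) ^ (1 - α) :=
            Real.rpow_le_rpow (by linarith [hz.2]) (by linarith [hz.1]) (by linarith)
          have h2 : 0 < 1 - α := by linarith
          gcongr

/-! ### Primitives, test functions and the lemma of du Bois-Reymond -/

theorem hasDerivAt_integral_Ioo_of_continuous {k : ℝ → ℝ} (hk : Continuous k) (c : ℝ) (x : ℝ) :
    HasDerivAt (fun x => ∫ t in c..x, k t) (k x) x :=
  intervalIntegral.integral_hasDerivAt_right (hk.intervalIntegrable _ _)
    (hk.stronglyMeasurableAtFilter _ _) hk.continuousAt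

/-- A smooth function with zero mean supported in `[c, d]` is the derivative of a smooth function
supported in `[c, d]`. -/
theorem exists_primitive {k : ℝ → ℝ} (hk : ContDiff ℝ ((⊤ : ℕ∞) : WithTop ℕ∞) k) {c d : ℝ}
    (hs : ∀ x, x ∉ Icc c d → k x = 0) (hz : ∫ x, k x = 0) :
    ∃ η : ℝ → ℝ, ContDiff ℝ ((⊤ : ℕ∞) : WithTop ℕ∞) η ∧ (∀ x, x ∉ Icc c d → η x = 0) ∧
      deriv η = k := by
  have hder := hasDerivAt_integral_Ioo_of_continuous hk.continuous c
  have hd : deriv (fun x => ∫ t in c..x, k t) = k := funext fun x => (hder x).deriv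
  refine ⟨fun x => ∫ t in c..x, k t, ?_, ?_, hd⟩
  · refine contDiff_infty_iff_deriv.2 ⟨fun x => (hder x).differentiableAt, ?_⟩
    rw [hd]; exact hk
  · intro x hx
    rw [mem_Icc, not_and_or, not_le, not_le] at hx
    rcases hx with hx | hx
    · refine intervalIntegral.integral_zero_ae (Eventually.of_forall fun t ht => ?_)
      rw [uIoc_of_ge hx.le] at ht
      -- The interval of integration `Ioc x c` contains `c`, where the support hypothesis is silent;
      -- `k c = 0` comes from continuity from the left.
      by_cases h : t = c
      · have : k c = 0 := by
          have hcl : k =ᶠ[𝓝[<] c] fun _ => 0 := by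
            filter_upwards [self_mem_nhdsWithin] with s hs'
            exact hs s fun h => absurd h.1 (not_le.2 hs')
          have l1 : Tendsto k (𝓝[<] c) (𝓝 (k c)) := hk.continuous.continuousAt.mono_left inf_le_left
          exact tendsto_nhds_unique l1 (tendsto_const_nhds.congr' hcl.symm)
        rw [h, this]
      · exact hs t fun h' => h (le_antisymm ht.2 h'.1)
    · change ∫ t in c..x, k t = 0
      rw [← hz]
      by_cases hcd : c ≤ d
      · rw [intervalIntegral.integral_of_le (by linarith), ← integral_Icc_eq_integral_Ioc]
        refine setIntegral_eq_integral_of_forall_compl_eq_zero fun t ht => hs t fun h => ht ?_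
        exact ⟨h.1, h.2.trans hx.le⟩
      · have : k = fun _ => 0 := funext fun t => hs t fun h => hcd (h.1.trans h.2)
        simp [this]

theorem tsupport_subset_Icc {k : ℝ → ℝ} {c d : ℝ} (hs : ∀ x, x ∉ Icc c d → k x = 0) :
    tsupport k ⊆ Icc c d :=
  closure_minimal (fun x hx => by by_contra h; exact hx (hs x h)) isClosed_Icc

theorem hasCompactSupport_of_Icc {k : ℝ → ℝ} {c d : ℝ} (hs : ∀ x, x ∉ Icc c d → k x = 0) :
    HasCompactSupport k :=
  HasCompactSupport.intro isCompact_Icc hs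

/-- A compactly supported function on `(a, b)` is supported in some `[c, d] ⊆ (a, b)`. -/
theorem exists_Icc_of_tsupport {k : ℝ → ℝ} {a b : ℝ} (hab : a < b) (hc : HasCompactSupport k)
    (hs : tsupport k ⊆ Ioo a b) :
    ∃ c d, a < c ∧ c < d ∧ d < b ∧ ∀ x, x ∉ Icc c d → k x = 0 := by
  -- Adjoining the midpoint keeps the compact set nonempty when `k` vanishes identically. Going
  -- halfway to `a` and to `b` below makes the inequalities strict.
  set m := (a + b) / 2
  have hK : IsCompact (insert m (tsupport k)) := IsCompact.insert hc m
  have hKs : insert m (tsupport k) ⊆ Ioo a b :=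
    insert_subset ⟨by simp only [m]; linarith, by simp only [m]; linarith⟩ hs
  obtain ⟨c, hcm, hcl⟩ := hK.exists_isLeast ⟨m, mem_insert _ _⟩
  obtain ⟨d, hdm, hdl⟩ := hK.exists_isGreatest ⟨m, mem_insert _ _⟩
  have h1 := (hKs hcm).1
  have h2 := (hKs hdm).2
  have h3 : c ≤ d := hcl hdm
  refine ⟨(a + c) / 2, (d + b) / 2, by linarith, by linarith, by linarith, fun x hx => ?_⟩
  refine image_eq_zero_of_notMem_tsupport fun h => hx ?_
  have := hcl (mem_insert_of_mem _ h)
  have := hdl (mem_insert_of_mem _ h)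
  constructor <;> linarith

theorem integrableOn_Icc_of_locallyIntegrableOn {V : ℝ → ℝ} {a b c d : ℝ}
    (hV : LocallyIntegrableOn V (Ioo a b)) (hc : a < c) (hd : d < b) :
    IntegrableOn V (Icc c d) :=
  hV.integrableOn_compact_subset (fun _ hx => ⟨hc.trans_le hx.1, hx.2.trans_lt hd⟩) isCompact_Icc

theorem locallyIntegrableOn_Ioo_of_Icc {V : ℝ → ℝ} {a b : ℝ}
    (h : ∀ c d, a < c → d < b → IntegrableOn V (Icc c d)) : LocallyIntegrableOn V (Ioo a b) := by
  intro x hx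
  refine ⟨Icc ((a + x) / 2) ((x + b) / 2), ?_, h _ _ (by linarith [hx.1]) (by linarith [hx.2])⟩
  exact mem_nhdsWithin_of_mem_nhds (Icc_mem_nhds (by linarith [hx.1]) (by linarith [hx.2]))

theorem intervalIntegrable_of_locallyIntegrableOn {V : ℝ → ℝ} {a b x y : ℝ}
    (hV : LocallyIntegrableOn V (Ioo a b)) (hx : x ∈ Ioo a b) (hy : y ∈ Ioo a b) :
    IntervalIntegrable V volume x y := by
  rw [intervalIntegrable_iff']
  exact integrableOn_Icc_of_locallyIntegrableOn hV (lt_min hx.1 hy.1) (max_lt hx.2 hy.2)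

/-- Integration by parts of a primitive against a test function. -/
theorem integral_primitive_mul_deriv {V : ℝ → ℝ} {a b m c d : ℝ}
    (hV : LocallyIntegrableOn V (Ioo a b)) (hm : m ∈ Ioo a b) (hc : a < c) (hcd : c < d)
    (hd : d < b) {η : ℝ → ℝ} (hη : ContDiff ℝ ((⊤ : ℕ∞) : WithTop ℕ∞) η)
    (hs : ∀ x, x ∉ Icc c d → η x = 0) :
    ∫ x in Ioo a b, deriv η x * (∫ t in m..x, V t) = -∫ x in Ioo a b, V x * η x := by
  have hcont : Continuous (deriv η) := hη.continuous_deriv (by simp)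
  -- `V` is only locally integrable, so the integrals are cut down to an interval strictly between
  -- the support of `η` and `(a, b)`, on which `V` is integrable.
  set c' := (a + c) / 2
  set d' := (d + b) / 2
  have hc1 : a < c' := by simp only [c']; linarith
  have hc2 : c' < c := by simp only [c']; linarith
  have hd1 : d' < b := by simp only [d']; linarith
  have hd2 : d < d' := by simp only [d']; linarith
  have hsub : Ioo c' d' ⊆ Ioo a b := Ioo_subset_Ioo hc1.le hd1.le
  have hds : ∀ x, x ∉ Icc c d → deriv η x = 0 := fun x hx =>
    image_eq_zero_of_notMem_tsupport fun h =>
      hx (tsupport_subset_Icc hs (tsupport_deriv_subset h))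
  have hout : ∀ x ∈ Ioo a b \ Ioo c' d', x ∉ Icc c d := fun x hx h =>
    hx.2 ⟨hc2.trans_le h.1, h.2.trans_lt hd2⟩
  rw [setIntegral_eq_of_subset_of_forall_sdiff_eq_zero (s := Ioo c' d') measurableSet_Ioo hsub
      fun x hx => by rw [hds x (hout x hx), zero_mul],
    setIntegral_eq_of_subset_of_forall_sdiff_eq_zero (s := Ioo c' d') (t := Ioo a b)
      measurableSet_Ioo hsub fun x hx => by rw [hs x (hout x hx), mul_zero]]
  have hVi : IntegrableOn V (Ioo c' d') :=
    (integrableOn_Icc_of_locallyIntegrableOn hV hc1 hd1).mono_set Ioo_subset_Icc_self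
  obtain ⟨M, hM⟩ := (hasCompactSupport_of_Icc hds).exists_bound_of_continuous hcont
  have hint : ∀ x y, IntegrableOn (deriv η) (Ioo x y) := fun x y =>
    (hcont.integrableOn_Icc).mono_set Ioo_subset_Icc_self
  have hM0 : 0 ≤ M := (norm_nonneg _).trans (hM 0)
  -- Fubini plays the role of integration by parts, the primitive of `V` being merely absolutely
  -- continuous. Moving its base point from `m` to `c'` costs a constant, which is harmless because
  -- `deriv η` has zero mean.
  have hT := (triangle_fubini (G := fun y _ => deriv η y) (C := M * (d' - c')) hVi
    (hcont.measurable.comp measurable_fst) (fun z _ => hint _ _) (fun z hz => by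
      refine (setIntegral_mono_on (hint z d').abs (integrable_const M) measurableSet_Ioo
        fun x _ => hM x).trans ?_
      simp only [integral_const, smul_eq_mul, MeasurableSet.univ, measureReal_restrict_apply,
        univ_inter, Real.volume_real_Ioo_of_le hz.2.le]
      nlinarith [hz.1])).2
  have hFTC : ∀ x y, x ≤ y → ∫ t in Ioo x y, deriv η t = η y - η x := by
    intro x y h
    rw [← integral_Ioc_eq_integral_Ioo, ← intervalIntegral.integral_of_le h]
    exact intervalIntegral.integral_deriv_eq_sub
      (fun t _ => hη.differentiable (by simp) t) (hcont.intervalIntegrable _ _)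
  have hd0 : η d' = 0 := hs _ fun h => absurd h.2 (not_le.2 hd2)
  have hc0 : η c' = 0 := hs _ fun h => absurd h.1 (not_le.2 hc2)
  have hR : ∫ z in Ioo c' d', V z * ∫ y in Ioo z d', deriv η y
      = -∫ x in Ioo c' d', V x * η x := by
    rw [← integral_neg]
    refine setIntegral_congr_fun measurableSet_Ioo fun z hz => ?_
    simp only [hFTC z d' hz.2.le, hd0]; ring
  have hc'm : c' ∈ Ioo a b := ⟨hc1, by linarith⟩
  have hsplit : ∀ x ∈ Ioo c' d', deriv η x * (∫ t in m..x, V t)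
      = deriv η x * (∫ t in m..c', V t) + ∫ z in Ioo c' x, V z * deriv η x := by
    intro x hx
    have hx' : x ∈ Ioo a b := hsub hx
    rw [← intervalIntegral.integral_add_adjacent_intervals
      (intervalIntegrable_of_locallyIntegrableOn hV hm hc'm)
      (intervalIntegrable_of_locallyIntegrableOn hV hc'm hx'), integral_mul_const,
      intervalIntegral.integral_of_le hx.1.le, integral_Ioc_eq_integral_Ioo]
    ring
  rw [setIntegral_congr_fun measurableSet_Ioo hsplit, integral_add, hT.2, hR, integral_mul_const,
    hFTC _ _ (by linarith), hd0, hc0]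
  · ring
  · exact (hint _ _).mul_const _
  · exact hT.1

theorem continuousOn_primitive_Ioo {V : ℝ → ℝ} {a b m : ℝ}
    (hV : LocallyIntegrableOn V (Ioo a b)) (hm : m ∈ Ioo a b) :
    ContinuousOn (fun x => ∫ t in m..x, V t) (Ioo a b) := by
  intro x hx
  have h1 : a < min x m := lt_min hx.1 hm.1
  have h2 : max x m < b := max_lt hx.2 hm.2
  set c := (a + min x m) / 2
  set d := (max x m + b) / 2
  have hcx : c < min x m := by simp only [c]; linarith
  have hdx : max x m < d := by simp only [d]; linarith
  have hcm : m ∈ Icc c d := ⟨(hcx.trans_le (min_le_right _ _)).le, ((le_max_right _ _).trans_lt hdx).le⟩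
  have hcd : c ≤ d := hcm.1.trans hcm.2
  have hi : IntervalIntegrable V volume c d := by
    rw [intervalIntegrable_iff', uIcc_of_le hcd]
    exact integrableOn_Icc_of_locallyIntegrableOn hV (by simp only [c]; linarith) (by simp only [d]; linarith)
  have := intervalIntegral.continuousOn_primitive_interval' hi (a := m) (by rwa [uIcc_of_le hcd])
  rw [uIcc_of_le hcd] at this
  exact (this.continuousAt (Icc_mem_nhds (hcx.trans_le (min_le_left _ _))
    ((le_max_left _ _).trans_lt hdx))).continuousWithinAt

/-- The lemma of du Bois-Reymond: a function with weak derivative `V` is a primitive of `V`. -/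
theorem ae_eq_const_add_primitive {F V : ℝ → ℝ} {a b m : ℝ} (hab : a < b)
    (hF : LocallyIntegrableOn F (Ioo a b)) (hV : LocallyIntegrableOn V (Ioo a b))
    (hm : m ∈ Ioo a b)
    (h : ∀ η : ℝ → ℝ, ContDiff ℝ ((⊤ : ℕ∞) : WithTop ℕ∞) η → HasCompactSupport η →
      tsupport η ⊆ Ioo a b → ∫ x in Ioo a b, deriv η x * F x = -∫ x in Ioo a b, V x * η x) :
    ∃ C, ∀ᵐ x ∂(volume.restrict (Ioo a b)), F x = C + ∫ t in m..x, V t := by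
  set P : ℝ → ℝ := fun x => ∫ t in m..x, V t with hP
  have hPl : LocallyIntegrableOn P (Ioo a b) :=
    (continuousOn_primitive_Ioo hV hm).locallyIntegrableOn measurableSet_Ioo
  have hD : LocallyIntegrableOn (fun x => F x - P x) (Ioo a b) := hF.sub hPl
  have htest : ∀ (k W : ℝ → ℝ) (c d : ℝ), Continuous k → a < c → d < b →
      (∀ x, x ∉ Icc c d → k x = 0) → LocallyIntegrableOn W (Ioo a b) →
      IntegrableOn (fun x => k x * W x) (Ioo a b) := by
    intro k W c d hk hc hd hs hW
    have : IntegrableOn (fun x => k x * W x) (Icc c d) :=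
      (integrableOn_Icc_of_locallyIntegrableOn hW hc hd).continuousOn_mul hk.continuousOn isCompact_Icc
    refine (integrableOn_iff_integrable_of_support_subset (s := Icc c d) ?_).1 this |>.integrableOn
    intro x hx
    by_contra hx'
    exact hx (by simp [hs x hx'])
  set D : ℝ → ℝ := fun x => F x - P x with hDdef
  have hDη : ∀ (η : ℝ → ℝ) (c d : ℝ), ContDiff ℝ ((⊤ : ℕ∞) : WithTop ℕ∞) η → a < c → c < d → d < b →
      (∀ x, x ∉ Icc c d → η x = 0) → ∫ x in Ioo a b, deriv η x * D x = 0 := by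
    intro η c d hη hc hcd hd hs
    have hds : ∀ x, x ∉ Icc c d → deriv η x = 0 := fun x hx =>
      image_eq_zero_of_notMem_tsupport fun h =>
        hx (tsupport_subset_Icc hs (tsupport_deriv_subset h))
    have hcont : Continuous (deriv η) := hη.continuous_deriv (by simp)
    have e1 := h η hη (hasCompactSupport_of_Icc hs) ((tsupport_subset_Icc hs).trans
      fun x hx => ⟨hc.trans_le hx.1, hx.2.trans_lt hd⟩)
    have e2 := integral_primitive_mul_deriv hV hm hc hcd hd hη hs
    simp only [hDdef, mul_sub]
    rw [integral_sub (htest _ F c d hcont hc hd hds hF) (htest _ P c d hcont hc hd hds hPl), e1, e2,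
      sub_self]
  -- A bump of mass one fixes the constant `C = ∫ ρ D`. For a test function `ψ`, the difference `ψ -
  -- (∫ ψ) ρ` has zero mean, hence is the derivative of a test function and is annihilated by `D`.
  -- So `∫ ψ D = C ∫ ψ`, that is, `D - C` vanishes as a distribution.
  obtain ⟨ρ, hρ1, hρ2, hρ3, hρ4⟩ : ∃ ρ : ℝ → ℝ, ContDiff ℝ ((⊤ : ℕ∞) : WithTop ℕ∞) ρ ∧
      HasCompactSupport ρ ∧ tsupport ρ ⊆ Ioo a b ∧ ∫ x, ρ x = 1 := by
    obtain ⟨δ, hδ, hδs⟩ := Metric.isOpen_iff.1 isOpen_Ioo m hm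
    let B : ContDiffBump m := ⟨δ / 4, δ / 2, by linarith, by linarith⟩
    refine ⟨B.normed volume, B.contDiff_normed, B.hasCompactSupport_normed, ?_, B.integral_normed⟩
    rw [B.tsupport_normed_eq]
    exact (Metric.closedBall_subset_ball (by simp only [B]; linarith)).trans hδs
  refine ⟨∫ x in Ioo a b, ρ x * D x, ?_⟩
  set C := ∫ x in Ioo a b, ρ x * D x with hC
  have hconst : LocallyIntegrableOn (fun x => D x - C) (Ioo a b) :=
    hD.sub ((continuous_const.locallyIntegrable).locallyIntegrableOn _)
  have := isOpen_Ioo.ae_eq_zero_of_integral_contDiff_smul_eq_zero hconst ?_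
  · rw [ae_restrict_iff' measurableSet_Ioo]
    filter_upwards [this] with x hx hx'
    have := hx hx'
    simp only [hDdef] at this
    linarith
  intro ψ hψ hψc hψs
  obtain ⟨c1, d1, h1, h2, h3, h4⟩ := exists_Icc_of_tsupport hab hψc hψs
  obtain ⟨c2, d2, g1, g2, g3, g4⟩ := exists_Icc_of_tsupport hab hρ2 hρ3
  set c := min c1 c2
  set d := max d1 d2
  have hca : a < c := lt_min h1 g1
  have hdb : d < b := max_lt h3 g3
  have hcd : c < d := (min_le_left _ _).trans_lt (h2.trans_le (le_max_left _ _))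
  have i1 : Icc c1 d1 ⊆ Icc c d := Icc_subset_Icc (min_le_left _ _) (le_max_left _ _)
  have i2 : Icc c2 d2 ⊆ Icc c d := Icc_subset_Icc (min_le_right _ _) (le_max_right _ _)
  have hψI : ∀ x, x ∉ Icc c d → ψ x = 0 := fun x hx => h4 x fun h => hx (i1 h)
  have hρI : ∀ x, x ∉ Icc c d → ρ x = 0 := fun x hx => g4 x fun h => hx (i2 h)
  set A := ∫ x, ψ x with hA
  have hψint : Integrable ψ := hψ.continuous.integrable_of_hasCompactSupport hψc
  have hρint : Integrable ρ := hρ1.continuous.integrable_of_hasCompactSupport hρ2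
  obtain ⟨η, hη, hηs, hηd⟩ := exists_primitive (k := fun x => ψ x - A * ρ x)
    (hψ.sub (contDiff_const.mul hρ1)) (c := c) (d := d)
    (fun x hx => by rw [hψI x hx, hρI x hx]; ring)
    (by rw [integral_sub hψint (hρint.const_mul _), integral_const_mul, hρ4, ← hA]; ring)
  have e := hDη η c d hη hca hcd hdb hηs
  have j1 := htest ψ D c d hψ.continuous hca hdb hψI hD
  have j2 := htest ρ D c d hρ1.continuous hca hdb hρI hD
  rw [hηd] at e
  have e' : ∫ x in Ioo a b, ψ x * D x = A * C := by
    have : ∀ x, (ψ x - A * ρ x) * D x = ψ x * D x - A * (ρ x * D x) := fun x => by ring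
    simp only [this] at e
    rw [integral_sub j1 (j2.const_mul _), integral_const_mul] at e
    linarith
  have e2 : ∫ x in Ioo a b, ψ x = A :=
    setIntegral_eq_integral_of_forall_compl_eq_zero fun x hx =>
      image_eq_zero_of_notMem_tsupport fun h => hx (hψs h)
  rw [← setIntegral_eq_integral_of_forall_compl_eq_zero (s := Ioo a b) fun x hx => by
    rw [image_eq_zero_of_notMem_tsupport fun h => hx (hψs h), zero_smul]]
  simp only [smul_eq_mul, mul_sub]
  rw [integral_sub j1 (hψint.integrableOn.mul_const _), integral_mul_const, e', e2, sub_self]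

/-! ### Localisation away from the left endpoint -/

theorem integral_sub_rpow_neg {y c T α : ℝ} (h0 : 0 < α) (hy : y < c) (hc : c ≤ T) :
    IntegrableOn (fun x => (x - y) ^ (-1 - α)) (Ioo c T) ∧
    ∫ x in Ioo c T, (x - y) ^ (-1 - α) = ((c - y) ^ (-α) - (T - y) ^ (-α)) / α := by
  have hn : (0 : ℝ) ∉ uIcc (c - y) (T - y) := by
    rw [uIcc_of_le (by linarith)]; intro h; linarith [h.1]
  have hi : IntervalIntegrable (fun x => (x - y) ^ (-1 - α)) volume c T := by
    have := (intervalIntegral.intervalIntegrable_rpow (μ := volume) (r := -1 - α)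
      (Or.inr hn)).comp_sub_right y
    simpa using this
  refine ⟨(intervalIntegrable_iff_integrableOn_Ioo_of_le hc).1 hi, ?_⟩
  rw [← integral_Ioc_eq_integral_Ioo, ← intervalIntegral.integral_of_le hc,
    intervalIntegral.integral_comp_sub_right (fun x => x ^ (-1 - α)) y,
    integral_rpow (Or.inr ⟨by linarith, hn⟩)]
  rw [show -1 - α + 1 = -α by ring, div_neg, ← neg_div, neg_sub]

theorem integrableOn_mul_of_bound {u k : ℝ → ℝ} {s : Set ℝ} (hs : MeasurableSet s) {M : ℝ}
    (hu : IntegrableOn u s) (hk : Measurable k) (hM : ∀ y ∈ s, |k y| ≤ M) :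
    IntegrableOn (fun y => u y * k y) s := by
  refine Integrable.mul_bdd (c := M) hu hk.aestronglyMeasurable ?_
  filter_upwards [ae_restrict_mem hs] with y hy using hM y hy

/-- The contribution of `(a, c)` to the fractional integral is a primitive on `(c, T)`. -/
theorem far_fubini {a c T α : ℝ} (h0 : 0 < α) (hcT : c ≤ T) {u : ℝ → ℝ}
    (hu : IntegrableOn u (Ioo a c)) (hc : IntegrableOn (fun y => u y * (c - y) ^ (-α)) (Ioo a c)) :
    IntegrableOn (fun x => ∫ y in Ioo a c, u y * (x - y) ^ (-1 - α)) (Ioo c T) ∧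
    α * ∫ x in Ioo c T, ∫ y in Ioo a c, u y * (x - y) ^ (-1 - α)
      = (∫ y in Ioo a c, u y * (c - y) ^ (-α)) - ∫ y in Ioo a c, u y * (T - y) ^ (-α) := by
  have hpos : ∀ y ∈ Ioo a c, 0 < c - y ∧ c - y ≤ T - y := fun y hy =>
    ⟨by linarith [hy.2], by linarith⟩
  have hmono : ∀ y ∈ Ioo a c, (T - y) ^ (-α) ≤ (c - y) ^ (-α) := fun y hy =>
    Real.rpow_le_rpow_of_nonpos (hpos y hy).1 (hpos y hy).2 (by linarith)
  have hmeas : AEStronglyMeasurable (fun p : ℝ × ℝ => u p.1 * (p.2 - p.1) ^ (-1 - α))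
      ((volume.restrict (Ioo a c)).prod (volume.restrict (Ioo c T))) :=
    (hu.aestronglyMeasurable.comp_fst).mul
      ((measurable_snd.sub measurable_fst).pow_const _).aestronglyMeasurable
  have hnorm : ∀ y ∈ Ioo a c, ∫ x in Ioo c T, ‖u y * (x - y) ^ (-1 - α)‖
      = |u y| * (((c - y) ^ (-α) - (T - y) ^ (-α)) / α) := by
    intro y hy
    rw [← (integral_sub_rpow_neg h0 hy.2 hcT).2, ← integral_const_mul]
    refine setIntegral_congr_fun measurableSet_Ioo fun x hx => ?_
    simp only [norm_mul, Real.norm_eq_abs]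
    rw [abs_of_nonneg (Real.rpow_nonneg (by linarith [hy.2, hx.1]) _)]
  have hint : Integrable (fun p : ℝ × ℝ => u p.1 * (p.2 - p.1) ^ (-1 - α))
      ((volume.restrict (Ioo a c)).prod (volume.restrict (Ioo c T))) := by
    rw [integrable_prod_iff hmeas]
    constructor
    · filter_upwards [ae_restrict_mem measurableSet_Ioo] with y hy
      exact (integral_sub_rpow_neg h0 hy.2 hcT).1.const_mul _
    -- Integration in `x` up to the singular endpoint `c` leaves at most `(c - y) ^ (-α) / α`, which
    -- is why absolute convergence of the fractional integral at `c` is assumed.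
    · refine Integrable.mono' (hc.norm.div_const α) hmeas.norm.integral_prod_right' ?_
      filter_upwards [ae_restrict_mem measurableSet_Ioo] with y hy
      have hT0 : 0 ≤ (T - y) ^ (-α) := Real.rpow_nonneg (by linarith [hpos y hy]) _
      have hc0 : 0 ≤ (c - y) ^ (-α) := Real.rpow_nonneg (hpos y hy).1.le _
      rw [hnorm y hy, norm_mul, norm_mul, Real.norm_of_nonneg hc0, Real.norm_eq_abs,
        Real.norm_eq_abs, abs_abs, abs_of_nonneg (div_nonneg (by linarith [hmono y hy]) h0.le),
        mul_div_assoc ‖u y‖]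
      exact mul_le_mul_of_nonneg_left (div_le_div_of_nonneg_right (by linarith) h0.le)
        (abs_nonneg _)
  refine ⟨hint.integral_prod_right, ?_⟩
  rw [← integral_integral_swap (f := fun y x => u y * (x - y) ^ (-1 - α)) hint]
  have hcT' : IntegrableOn (fun y => u y * (T - y) ^ (-α)) (Ioo a c) := by
    refine Integrable.mono' hc.norm (hu.aestronglyMeasurable.mul
      ((measurable_const.sub measurable_id).pow_const _).aestronglyMeasurable) ?_
    filter_upwards [ae_restrict_mem measurableSet_Ioo] with y hy
    have hT0 : 0 ≤ (T - y) ^ (-α) := Real.rpow_nonneg (by linarith [hpos y hy]) _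
    have hc0 : 0 ≤ (c - y) ^ (-α) := Real.rpow_nonneg (hpos y hy).1.le _
    rw [norm_mul, norm_mul, Real.norm_of_nonneg hc0, Real.norm_of_nonneg hT0]
    exact mul_le_mul_of_nonneg_left (hmono y hy) (norm_nonneg _)
  rw [← integral_sub hc hcT', ← integral_const_mul]
  refine setIntegral_congr_fun measurableSet_Ioo fun y hy => ?_
  simp only [integral_const_mul]
  rw [(integral_sub_rpow_neg h0 hy.2 hcT).2]
  field_simp

/-- The density of the fractional integral of `u` restricted to `(c, b)`. -/
def localDensity (a c α : ℝ) (u v : ℝ → ℝ) (z : ℝ) : ℝ :=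
  Real.Gamma (1 - α) * v z + α * ∫ y in Ioo a c, u y * (z - y) ^ (-1 - α)

theorem setIntegral_Ioo_split {k : ℝ → ℝ} {a c x : ℝ} (h1 : a < c) (h2 : c < x)
    (hk : IntegrableOn k (Ioo a x)) :
    ∫ y in Ioo a x, k y = (∫ y in Ioo a c, k y) + ∫ y in Ioo c x, k y := by
  have hi : ∀ p q, p ≤ q → a ≤ p → q ≤ x → IntervalIntegrable k volume p q := fun p q h hp hq =>
    (intervalIntegrable_iff_integrableOn_Ioo_of_le h).2 (hk.mono_set (Ioo_subset_Ioo hp hq))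
  simp only [← integral_Ioc_eq_integral_Ioo]
  rw [← intervalIntegral.integral_of_le h1.le, ← intervalIntegral.integral_of_le h2.le,
    ← intervalIntegral.integral_of_le (h1.trans h2).le,
    intervalIntegral.integral_add_adjacent_intervals (hi _ _ h1.le le_rfl h2.le)
      (hi _ _ h2.le h1.le le_rfl)]

/-- By du Bois-Reymond the fractional integral from `a` is a.e. a constant plus a primitive of `Γ(1
- α) v`. Subtracting its values at `x` and at `c` removes the constant, and `far_fubini` writes the
change of the `(a, c)` contribution as an integral. Hence `c` has to be generic: the identity must
hold at `c` and the fractional integral must converge there. Starting at `c` also avoids integrating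
`v` up to `a`. -/
theorem IsWeakFracDeriv.ae_abelIntegral_eq {α a b : ℝ} (hab : a < b) (h0 : 0 < α) (h1 : α < 1)
    {u v : ℝ → ℝ} (hv : IsWeakFracDeriv .left α a b u v) :
    ∀ᵐ c ∂(volume.restrict (Ioo a b)),
      (∀ d, d < b → IntegrableOn (localDensity a c α u v) (Ioo c d)) ∧
      ∀ᵐ x ∂(volume.restrict (Ioo c b)),
        abelIntegral c (-α) u x = ∫ z in Ioo c x, localDensity a c α u v z := by
  have hFub := triangle_fubini (C := (b - a) ^ (1 - α) / (1 - α)) (G := fun y z => (y - z) ^ (-α))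
    hv.integrableOn (by simp only [Function.uncurry_def]; fun_prop)
    (fun z hz => (integral_sub_rpow (by linarith) hz.2.le).1) (fun z hz => by
      have e : ∫ y in Ioo z b, |(y - z) ^ (-α)| = ∫ y in Ioo z b, (y - z) ^ (-α) :=
        setIntegral_congr_fun measurableSet_Ioo fun y hy =>
          abs_of_nonneg (Real.rpow_nonneg (by linarith [hy.1]) _)
      rw [e, (integral_sub_rpow (by linarith) hz.2.le).2, show -α + 1 = 1 - α by ring]
      have : 0 < 1 - α := by linarith
      have h3 : (b - z) ^ (1 - α) ≤ (b - a) ^ (1 - α) :=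
        Real.rpow_le_rpow (by linarith [hz.2]) (by linarith [hz.1]) (by linarith)
      gcongr)
  have hVl : LocallyIntegrableOn (fun x => Real.Gamma (1 - α) * v x) (Ioo a b) :=
    hv.locallyIntegrableOn.smul (Real.Gamma (1 - α))
  obtain ⟨C, hC⟩ := ae_eq_const_add_primitive (m := (a + b) / 2) hab
    (F := abelIntegral a (-α) u) (hFub.2.1.locallyIntegrableOn) hVl
    ⟨by linarith, by linarith⟩ (fun η hη hc hs => hv.integral_abelIntegral h1 hη hc hs)
  have hm : (a + b) / 2 ∈ Ioo a b := ⟨by linarith, by linarith⟩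
  filter_upwards [ae_restrict_mem measurableSet_Ioo, hFub.1, hC] with c hc hci hcF
  have huc : IntegrableOn u (Ioo a c) := hv.integrableOn.mono_set (Ioo_subset_Ioo le_rfl hc.2.le)
  have hdens : ∀ d, d < b → IntegrableOn (fun x => Real.Gamma (1 - α) * v x) (Ioo c d) :=
    fun d hd => (integrableOn_Icc_of_locallyIntegrableOn hVl hc.1 hd).mono_set Ioo_subset_Icc_self
  have hfar : ∀ T, IntegrableOn (fun x => ∫ y in Ioo a c, u y * (x - y) ^ (-1 - α)) (Ioo c T) := by
    intro T
    rcases le_total c T with h | h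
    · exact (far_fubini h0 h huc hci).1
    · simp [Ioo_eq_empty (not_lt.2 h)]
  refine ⟨fun d hd => (hdens d hd).add ((hfar d).const_mul α), ?_⟩
  have hsub : Ioo c b ⊆ Ioo a b := Ioo_subset_Ioo hc.1.le le_rfl
  filter_upwards [ae_restrict_mem measurableSet_Ioo, ae_restrict_of_ae_restrict_of_subset hsub hFub.1,
    ae_restrict_of_ae_restrict_of_subset hsub hC] with x hx hxi hxF
  have e1 : abelIntegral a (-α) u x
      = (∫ y in Ioo a c, u y * (x - y) ^ (-α)) + abelIntegral c (-α) u x :=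
    setIntegral_Ioo_split hc.1 hx.1 hxi
  have e2 := (far_fubini h0 hx.1.le huc hci).2
  have e3 : ∫ z in Ioo c x, localDensity a c α u v z = (∫ t in c..x, Real.Gamma (1 - α) * v t)
      + α * ∫ z in Ioo c x, ∫ y in Ioo a c, u y * (z - y) ^ (-1 - α) := by
    rw [intervalIntegral.integral_of_le hx.1.le, integral_Ioc_eq_integral_Ioo,
      ← integral_const_mul, ← integral_add (hdens x hx.2) ((hfar x).const_mul α)]
    rfl
  have e4 := intervalIntegral.integral_add_adjacent_intervals
    (intervalIntegrable_of_locallyIntegrableOn hVl hm hc)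
    (intervalIntegrable_of_locallyIntegrableOn hVl hc (hsub hx))
  have e5 : abelIntegral a (-α) u c = ∫ y in Ioo a c, u y * (c - y) ^ (-α) := rfl
  linarith

/-! ### Abel inversion -/

/-- Abel inversion. -/
theorem abel_inversion {c d α : ℝ} (h0 : 0 < α) (h1 : α < 1) (hcd : c < d) {u h : ℝ → ℝ}
    (hu : IntegrableOn u (Ioo c d)) (hh : IntegrableOn h (Ioo c d))
    (he : ∀ᵐ x ∂(volume.restrict (Ioo c d)), abelIntegral c (-α) u x = ∫ z in Ioo c x, h z) :
    ∀ᵐ x ∂(volume.restrict (Ioo c d)),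
      IntegrableOn (fun z => h z * (x - z) ^ (α - 1)) (Ioo c x) ∧
      betaConst α * u x = abelIntegral c (α - 1) h x := by
  have hα : -1 < α - 1 := by linarith
  have hbd : ∀ x, ∀ z ∈ Ioo c x, (x - z) ^ α / α ≤ (x - c) ^ α / α := fun x z hz => by
    have : (x - z) ^ α ≤ (x - c) ^ α :=
      Real.rpow_le_rpow (by linarith [hz.2]) (by linarith [hz.1]) h0.le
    gcongr
  -- The three statements are inferred from `triangle_fubini` on `(c, x)`, applied to the kernels
  -- `(y - z) ^ (α - 1)`, `(x - y) ^ (α - 1)` and the Beta kernel.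
  have T3 : ∀ x ≤ d, _ := fun x (hx : x ≤ d) =>
    triangle_fubini (c := c) (T := x) (C := (x - c) ^ α / α)
    (G := fun y z => (y - z) ^ (α - 1)) (hh.mono_set (Ioo_subset_Ioo le_rfl hx))
    (by simp only [Function.uncurry_def]; fun_prop)
    (fun z hz => (integral_sub_rpow hα hz.2.le).1) (fun z hz => by
      have e : ∫ y in Ioo z x, |(y - z) ^ (α - 1)| = ∫ y in Ioo z x, (y - z) ^ (α - 1) :=
        setIntegral_congr_fun measurableSet_Ioo fun y hy =>
          abs_of_nonneg (Real.rpow_nonneg (by linarith [hy.1]) _)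
      rw [e, (integral_sub_rpow hα hz.2.le).2, sub_add_cancel]
      exact hbd x z hz)
  have T2 : ∀ x ≤ d, _ := fun x (hx : x ≤ d) =>
    triangle_fubini (c := c) (T := x) (C := (x - c) ^ α / α)
    (G := fun y _ => (x - y) ^ (α - 1)) (hh.mono_set (Ioo_subset_Ioo le_rfl hx))
    (by simp only [Function.uncurry_def]; fun_prop)
    (fun z hz => (integral_rsub_rpow hα hz.2.le).1) (fun z hz => by
      have e : ∫ y in Ioo z x, |(x - y) ^ (α - 1)| = ∫ y in Ioo z x, (x - y) ^ (α - 1) :=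
        setIntegral_congr_fun measurableSet_Ioo fun y hy =>
          abs_of_nonneg (Real.rpow_nonneg (by linarith [hy.2]) _)
      rw [e, (integral_rsub_rpow hα hz.2.le).2, sub_add_cancel]
      exact hbd x z hz)
  have T1 : ∀ x ≤ d, _ := fun x (hx : x ≤ d) =>
    triangle_fubini (c := c) (T := x) (C := betaConst α)
    (G := fun y z => (x - y) ^ (α - 1) * (y - z) ^ (-α)) (hu.mono_set (Ioo_subset_Ioo le_rfl hx))
    (by simp only [Function.uncurry_def]; fun_prop)
    (fun z hz => (integral_beta h0 h1 hz.2).1) (fun z hz => by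
      rw [← (integral_beta h0 h1 hz.2).2]
      refine (setIntegral_congr_fun measurableSet_Ioo fun y hy => ?_).le
      exact abs_of_nonneg (mul_nonneg (Real.rpow_nonneg (by linarith [hy.2]) _)
        (Real.rpow_nonneg (by linarith [hy.1]) _)))
  have hW : IntegrableOn (fun y => betaConst α * u y - abelIntegral c (α - 1) h y) (Ioo c d) :=
    (hu.const_mul _).sub (T3 d le_rfl).2.1
  -- Both terms are compared after integration over `(c, x)`. Composing the two fractional kernels
  -- gives `B ∫ u` by the Beta integral, and by the hypothesis also `∫∫ h(z) (x - y) ^ (α - 1)`. The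
  -- latter is the integral of the claimed right side, because `(y - z) ^ (α - 1)` and `(x - y) ^ (α
  -- - 1)` have the same integral over `(z, x)`. Lebesgue differentiation then removes the
  -- integration.
  have hzero : ∀ x ∈ Ioo c d,
      ∫ y in Ioo c x, (betaConst α * u y - abelIntegral c (α - 1) h y) = 0 := by
    intro x hx
    have hA : IntegrableOn (abelIntegral c (α - 1) h) (Ioo c x) := (T3 x hx.2.le).2.1
    rw [integral_sub ((hu.mono_set (Ioo_subset_Ioo le_rfl hx.2.le)).const_mul _) hA]
    have a3 := (T3 x hx.2.le).2.2
    have a2 := (T2 x hx.2.le).2.2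
    have a1 := (T1 x hx.2.le).2.2
    have b3 : ∫ z in Ioo c x, h z * ∫ y in Ioo z x, (y - z) ^ (α - 1)
        = ∫ z in Ioo c x, h z * ∫ y in Ioo z x, (x - y) ^ (α - 1) :=
      setIntegral_congr_fun measurableSet_Ioo fun z hz => by
        simp only [(integral_sub_rpow hα hz.2.le).2, (integral_rsub_rpow hα hz.2.le).2]
    have b1 : ∫ z in Ioo c x, u z * ∫ y in Ioo z x, (x - y) ^ (α - 1) * (y - z) ^ (-α)
        = ∫ y in Ioo c x, betaConst α * u y :=
      setIntegral_congr_fun measurableSet_Ioo fun z hz => by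
        simp only [(integral_beta h0 h1 hz.2).2]; ring
    have b2 : ∫ y in Ioo c x, ∫ z in Ioo c y, u z * ((x - y) ^ (α - 1) * (y - z) ^ (-α))
        = ∫ y in Ioo c x, ∫ z in Ioo c y, h z * (x - y) ^ (α - 1) := by
      refine integral_congr_ae ?_
      filter_upwards [ae_restrict_of_ae_restrict_of_subset (Ioo_subset_Ioo le_rfl hx.2.le) he]
        with y hy
      rw [integral_mul_const, ← hy, abelIntegral, ← integral_mul_const]
      congr 1; ext z; ring
    rw [← b1, ← a1, b2, a2, ← b3, ← a3]
    exact sub_self _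
  have hWi : IntervalIntegrable (fun y => betaConst α * u y - abelIntegral c (α - 1) h y)
      volume c d := (intervalIntegrable_iff_integrableOn_Ioo_of_le hcd.le).2 hW
  have hD := hWi.ae_hasDerivAt_integral
  filter_upwards [ae_restrict_mem measurableSet_Ioo, (T3 d le_rfl).1, ae_restrict_of_ae hD]
    with x hx hxi hxd
  refine ⟨hxi, ?_⟩
  have d1 := hxd (by rw [uIcc_of_le hcd.le]; exact Ioo_subset_Icc_self hx) c left_mem_uIcc
  have d2 : (fun y => ∫ t in c..y, (betaConst α * u t - abelIntegral c (α - 1) h t))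
      =ᶠ[𝓝 x] fun _ => 0 := by
    filter_upwards [Ioo_mem_nhds hx.1 hx.2] with y hy
    rw [intervalIntegral.integral_of_le hy.1.le, integral_Ioc_eq_integral_Ioo, hzero y hy]
  have d3 := d1.unique ((hasDerivAt_const x (0:ℝ)).congr_of_eventuallyEq d2)
  linarith

/-! ### The truncated Marchaud derivative as an average of the density -/

/-- The truncated Marchaud derivative, up to the factor `1 / Γ(1 - α)`. -/
def marchaudTrunc (a α ε : ℝ) (u : ℝ → ℝ) (x : ℝ) : ℝ :=
  ε ^ (-α) * u x - α * ∫ y in Ioo a (x - ε), u y * (x - y) ^ (-1 - α)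

/-- The kernel that expresses the truncated Marchaud derivative of a fractional integral. -/
def marchaudKernel (α t : ℝ) : ℝ := (t ^ α - (max (t - 1) 0) ^ α) / t

/-- The inner integral that appears when the Abel representation of `u` is inserted in the truncated
Marchaud integral. It is elementary because `(y - z) / (x - y)` has derivative `(x - z) / (x - y) ^
2`, so its power `α`, divided by `α (x - z)`, is a primitive. -/
theorem integral_mixed {α z T x : ℝ} (h0 : 0 < α) (hz : z < T) (hT : T < x) :
    IntegrableOn (fun y => (x - y) ^ (-1 - α) * (y - z) ^ (α - 1)) (Ioo z T) ∧
    ∫ y in Ioo z T, (x - y) ^ (-1 - α) * (y - z) ^ (α - 1)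
      = ((T - z) / (x - T)) ^ α / (α * (x - z)) := by
  have hi : IntegrableOn (fun y => (x - y) ^ (-1 - α) * (y - z) ^ (α - 1)) (Ioo z T) := by
    have := integrableOn_mul_of_bound (k := fun y => (x - y) ^ (-1 - α)) (M := (x - T) ^ (-1 - α))
      measurableSet_Ioo (integral_sub_rpow (z := z) (T := T) (p := α - 1) (by linarith) hz.le).1
      ((measurable_const.sub measurable_id).pow_const _) (fun y hy => by
        rw [abs_of_nonneg (Real.rpow_nonneg (by linarith [hy.2]) _)]
        exact Real.rpow_le_rpow_of_nonpos (by linarith) (by linarith [hy.2]) (by linarith))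
    simpa only [mul_comm] using this
  refine ⟨hi, ?_⟩
  rw [← integral_Ioc_eq_integral_Ioo, ← intervalIntegral.integral_of_le hz.le,
    intervalIntegral.integral_eq_sub_of_hasDerivAt_of_le hz.le
      (f := fun y => ((y - z) / (x - y)) ^ α / (α * (x - z)))]
  · simp [h0.ne']
  · refine ContinuousOn.div_const (ContinuousOn.rpow_const ?_ fun _ _ => Or.inr h0.le) _
    refine ContinuousOn.div (by fun_prop) (by fun_prop) fun y hy => ?_
    have := hy.2; linarith
  · intro y hy
    have p1 : 0 < y - z := by linarith [hy.1]
    have p2 : 0 < x - y := by linarith [hy.2]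
    have p3 : 0 < x - z := by linarith
    have d1 : HasDerivAt (fun y => (y - z) / (x - y)) ((x - z) / (x - y) ^ 2) y := by
      have := ((hasDerivAt_id y).sub_const z).div ((hasDerivAt_id y).const_sub x) p2.ne'
      refine this.congr_deriv ?_
      simp only [id_eq]; field_simp; ring
    refine ((d1.rpow_const (p := α) (Or.inl (by positivity))).div_const _).congr_deriv ?_
    have e2 : (x - y) ^ (-1 - α) = ((x - y) * (x - y) ^ α)⁻¹ := by
      rw [← Real.rpow_one_add' p2.le (by positivity), ← Real.rpow_neg p2.le]; ring_nf
    rw [Real.div_rpow p1.le p2.le, Real.rpow_sub_one p2.ne', e2]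
    have := Real.rpow_pos_of_pos p2 α
    field_simp
  · exact (intervalIntegrable_iff_integrableOn_Ioo_of_le hz.le).2 hi

/-- The truncated Marchaud derivative of a fractional integral is an average of the density. -/
theorem marchaudTrunc_eq {c d α x ε : ℝ} (h0 : 0 < α) {u h : ℝ → ℝ}
    (hh : IntegrableOn h (Ioo c d)) (hx : x ∈ Ioo c d) (hε : 0 < ε) (hεx : ε < x - c)
    (hi : IntegrableOn (fun z => h z * (x - z) ^ (α - 1)) (Ioo c x))
    (hex : betaConst α * u x = abelIntegral c (α - 1) h x)
    (hae : ∀ᵐ y ∂(volume.restrict (Ioo c x)), betaConst α * u y = abelIntegral c (α - 1) h y) :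
    betaConst α * marchaudTrunc c α ε u x
      = ∫ t in Ioi (0 : ℝ), (Ioo c d).indicator h (x - ε * t) * marchaudKernel α t := by
  have hcT : c < x - ε := by linarith
  have hTx : x - ε < x := by linarith
  have hcx : Ioo c (x - ε) ⊆ Ioo c x := Ioo_subset_Ioo le_rfl hTx.le
  have hF := (triangle_fubini (c := c) (T := x - ε) (C := ((x - ε - c) / ε) ^ α / (α * ε))
    (G := fun y z => (x - y) ^ (-1 - α) * (y - z) ^ (α - 1)) (f := h)
    (hh.mono_set (Ioo_subset_Ioo le_rfl (hTx.le.trans hx.2.le)))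
    (by simp only [Function.uncurry_def]; fun_prop)
    (fun z hz => (integral_mixed h0 hz.2 hTx).1) (fun z hz => by
      have e : ∫ y in Ioo z (x - ε), |(x - y) ^ (-1 - α) * (y - z) ^ (α - 1)|
          = ∫ y in Ioo z (x - ε), (x - y) ^ (-1 - α) * (y - z) ^ (α - 1) :=
        setIntegral_congr_fun measurableSet_Ioo fun y hy => abs_of_nonneg (mul_nonneg
          (Real.rpow_nonneg (by linarith [hy.2]) _) (Real.rpow_nonneg (by linarith [hy.1]) _))
      rw [e, (integral_mixed h0 hz.2 hTx).2, sub_sub_cancel]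
      have q1 : ((x - ε - z) / ε) ^ α ≤ ((x - ε - c) / ε) ^ α :=
        Real.rpow_le_rpow (div_nonneg (by linarith [hz.2]) hε.le)
          (div_le_div_of_nonneg_right (by linarith [hz.1]) hε.le) h0.le
      have q2 : α * ε ≤ α * (x - z) := by
        apply mul_le_mul_of_nonneg_left _ h0.le; linarith [hz.2]
      have q3 : 0 ≤ ((x - ε - c) / ε) ^ α :=
        Real.rpow_nonneg (div_nonneg (by linarith) hε.le) _
      gcongr)).2
  have e1 : betaConst α * ∫ y in Ioo c (x - ε), u y * (x - y) ^ (-1 - α)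
      = ∫ z in Ioo c (x - ε), h z * (((x - ε - z) / ε) ^ α / (α * (x - z))) := by
    have : ∫ z in Ioo c (x - ε), h z * (((x - ε - z) / ε) ^ α / (α * (x - z)))
        = ∫ z in Ioo c (x - ε), h z * ∫ y in Ioo z (x - ε),
          (x - y) ^ (-1 - α) * (y - z) ^ (α - 1) :=
      setIntegral_congr_fun measurableSet_Ioo fun z hz => by
        simp only [(integral_mixed h0 hz.2 hTx).2, sub_sub_cancel]
    rw [this, ← hF.2, ← integral_const_mul]
    refine integral_congr_ae ?_
    filter_upwards [ae_restrict_of_ae_restrict_of_subset hcx hae] with y hy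
    rw [← mul_assoc, hy, abelIntegral, ← integral_mul_const]
    congr 1; ext z; ring
  -- The average written in the variable `z = x - ε t`. The half-line `t > 0` becomes `z < x`, and
  -- the indicator of `(c, d)` then leaves `(c, x)`.
  set k : ℝ → ℝ := (Ioo c x).indicator (fun z => h z * (ε⁻¹ * marchaudKernel α ((x - z) / ε)))
    with hk
  have e2 : ∫ t in Ioi (0 : ℝ), (Ioo c d).indicator h (x - ε * t) * marchaudKernel α t
      = ∫ z, k z := by
    have a1 := Measure.integral_comp_mul_left (fun s => k (x - s)) ε
    rw [integral_sub_left_eq_self k, abs_of_pos (inv_pos.2 hε), smul_eq_mul] at a1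
    have a2 : ∫ z, k z = ∫ t, ε * k (x - ε * t) := by
      rw [integral_const_mul, a1]; field_simp
    rw [a2, ← integral_indicator measurableSet_Ioi]
    congr 1
    ext t
    by_cases ht : 0 < t
    · have hlt : x - ε * t < x := by nlinarith
      rw [indicator_of_mem (show t ∈ Ioi (0:ℝ) from ht), hk]
      by_cases hm : c < x - ε * t
      · rw [indicator_of_mem (show x - ε * t ∈ Ioo c d from ⟨hm, hlt.trans hx.2⟩),
          indicator_of_mem (show x - ε * t ∈ Ioo c x from ⟨hm, hlt⟩), sub_sub_cancel,
          mul_div_cancel_left₀ _ hε.ne']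
        field_simp
      · rw [indicator_of_notMem fun h' => hm h'.1, indicator_of_notMem fun h' => hm h'.1]
        simp
    · have hlt : x ≤ x - ε * t := by nlinarith
      rw [indicator_of_notMem (show t ∉ Ioi (0:ℝ) from ht), hk,
        indicator_of_notMem fun h' => absurd h'.2 (not_lt.2 hlt), mul_zero]
  -- The two terms of the kernel are separated: `t ^ α / t` reproduces `ε ^ (-α)` times the Abel
  -- integral of `h`, and the positive part is supported in `z < x - ε`, where it gives the
  -- truncated integral of `u` computed in `e1`.
  have e3 : ∫ z, k z = (∫ z in Ioo c x, ε ^ (-α) * (h z * (x - z) ^ (α - 1)))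
      - ∫ z in Ioo c (x - ε), α * (h z * (((x - ε - z) / ε) ^ α / (α * (x - z)))) := by
    have b2 : ∫ z in Ioo c (x - ε), α * (h z * (((x - ε - z) / ε) ^ α / (α * (x - z))))
        = ∫ z in Ioo c x, (Iio (x - ε)).indicator
          (fun z => α * (h z * (((x - ε - z) / ε) ^ α / (α * (x - z))))) z := by
      rw [setIntegral_indicator measurableSet_Iio]
      congr 2
      ext z; simp only [mem_inter_iff, mem_Ioo, mem_Iio]
      exact ⟨fun h' => ⟨⟨h'.1, h'.2.trans hTx⟩, h'.2⟩, fun h' => ⟨h'.1.1, h'.2⟩⟩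
    have hi2 : IntegrableOn (fun z => (Iio (x - ε)).indicator
          (fun z => α * (h z * (((x - ε - z) / ε) ^ α / (α * (x - z))))) z) (Ioo c x) := by
      rw [IntegrableOn, integrable_indicator_iff measurableSet_Iio, IntegrableOn,
        Measure.restrict_restrict measurableSet_Iio]
      have hs : Iio (x - ε) ∩ Ioo c x = Ioo c (x - ε) := by
        ext z; simp only [mem_inter_iff, mem_Ioo, mem_Iio]
        exact ⟨fun h' => ⟨h'.2.1, h'.1⟩, fun h' => ⟨h'.2, h'.1, h'.2.trans hTx⟩⟩
      rw [hs]
      refine Integrable.const_mul ?_ _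
      refine integrableOn_mul_of_bound (M := ((x - ε - c) / ε) ^ α / (α * ε)) measurableSet_Ioo
        (hh.mono_set (Ioo_subset_Ioo le_rfl (hTx.le.trans hx.2.le))) ?_ fun z hz => ?_
      · exact (((measurable_const.sub measurable_id).div_const _).pow_const _).div
          ((measurable_const.sub measurable_id).const_mul _)
      · have q1 : ((x - ε - z) / ε) ^ α ≤ ((x - ε - c) / ε) ^ α :=
          Real.rpow_le_rpow (div_nonneg (by linarith [hz.2]) hε.le)
            (div_le_div_of_nonneg_right (by linarith [hz.1]) hε.le) h0.le
        have q2 : α * ε ≤ α * (x - z) := by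
          apply mul_le_mul_of_nonneg_left _ h0.le; linarith [hz.2]
        have q3 : 0 ≤ ((x - ε - c) / ε) ^ α :=
          Real.rpow_nonneg (div_nonneg (by linarith) hε.le) _
        have q4 : 0 ≤ ((x - ε - z) / ε) ^ α :=
          Real.rpow_nonneg (div_nonneg (by linarith [hz.2]) hε.le) _
        have q5 : 0 < α * (x - z) := lt_of_lt_of_le (by positivity) q2
        rw [abs_of_nonneg (div_nonneg q4 q5.le)]
        gcongr
    rw [b2, ← integral_sub (hi.const_mul _) hi2, hk, integral_indicator measurableSet_Ioo]
    refine setIntegral_congr_fun measurableSet_Ioo fun z hz => ?_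
    have p : 0 < x - z := by linarith [hz.2]
    have w1 : ε⁻¹ * (((x - z) / ε) ^ α / ((x - z) / ε)) = ε ^ (-α) * (x - z) ^ (α - 1) := by
      rw [Real.div_rpow p.le hε.le, Real.rpow_neg hε.le, Real.rpow_sub_one p.ne']
      field_simp
    simp only [marchaudKernel]
    by_cases hzT : z < x - ε
    · rw [indicator_of_mem (show z ∈ Iio (x - ε) from hzT)]
      have : max ((x - z) / ε - 1) 0 = (x - ε - z) / ε := by
        rw [max_eq_left]
        · field_simp; ring
        · rw [sub_nonneg, one_le_div hε]; linarith
      rw [this, sub_div, mul_sub, w1]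
      field_simp
    · rw [indicator_of_notMem (show z ∉ Iio (x - ε) from hzT)]
      have : max ((x - z) / ε - 1) 0 = 0 := by
        rw [max_eq_right]
        rw [sub_nonpos, div_le_one hε]; linarith [not_lt.1 hzT]
      rw [this, Real.zero_rpow h0.ne', sub_zero, w1]
      ring
  rw [e2, e3, integral_const_mul, integral_const_mul, ← e1, marchaudTrunc]
  have : ∫ z in Ioo c x, h z * (x - z) ^ (α - 1) = betaConst α * u x := hex.symm
  rw [this]; ring

/-! ### Size and mass of the kernel -/

theorem marchaudKernel_of_le_one {α t : ℝ} (h0 : 0 < α) (ht : 0 < t) (h : t ≤ 1) :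
    marchaudKernel α t = t ^ (α - 1) := by
  rw [marchaudKernel, max_eq_right (by linarith), Real.zero_rpow h0.ne', sub_zero,
    Real.rpow_sub_one ht.ne']

theorem marchaudKernel_nonneg {α t : ℝ} (h0 : 0 < α) (ht : 0 < t) : 0 ≤ marchaudKernel α t :=
  div_nonneg (sub_nonneg.2 (Real.rpow_le_rpow (le_max_right _ _)
    (max_le (by linarith) ht.le) h0.le)) ht.le

/-- With `r = 1 - 1/t` in `(0, 1)` one has `r ≤ r ^ α`; multiplication by `t ^ α` gives the bound.
-/
theorem rpow_sub_rpow_le {α t : ℝ} (h1 : α < 1) (ht : 1 < t) :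
    t ^ α - (t - 1) ^ α ≤ t ^ (α - 1) := by
  have t0 : 0 < t := by linarith
  have e : t - 1 = t * (1 - 1 / t) := by field_simp
  have p : 0 < 1 - 1 / t := by rw [sub_pos, div_lt_one t0]; exact ht
  have q : 1 - 1 / t ≤ (1 - 1 / t) ^ α := by
    have := Real.rpow_le_rpow_of_exponent_ge p (by linarith [one_div_pos.2 t0]) h1.le
    rwa [Real.rpow_one] at this
  rw [e, Real.mul_rpow t0.le p.le, Real.rpow_sub_one t0.ne']
  have r := Real.rpow_pos_of_pos t0 α
  have : t ^ α * (1 - 1 / t) ≤ t ^ α * (1 - 1 / t) ^ α := mul_le_mul_of_nonneg_left q r.le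
  have e3 : t ^ α * (1 - 1 / t) = t ^ α - t ^ α / t := by ring
  linarith

theorem marchaudKernel_le {α t : ℝ} (h1 : α < 1) (ht : 1 < t) :
    marchaudKernel α t ≤ t ^ (α - 2) := by
  have t0 : 0 < t := by linarith
  rw [marchaudKernel, max_eq_left (by linarith), show α - 2 = α - 1 - 1 by ring,
    Real.rpow_sub_one t0.ne']
  exact div_le_div_of_nonneg_right (rpow_sub_rpow_le h1 ht) t0.le

/-- The inversion `t ↦ 1/t` carries the Beta integral on `(0, 1)` to this one. -/
theorem integral_Ioi_betaConst {α : ℝ} (h0 : 0 < α) (h1 : α < 1) :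
    IntegrableOn (fun t : ℝ => (t - 1) ^ (α - 1) / t) (Ioi 1) ∧
    ∫ t in Ioi (1 : ℝ), (t - 1) ^ (α - 1) / t = betaConst α := by
  have him : (fun t : ℝ => t⁻¹) '' Ioo 0 1 = Ioi 1 := by
    ext y; constructor
    · rintro ⟨t, ht, rfl⟩
      exact (one_lt_inv₀ ht.1).2 ht.2
    · intro hy
      have hy : 1 < y := hy
      exact ⟨y⁻¹, ⟨by positivity, inv_lt_one_of_one_lt₀ hy⟩, inv_inv y⟩
  have hder : ∀ t ∈ Ioo (0:ℝ) 1, HasDerivWithinAt (fun t : ℝ => t⁻¹) (-(t ^ 2)⁻¹) (Ioo 0 1) t :=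
    fun t ht => (hasDerivAt_inv ht.1.ne').hasDerivWithinAt
  have hinj : InjOn (fun t : ℝ => t⁻¹) (Ioo 0 1) := fun s _ t _ h => inv_injective h
  have key : ∀ t ∈ Ioo (0:ℝ) 1, |-(t ^ 2)⁻¹| • ((t⁻¹ - 1) ^ (α - 1) / t⁻¹)
      = t ^ (-α) * (1 - t) ^ (α - 1) := by
    intro t ht
    have p : 0 < t := ht.1
    rw [abs_neg, abs_of_pos (by positivity), show t⁻¹ - 1 = (1 - t) / t by field_simp,
      Real.div_rpow (by linarith [ht.2]) p.le, Real.rpow_sub_one p.ne', Real.rpow_neg p.le,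
      smul_eq_mul]
    field_simp
  rw [← him, integrableOn_image_iff_integrableOn_abs_deriv_smul measurableSet_Ioo hder hinj,
    integral_image_eq_integral_abs_deriv_smul measurableSet_Ioo hder hinj]
  exact ⟨(integrableOn_betaConst h0 h1).congr_fun (fun t ht => (key t ht).symm) measurableSet_Ioo,
    setIntegral_congr_fun measurableSet_Ioo key⟩

/-- On `(0, 1]` the kernel is `t ^ (α - 1)`, of mass `1/α`. On `(1, ∞)` it is the Beta integrand `(t
- 1) ^ (α - 1) / t` plus the derivative of `(t ^ α - (t - 1) ^ α) / α`, which decreases from `1/α`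
to `0`. The contributions `1/α` and `-1/α` cancel. -/
theorem integral_marchaudKernel {α : ℝ} (h0 : 0 < α) (h1 : α < 1) :
    IntegrableOn (marchaudKernel α) (Ioi 0) ∧ ∫ t in Ioi (0:ℝ), marchaudKernel α t = betaConst α := by
  have hm : ContinuousWithinAt (fun t : ℝ => (t ^ α - (t - 1) ^ α) / α) (Ici 1) 1 := by
    refine Continuous.continuousWithinAt ?_
    have := Real.continuous_rpow_const h0.le
    exact (this.sub (this.comp (continuous_id.sub continuous_const))).div_const _
  have hd : ∀ t ∈ Ioi (1:ℝ), HasDerivAt (fun t : ℝ => (t ^ α - (t - 1) ^ α) / α)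
      (t ^ (α - 1) - (t - 1) ^ (α - 1)) t := by
    intro t ht
    have ht : 1 < t := ht
    have d1 := (hasDerivAt_id t).rpow_const (p := α) (Or.inl (by simp; linarith))
    have d2 := ((hasDerivAt_id t).sub_const 1).rpow_const (p := α) (Or.inl (by simp; linarith))
    refine ((d1.sub d2).div_const α).congr_deriv ?_
    simp only [id_eq]
    field_simp
  have hneg : ∀ t ∈ Ioi (1:ℝ), t ^ (α - 1) - (t - 1) ^ (α - 1) ≤ 0 := by
    intro t ht
    have ht : 1 < t := ht
    exact sub_nonpos.2 (Real.rpow_le_rpow_of_nonpos (by linarith) (by linarith) (by linarith))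
  have hlim : Tendsto (fun t : ℝ => (t ^ α - (t - 1) ^ α) / α) atTop (𝓝 0) := by
    have : Tendsto (fun t : ℝ => t ^ (α - 1) / α) atTop (𝓝 0) := by
      have := (tendsto_rpow_neg_atTop (y := 1 - α) (by linarith)).div_const α
      simpa using this
    refine tendsto_of_tendsto_of_tendsto_of_le_of_le' tendsto_const_nhds this ?_ ?_
    · filter_upwards [eventually_gt_atTop 1] with t ht
      exact div_nonneg (sub_nonneg.2 (Real.rpow_le_rpow (by linarith) (by linarith) h0.le)) h0.le
    · filter_upwards [eventually_gt_atTop 1] with t ht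
      exact div_le_div_of_nonneg_right (rpow_sub_rpow_le h1 ht) h0.le
  have i2 := integrableOn_Ioi_deriv_of_nonpos hm hd hneg hlim
  have v2 := integral_Ioi_of_hasDerivAt_of_nonpos hm hd hneg hlim
  obtain ⟨i1, v1⟩ := integral_Ioi_betaConst h0 h1
  have i3 : IntegrableOn (fun t : ℝ => t ^ (α - 1)) (Ioc 0 1) := by
    rw [integrableOn_Ioc_iff_integrableOn_Ioo]
    simpa using (integral_sub_rpow (z := 0) (T := 1) (p := α - 1) (by linarith) zero_le_one).1
  have v3 : ∫ t in Ioc (0:ℝ) 1, t ^ (α - 1) = 1 / α := by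
    rw [integral_Ioc_eq_integral_Ioo]
    simpa using (integral_sub_rpow (z := 0) (T := 1) (p := α - 1) (by linarith) zero_le_one).2
  have k1 : EqOn (fun t : ℝ => t ^ (α - 1)) (marchaudKernel α) (Ioc 0 1) := fun t ht =>
    (marchaudKernel_of_le_one h0 ht.1 ht.2).symm
  have k2 : EqOn (fun t : ℝ => (t - 1) ^ (α - 1) / t + (t ^ (α - 1) - (t - 1) ^ (α - 1)))
      (marchaudKernel α) (Ioi 1) := by
    intro t ht
    have ht : 1 < t := ht
    simp only [marchaudKernel]
    rw [max_eq_left (by linarith), Real.rpow_sub_one (by linarith), Real.rpow_sub_one (by linarith)]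
    have : t ≠ 0 := by linarith
    have : t - 1 ≠ 0 := by linarith
    field_simp; ring
  have j1 := i3.congr_fun k1 measurableSet_Ioc
  have j2 := (i1.add i2).congr_fun k2 measurableSet_Ioi
  have hU : Ioc (0:ℝ) 1 ∪ Ioi 1 = Ioi 0 := Ioc_union_Ioi_eq_Ioi zero_le_one
  rw [← hU]
  refine ⟨j1.union j2, ?_⟩
  rw [setIntegral_union (Ioc_disjoint_Ioi le_rfl) measurableSet_Ioi j1 j2,
    ← setIntegral_congr_fun measurableSet_Ioc k1, ← setIntegral_congr_fun measurableSet_Ioi k2,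
    integral_add i1 i2, v1, v2, v3]
  simp [h0.ne']

/-! ### Convergence of the averages at Lebesgue points -/

/-- Layer-cake form of Tonelli's theorem on `0 < t < r`. -/
theorem lintegral_layer {φ ν : ℝ → ℝ≥0∞} (hφ : AEMeasurable φ) (hν : Measurable ν) :
    ∫⁻ t in Ioi (0:ℝ), φ t * ∫⁻ r in Ioi t, ν r
      = ∫⁻ r in Ioi (0:ℝ), ν r * ∫⁻ t in Ioo 0 r, φ t := by
  set Φ : ℝ → ℝ → ℝ≥0∞ := fun t r => {p : ℝ × ℝ | p.1 < p.2}.indicator (fun p => φ p.1 * ν p.2) (t, r)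
    with hΦ
  have hm : AEMeasurable (Function.uncurry Φ)
      ((volume.restrict (Ioi (0:ℝ))).prod (volume.restrict (Ioi (0:ℝ)))) := by
    refine AEMeasurable.indicator ?_ (measurableSet_lt measurable_fst measurable_snd)
    exact (hφ.restrict.comp_fst).mul (hν.comp measurable_snd).aemeasurable
  have h1 : ∀ t, (fun r => Φ t r) = (Ioi t).indicator (fun r => φ t * ν r) := by
    intro t; ext r; simp [hΦ, indicator]
  have h2 : ∀ r, (fun t => Φ t r) = (Iio r).indicator (fun t => ν r * φ t) := by
    intro r; ext t; simp [hΦ, indicator, mul_comm]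
  have e := lintegral_lintegral_swap hm
  have e1 : ∫⁻ t in Ioi (0:ℝ), φ t * ∫⁻ r in Ioi t, ν r
      = ∫⁻ t in Ioi (0:ℝ), ∫⁻ r in Ioi (0:ℝ), Φ t r := by
    refine setLIntegral_congr_fun measurableSet_Ioi fun t ht => ?_
    have ht : 0 < t := ht
    simp only [h1]
    rw [setLIntegral_indicator measurableSet_Ioi, Ioi_inter_Ioi, max_eq_left ht.le,
      lintegral_const_mul _ hν]
  have e2 : ∫⁻ r in Ioi (0:ℝ), ν r * ∫⁻ t in Ioo 0 r, φ t
      = ∫⁻ r in Ioi (0:ℝ), ∫⁻ t in Ioi (0:ℝ), Φ t r := by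
    refine setLIntegral_congr_fun measurableSet_Ioi fun r hr => ?_
    simp only [h2]
    rw [setLIntegral_indicator measurableSet_Iio, inter_comm, Ioi_inter_Iio,
      lintegral_const_mul'' _ hφ.restrict]
  rw [e1, e2]; exact e

/-- The density of a decreasing majorant of `marchaudKernel`. -/
def layerDensity (α r : ℝ) : ℝ := if r ≤ 1 then (1 - α) * r ^ (α - 2) else (2 - α) * r ^ (α - 3)

theorem measurable_layerDensity (α : ℝ) : Measurable (layerDensity α) :=
  Measurable.ite measurableSet_Iic ((measurable_id.pow_const _).const_mul _)
    ((measurable_id.pow_const _).const_mul _)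

theorem layerDensity_nonneg {α r : ℝ} (h1 : α < 1) (hr : 0 < r) : 0 ≤ layerDensity α r := by
  have a : 0 < 1 - α := by linarith
  have b : 0 < 2 - α := by linarith
  unfold layerDensity; split_ifs <;> positivity

theorem integral_layerDensity_gt {α t : ℝ} (h1 : α < 1) (ht : 1 ≤ t) :
    IntegrableOn (layerDensity α) (Ioi t) ∧ ∫ r in Ioi t, layerDensity α r = t ^ (α - 2) := by
  have t0 : 0 < t := by linarith
  have e : EqOn (fun r => (2 - α) * r ^ (α - 3)) (layerDensity α) (Ioi t) := fun r hr => by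
    rw [layerDensity, if_neg (not_le.2 (ht.trans_lt hr))]
  refine ⟨IntegrableOn.congr_fun ((integrableOn_Ioi_rpow_of_lt (a := α - 3) (by linarith) t0).const_mul _)
    e measurableSet_Ioi, ?_⟩
  rw [← setIntegral_congr_fun measurableSet_Ioi e, integral_const_mul,
    integral_Ioi_rpow_of_lt (by linarith) t0, show α - 3 + 1 = α - 2 by ring]
  have : α - 2 ≠ 0 := by linarith
  field_simp; ring

theorem integral_layerDensity_le {α t : ℝ} (h1 : α < 1) (t0 : 0 < t) (ht : t ≤ 1) :
    IntegrableOn (layerDensity α) (Ioi t) ∧ ∫ r in Ioi t, layerDensity α r = t ^ (α - 1) := by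
  have e : EqOn (fun r => (1 - α) * r ^ (α - 2)) (layerDensity α) (Ioc t 1) := fun r hr => by
    rw [layerDensity, if_pos hr.2]
  have hn : (0 : ℝ) ∉ uIcc t 1 := by
    rw [uIcc_of_le ht]; intro h; linarith [h.1]
  have hi : IntegrableOn (fun r : ℝ => r ^ (α - 2)) (Ioc t 1) :=
    (intervalIntegral.intervalIntegrable_rpow (μ := volume) (r := α - 2) (Or.inr hn)).1
  have hv : ∫ r in Ioc t 1, layerDensity α r = t ^ (α - 1) - 1 := by
    rw [← setIntegral_congr_fun measurableSet_Ioc e, integral_const_mul,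
      ← intervalIntegral.integral_of_le ht, integral_rpow (Or.inr ⟨by linarith, hn⟩),
      show α - 2 + 1 = α - 1 by ring, Real.one_rpow]
    have : α - 1 ≠ 0 := by linarith
    field_simp; ring
  obtain ⟨i2, v2⟩ := integral_layerDensity_gt (t := 1) h1 le_rfl
  have i1 := IntegrableOn.congr_fun (hi.const_mul (1 - α)) e measurableSet_Ioc
  rw [← Ioc_union_Ioi_eq_Ioi ht]
  refine ⟨i1.union i2, ?_⟩
  rw [setIntegral_union (Ioc_disjoint_Ioi le_rfl) measurableSet_Ioi i1 i2, hv, v2, Real.one_rpow]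
  ring

/-- The tails of `layerDensity` are the decreasing majorant: `t ^ (α - 1)` up to `1`, where the
kernel equals it, and `t ^ (α - 2)` beyond. -/
theorem ofReal_marchaudKernel_le {α t : ℝ} (h0 : 0 < α) (h1 : α < 1) (ht : 0 < t) :
    ENNReal.ofReal (marchaudKernel α t) ≤ ∫⁻ r in Ioi t, ENNReal.ofReal (layerDensity α r) := by
  have hnn : 0 ≤ᵐ[volume.restrict (Ioi t)] layerDensity α := by
    filter_upwards [ae_restrict_mem measurableSet_Ioi] with r hr
    exact layerDensity_nonneg h1 (ht.trans hr)
  rcases le_or_gt t 1 with h | h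
  · obtain ⟨i, v⟩ := integral_layerDensity_le h1 ht h
    rw [← ofReal_integral_eq_lintegral_ofReal i hnn, v, marchaudKernel_of_le_one h0 ht h]
  · obtain ⟨i, v⟩ := integral_layerDensity_gt h1 h.le
    rw [← ofReal_integral_eq_lintegral_ofReal i hnn, v]
    exact ENNReal.ofReal_le_ofReal (marchaudKernel_le h1 h)

/-- By the layer-cake formula this integral is the total mass of the majorant; it supplies the
dominating function for the averages. -/
theorem integrable_layerDensity_mul {α : ℝ} (h0 : 0 < α) (h1 : α < 1) :
    IntegrableOn (fun r => layerDensity α r * r) (Ioi 0) := by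
  have e1 : EqOn (fun r : ℝ => (1 - α) * r ^ (α - 1)) (fun r => layerDensity α r * r) (Ioc 0 1) := by
    intro r hr
    simp only [layerDensity, if_pos hr.2]
    rw [show α - 2 = α - 1 - 1 by ring, Real.rpow_sub_one hr.1.ne' (α - 1)]
    have := hr.1.ne'; field_simp
  have e2 : EqOn (fun r : ℝ => (2 - α) * r ^ (α - 2)) (fun r => layerDensity α r * r) (Ioi 1) := by
    intro r hr
    have hr : 1 < r := hr
    have r0 : r ≠ 0 := by linarith
    simp only [layerDensity, if_neg (not_le.2 hr)]
    rw [show α - 3 = α - 2 - 1 by ring, Real.rpow_sub_one r0 (α - 2)]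
    field_simp
  have i1 : IntegrableOn (fun t : ℝ => t ^ (α - 1)) (Ioc 0 1) := by
    rw [integrableOn_Ioc_iff_integrableOn_Ioo]
    simpa using (integral_sub_rpow (z := 0) (T := 1) (p := α - 1) (by linarith) zero_le_one).1
  have i2 := integrableOn_Ioi_rpow_of_lt (a := α - 2) (by linarith) one_pos
  rw [← Ioc_union_Ioi_eq_Ioi zero_le_one]
  exact (IntegrableOn.congr_fun (i1.const_mul _) e1 measurableSet_Ioc).union
    (IntegrableOn.congr_fun (i2.const_mul _) e2 measurableSet_Ioi)

/-- The mean of `|h - h(x)|` over `(x - s, x)`. -/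
def leftMean (h : ℝ → ℝ) (x s : ℝ) : ℝ := s⁻¹ * ∫ y in (x - s)..x, |h y - h x|

theorem leftMean_nonneg (h : ℝ → ℝ) (x : ℝ) {s : ℝ} (hs : 0 < s) : 0 ≤ leftMean h x s :=
  mul_nonneg (inv_nonneg.2 hs.le)
    (intervalIntegral.integral_nonneg (by linarith) fun _ _ => abs_nonneg _)

theorem intervalIntegrable_abs_sub {h : ℝ → ℝ} (hh : Integrable h) (x p q : ℝ) :
    IntervalIntegrable (fun y => |h y - h x|) volume p q :=
  (hh.intervalIntegrable.sub intervalIntegrable_const).abs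

theorem measurable_leftMean {h : ℝ → ℝ} (hh : Integrable h) (x : ℝ) :
    Measurable (leftMean h x) := by
  have hc : Continuous fun b => ∫ y in x..b, |h y - h x| :=
    intervalIntegral.continuous_primitive
      (fun p q => intervalIntegrable_abs_sub hh x p q) x
  have : leftMean h x = fun s => s⁻¹ * -∫ y in x..(x - s), |h y - h x| := by
    ext s; rw [leftMean, intervalIntegral.integral_symm]
  rw [this]
  exact measurable_inv.mul (hc.comp (continuous_const.sub continuous_id)).measurable.neg

/-- A one-sided mean is at most twice the centred mean of the same radius, to which the Lebesgue
differentiation theorem applies. -/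
theorem ae_tendsto_leftMean {h : ℝ → ℝ} (hh : Integrable h) :
    ∀ᵐ x, Tendsto (leftMean h x) (𝓝[>] 0) (𝓝 0) := by
  filter_upwards [IsUnifLocDoublingMeasure.ae_tendsto_average_norm_sub
    (μ := volume) hh.locallyIntegrable 1] with x hx
  have := hx (w := fun _ => x) (δ := fun s : ℝ => s) (l := 𝓝[>] 0) tendsto_id (by
    filter_upwards [self_mem_nhdsWithin] with s hs
    have hs : 0 < s := hs
    simp [hs.le])
  have h2 := this.const_mul 2
  rw [mul_zero] at h2
  refine squeeze_zero' ?_ ?_ h2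
  · filter_upwards [self_mem_nhdsWithin] with s hs using leftMean_nonneg h x hs
  · filter_upwards [self_mem_nhdsWithin] with s hs
    have hs : 0 < s := hs
    have hi : IntegrableOn (fun y => |h y - h x|) (Icc (x - s) (x + s)) :=
      (hh.integrableOn.sub (integrableOn_const (by simp))).abs
    rw [leftMean, setAverage_eq, Real.closedBall_eq_Icc, Real.volume_real_Icc_of_le (by linarith),
      intervalIntegral.integral_of_le (by linarith)]
    have : ∫ y in Ioc (x - s) x, |h y - h x| ≤ ∫ y in Icc (x - s) (x + s), |h y - h x| :=
      setIntegral_mono_set hi (Eventually.of_forall fun _ => abs_nonneg _)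
        (Eventually.of_forall fun y hy => ⟨hy.1.le, hy.2.trans (by linarith)⟩)
    have e : x + s - (x - s) = 2 * s := by ring
    rw [e, smul_eq_mul, mul_inv, ← mul_assoc, ← mul_assoc, mul_inv_cancel₀ two_ne_zero, one_mul]
    exact mul_le_mul_of_nonneg_left this (inv_nonneg.2 hs.le)

/-- The kernel has unbounded support, so all scales enter, not only small ones. Small scales are
bounded by convergence; for `s ≥ δ` the mean is at most `δ⁻¹ ∫ |h| + |h x|`. -/
theorem exists_bound_leftMean {h : ℝ → ℝ} (hh : Integrable h) {x : ℝ}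
    (hx : Tendsto (leftMean h x) (𝓝[>] 0) (𝓝 0)) :
    ∃ M, ∀ s, 0 < s → leftMean h x s ≤ M := by
  have h1 := hx.eventually (gt_mem_nhds one_pos)
  rw [eventually_nhdsWithin_iff, Metric.eventually_nhds_iff] at h1
  obtain ⟨δ, hδ, hδs⟩ := h1
  refine ⟨max 1 (δ⁻¹ * (∫ y, |h y|) + |h x|), fun s hs => ?_⟩
  by_cases hsd : s < δ
  · exact (hδs (by simpa [abs_of_pos hs] using hsd) hs).le.trans (le_max_left _ _)
  · refine le_trans ?_ (le_max_right _ _)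
    have hi := hh.abs
    have e : ∫ y in (x - s)..x, |h y - h x| ≤ (∫ y, |h y|) + s * |h x| := by
      calc ∫ y in (x - s)..x, |h y - h x|
          ≤ ∫ y in (x - s)..x, (|h y| + |h x|) :=
            intervalIntegral.integral_mono_on (by linarith)
              (intervalIntegrable_abs_sub hh x _ _)
              (hi.intervalIntegrable.add intervalIntegrable_const) fun y _ => abs_sub _ _
        _ = (∫ y in (x - s)..x, |h y|) + s * |h x| := by
            rw [intervalIntegral.integral_add hi.intervalIntegrable intervalIntegrable_const]
            simp
        _ ≤ _ := by
            rw [intervalIntegral.integral_of_le (by linarith)]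
            refine add_le_add_left ?_ _
            exact setIntegral_le_integral hi (Eventually.of_forall fun _ => abs_nonneg _)
    have p : 0 ≤ ∫ y, |h y| := integral_nonneg fun _ => abs_nonneg _
    calc leftMean h x s ≤ s⁻¹ * ((∫ y, |h y|) + s * |h x|) :=
          mul_le_mul_of_nonneg_left e (inv_nonneg.2 hs.le)
      _ = s⁻¹ * (∫ y, |h y|) + |h x| := by field_simp
      _ ≤ _ := by gcongr; exact not_lt.1 hsd

theorem lintegral_leftMean {h : ℝ → ℝ} (hh : Integrable h) (x : ℝ) {ε r : ℝ} (hε : 0 < ε)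
    (hr : 0 < r) : ∫⁻ t in Ioo 0 r, ‖h (x - ε * t) - h x‖ₑ
      = ENNReal.ofReal (r * leftMean h x (ε * r)) := by
  have hi : IntegrableOn (fun t => h (x - ε * t) - h x) (Ioo 0 r) := by
    have h3 : Integrable fun t => h (x - ε * t) :=
      (hh.comp_sub_left x).comp_mul_left' hε.ne'
    exact h3.integrableOn.sub (integrable_const _)
  have e := intervalIntegral.integral_comp_sub_mul (a := 0) (b := r) (fun y => |h y - h x|) hε.ne' x
  have e2 : r * leftMean h x (ε * r) = ∫ t in Ioo 0 r, ‖h (x - ε * t) - h x‖ := by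
    rw [← integral_Ioc_eq_integral_Ioo, ← intervalIntegral.integral_of_le hr.le]
    simp only [Real.norm_eq_abs]
    rw [e, leftMean, mul_zero, sub_zero, smul_eq_mul]
    field_simp
  rw [e2, ofReal_integral_norm_eq_lintegral_enorm hi]

/-- Almost everywhere convergence of the averages with the kernel `marchaudKernel`. -/
theorem ae_tendsto_integral_marchaudKernel {α : ℝ} (h0 : 0 < α) (h1 : α < 1) {h : ℝ → ℝ}
    (hh : Integrable h) :
    ∀ᵐ x, Tendsto (fun ε => ∫ t in Ioi (0:ℝ), h (x - ε * t) * marchaudKernel α t) (𝓝[>] 0)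
      (𝓝 (betaConst α * h x)) := by
  filter_upwards [ae_tendsto_leftMean hh] with x hx
  obtain ⟨M, hM⟩ := exists_bound_leftMean hh hx
  obtain ⟨hKi, hKv⟩ := integral_marchaudKernel h0 h1
  -- Slicing the majorant into layers `(0, r)` bounds the error at scale `ε` by a superposition of
  -- the means over `(x - ε r, x)`. Each tends to zero, and the global bound `M` allows dominated
  -- convergence.
  set J : ℝ → ℝ≥0∞ := fun ε => ∫⁻ r in Ioi (0:ℝ),
    ENNReal.ofReal (layerDensity α r) * ENNReal.ofReal (r * leftMean h x (ε * r)) with hJ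
  have hJlim : Tendsto J (𝓝[>] 0) (𝓝 0) := by
    have := tendsto_lintegral_filter_of_dominated_convergence (μ := volume.restrict (Ioi (0:ℝ)))
      (l := 𝓝[>] (0:ℝ)) (f := fun _ => 0)
      (F := fun ε r => ENNReal.ofReal (layerDensity α r) * ENNReal.ofReal (r * leftMean h x (ε * r)))
      (fun r => ENNReal.ofReal (layerDensity α r * r * M)) (Eventually.of_forall fun ε => ?_) ?_ ?_ ?_
    · simpa using this
    · exact ((measurable_layerDensity α).ennreal_ofReal.mul
        (measurable_id.mul ((measurable_leftMean hh x).comp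
          (measurable_const.mul measurable_id))).ennreal_ofReal)
    · filter_upwards [self_mem_nhdsWithin] with ε hε
      filter_upwards [ae_restrict_mem measurableSet_Ioi] with r hr
      have hr : 0 < r := hr
      have hε : 0 < ε := hε
      have n0 := layerDensity_nonneg h1 hr
      rw [← ENNReal.ofReal_mul n0]
      refine ENNReal.ofReal_le_ofReal ?_
      rw [mul_assoc]
      exact mul_le_mul_of_nonneg_left (mul_le_mul_of_nonneg_left (hM _ (by positivity)) hr.le) n0
    · exact ((integrable_layerDensity_mul h0 h1).mul_const M).lintegral_lt_top.ne
    · filter_upwards [ae_restrict_mem measurableSet_Ioi] with r hr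
      have hr : 0 < r := hr
      have t1 : Tendsto (fun ε => ε * r) (𝓝[>] 0) (𝓝[>] 0) := by
        refine tendsto_nhdsWithin_iff.2 ⟨?_, ?_⟩
        · have : Tendsto (fun ε : ℝ => ε * r) (𝓝 0) (𝓝 (0 * r)) := tendsto_id.mul_const r
          rw [zero_mul] at this
          exact this.mono_left inf_le_left
        · filter_upwards [self_mem_nhdsWithin] with ε hε
          have hε : 0 < ε := hε
          exact (by positivity : 0 < ε * r)
      have t2 := ENNReal.tendsto_ofReal ((hx.comp t1).const_mul r)
      rw [mul_zero, ENNReal.ofReal_zero] at t2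
      have := ENNReal.Tendsto.const_mul (a := ENNReal.ofReal (layerDensity α r)) t2
        (Or.inr ENNReal.ofReal_ne_top)
      simpa using this
  have hφ : ∀ ε : ℝ, 0 < ε → AEStronglyMeasurable (fun t => h (x - ε * t) - h x) volume := by
    intro ε hε
    exact ((hh.comp_sub_left x).comp_mul_left' hε.ne').aestronglyMeasurable.sub
      aestronglyMeasurable_const
  have hle : ∀ ε : ℝ, 0 < ε →
      ∫⁻ t in Ioi (0:ℝ), ‖(h (x - ε * t) - h x) * marchaudKernel α t‖ₑ ≤ J ε := by
    intro ε hε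
    have e1 : J ε = ∫⁻ t in Ioi (0:ℝ), ‖h (x - ε * t) - h x‖ₑ *
        ∫⁻ r in Ioi t, ENNReal.ofReal (layerDensity α r) := by
      rw [lintegral_layer (hφ ε hε).enorm (measurable_layerDensity α).ennreal_ofReal]
      refine setLIntegral_congr_fun measurableSet_Ioi fun r hr => ?_
      simp only [lintegral_leftMean hh x hε hr]
    rw [e1]
    refine setLIntegral_mono' measurableSet_Ioi fun t ht => ?_
    rw [enorm_mul, Real.enorm_of_nonneg (marchaudKernel_nonneg h0 ht)]
    exact mul_le_mul_right (ofReal_marchaudKernel_le h0 h1 ht) _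
  rw [tendsto_iff_edist_tendsto_0]
  refine tendsto_of_tendsto_of_tendsto_of_le_of_le' tendsto_const_nhds hJlim
    (Eventually.of_forall fun _ => zero_le) ?_
  -- Integrability of the error is not known beforehand; it follows from finiteness of `J ε`, which
  -- holds for small `ε`.
  filter_upwards [self_mem_nhdsWithin, hJlim.eventually (gt_mem_nhds ENNReal.zero_lt_top)]
    with ε hε hfin
  have hint : IntegrableOn (fun t => (h (x - ε * t) - h x) * marchaudKernel α t) (Ioi 0) :=
    ⟨(hφ ε hε).restrict.mul hKi.aestronglyMeasurable, (hle ε hε).trans_lt hfin⟩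
  have e : ∫ t in Ioi (0:ℝ), h (x - ε * t) * marchaudKernel α t
      = (∫ t in Ioi (0:ℝ), (h (x - ε * t) - h x) * marchaudKernel α t) + betaConst α * h x := by
    rw [← hKv, ← integral_mul_const, ← integral_add hint (hKi.mul_const _)]
    congr 1; ext t; ring
  rw [e, edist_eq_enorm_sub, add_sub_cancel_right]
  exact (enorm_integral_le_lintegral_enorm _).trans (hle ε hε)

/-! ### Weak convergence of the averages -/

theorem quasiMeasurePreserving_sub_mul (x : ℝ) {ε : ℝ} (hε : ε ≠ 0) :
    Measure.QuasiMeasurePreserving (fun t => x - ε * t) volume volume := by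
  have h1 : Measure.QuasiMeasurePreserving (fun t : ℝ => ε * t) volume volume :=
    ⟨measurable_const_mul ε, by
      rw [Real.map_volume_mul_left hε]; exact Measure.smul_absolutelyContinuous⟩
  exact (Measure.measurePreserving_sub_left volume x).quasiMeasurePreserving.comp h1

/-- Weak convergence of the averages with the kernel `marchaudKernel`. -/
theorem tendsto_integral_mul_marchaudKernel {α : ℝ} (h0 : 0 < α) (h1 : α < 1) {h ψ : ℝ → ℝ}
    (hh : Integrable h) (hψ : Continuous ψ) {M : ℝ} (hM : ∀ x, ‖ψ x‖ ≤ M) :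
    (∀ ε, 0 < ε → Integrable
      fun x => ψ x * ∫ t in Ioi (0:ℝ), h (x - ε * t) * marchaudKernel α t) ∧
    Tendsto (fun ε => ∫ x, ψ x * ∫ t in Ioi (0:ℝ), h (x - ε * t) * marchaudKernel α t) (𝓝[>] 0)
      (𝓝 (betaConst α * ∫ x, ψ x * h x)) := by
  -- A strongly measurable representative makes `h (x - ε * t)` jointly measurable; the averages do
  -- not see the change because the affine map `t ↦ x - ε t` pulls null sets back to null sets.
  wlog hsm : StronglyMeasurable h generalizing h
  · obtain ⟨h', hs', he⟩ := hh.aestronglyMeasurable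
    have hh' : Integrable h' := hh.congr he
    have e1 : ∀ ε, 0 < ε → ∀ x, ∫ t in Ioi (0:ℝ), h (x - ε * t) * marchaudKernel α t
        = ∫ t in Ioi (0:ℝ), h' (x - ε * t) * marchaudKernel α t := by
      intro ε hε x
      refine integral_congr_ae (ae_restrict_of_ae ?_)
      filter_upwards [(quasiMeasurePreserving_sub_mul x hε.ne').ae he] with t ht
      rw [ht]
    have e2 : ∫ x, ψ x * h x = ∫ x, ψ x * h' x :=
      integral_congr_ae (he.mono fun x hx => by simp only [hx])
    obtain ⟨a1, a2⟩ := this hh' hs'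
    refine ⟨fun ε hε => by simpa only [e1 ε hε] using a1 ε hε, ?_⟩
    rw [e2]
    refine a2.congr' ?_
    filter_upwards [self_mem_nhdsWithin] with ε hε
    simp only [e1 ε hε]
  obtain ⟨hKi, hKv⟩ := integral_marchaudKernel h0 h1
  have hM0 : 0 ≤ M := (norm_nonneg _).trans (hM 0)
  have hKm : Measurable (marchaudKernel α) := by unfold marchaudKernel; fun_prop
  have hmeas : ∀ ε : ℝ, AEStronglyMeasurable
      (fun p : ℝ × ℝ => ψ p.1 * (h (p.1 - ε * p.2) * marchaudKernel α p.2))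
      (volume.prod (volume.restrict (Ioi 0))) := fun ε =>
    ((hψ.measurable.comp measurable_fst).mul ((hsm.measurable.comp
      (measurable_fst.sub (measurable_snd.const_mul ε))).mul
        (hKm.comp measurable_snd))).aestronglyMeasurable
  have hbi : ∀ s : ℝ, Integrable fun x => ψ x * h (x - s) := fun s =>
    (hh.comp_sub_right s).bdd_mul hψ.aestronglyMeasurable (Eventually.of_forall hM)
  have hbn : ∀ s : ℝ, ∫ x, ‖ψ x * h (x - s)‖ ≤ M * ∫ x, ‖h x‖ := by
    intro s
    rw [← integral_sub_right_eq_self (fun x => ‖h x‖) s, ← integral_const_mul]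
    refine integral_mono (hbi s).norm ((hh.comp_sub_right s).norm.const_mul M) fun x => ?_
    simp only [norm_mul]
    exact mul_le_mul_of_nonneg_right (hM x) (norm_nonneg _)
  have hint : ∀ ε : ℝ, Integrable
      (fun p : ℝ × ℝ => ψ p.1 * (h (p.1 - ε * p.2) * marchaudKernel α p.2))
      (volume.prod (volume.restrict (Ioi 0))) := by
    intro ε
    rw [integrable_prod_iff' (hmeas ε)]
    constructor
    · refine Eventually.of_forall fun t => ?_
      simpa only [mul_assoc] using (hbi (ε * t)).mul_const (marchaudKernel α t)
    · refine Integrable.mono' (hKi.norm.const_mul (M * ∫ x, ‖h x‖))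
        ((hmeas ε).prod_swap.norm.integral_prod_right') (Eventually.of_forall fun t => ?_)
      rw [Real.norm_of_nonneg (integral_nonneg fun _ => norm_nonneg _)]
      have : ∀ x, ‖ψ x * (h (x - ε * t) * marchaudKernel α t)‖
          = ‖ψ x * h (x - ε * t)‖ * ‖marchaudKernel α t‖ := fun x => by
        rw [← mul_assoc, norm_mul]
      simp only [this]
      rw [integral_mul_const]
      exact mul_le_mul_of_nonneg_right (hbn _) (norm_nonneg _)
  have hrw : ∀ ε x, ψ x * ∫ t in Ioi (0:ℝ), h (x - ε * t) * marchaudKernel α t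
      = ∫ t in Ioi (0:ℝ), ψ x * (h (x - ε * t) * marchaudKernel α t) := fun ε x =>
    (integral_const_mul _ _).symm
  refine ⟨fun ε _ => ?_, ?_⟩
  · simp only [hrw]; exact (hint ε).integral_prod_left
  -- Fubini and translation invariance shift the argument of `ψ` instead of that of `h`. As `ψ` is
  -- bounded and continuous, dominated convergence applies first in `z` and then in `t`.
  have hsw : ∀ ε, ∫ x, ψ x * ∫ t in Ioi (0:ℝ), h (x - ε * t) * marchaudKernel α t
      = ∫ t in Ioi (0:ℝ), (∫ z, ψ (z + ε * t) * h z) * marchaudKernel α t := by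
    intro ε
    simp only [hrw]
    rw [integral_integral_swap
      (f := fun x t => ψ x * (h (x - ε * t) * marchaudKernel α t)) (hint ε)]
    congr 1; ext t
    rw [← integral_mul_const, ← integral_add_right_eq_self
      (fun x => ψ x * (h (x - ε * t) * marchaudKernel α t)) (ε * t)]
    congr 1; ext z
    rw [add_sub_cancel_right]; ring
  simp only [hsw]
  rw [mul_comm, ← hKv, ← integral_const_mul]
  refine tendsto_integral_filter_of_dominated_convergence
    (fun t => (M * ∫ x, ‖h x‖) * ‖marchaudKernel α t‖) (Eventually.of_forall fun ε => ?_)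
    (Eventually.of_forall fun ε => Eventually.of_forall fun t => ?_) (hKi.norm.const_mul _)
    (Eventually.of_forall fun t => ?_)
  · refine AEStronglyMeasurable.mul ?_ hKm.aestronglyMeasurable
    have : Measurable fun p : ℝ × ℝ => ψ (p.2 + ε * p.1) * h p.2 :=
      (hψ.measurable.comp (measurable_snd.add (measurable_fst.const_mul ε))).mul
        (hsm.measurable.comp measurable_snd)
    exact (this.stronglyMeasurable.integral_prod_right').aestronglyMeasurable
  · rw [norm_mul]
    refine mul_le_mul_of_nonneg_right ?_ (norm_nonneg _)
    refine (norm_integral_le_integral_norm _).trans ?_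
    have := hbn (ε * t)
    rw [← integral_add_right_eq_self (fun x => ‖ψ x * h (x - ε * t)‖) (ε * t)] at this
    simpa only [add_sub_cancel_right] using this
  · refine Tendsto.mul_const _ ?_
    refine tendsto_integral_filter_of_dominated_convergence (fun z => M * ‖h z‖)
      (Eventually.of_forall fun ε => ?_) (Eventually.of_forall fun ε => Eventually.of_forall
        fun z => ?_) (hh.norm.const_mul M) (Eventually.of_forall fun z => ?_)
    · exact ((hψ.comp (continuous_id.add continuous_const)).measurable.mul
        hsm.measurable).aestronglyMeasurable
    · rw [norm_mul]; exact mul_le_mul_of_nonneg_right (hM _) (norm_nonneg _)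
    · refine Tendsto.mul_const _ ?_
      have : Continuous fun ε : ℝ => ψ (z + ε * t) := by fun_prop
      have := this.tendsto 0
      simp only [zero_mul, add_zero] at this
      exact this.mono_left inf_le_left

/-! ### Truncated Marchaud derivatives converge to the weak derivative -/

theorem exists_mem_Ioo_of_ae {P : ℝ → Prop} {p q : ℝ} (hpq : p < q)
    (h : ∀ᵐ x ∂(volume.restrict (Ioo p q)), P x) : ∃ x ∈ Ioo p q, P x := by
  have : NeBot (ae (volume.restrict (Ioo p q))) := by
    rw [ae_neBot, Ne, Measure.restrict_eq_zero]; simp [hpq]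
  exact ((ae_restrict_mem measurableSet_Ioo).and h).exists

/-- Intervals with rational endpoints suffice, so only countably many null sets are united. This
allows the base point `c` to depend on the subinterval. -/
theorem ae_restrict_Ioo_of_forall {P : ℝ → Prop} {a b : ℝ}
    (h : ∀ p q, a < p → p < q → q < b → ∀ᵐ x ∂(volume.restrict (Ioo p q)), P x) :
    ∀ᵐ x ∂(volume.restrict (Ioo a b)), P x := by
  have h1 : ∀ᵐ x : ℝ, ∀ p q : ℚ, a < p → (p:ℝ) < q → q < b → x ∈ Ioo (p:ℝ) q → P x := by
    rw [ae_all_iff]; intro p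
    rw [ae_all_iff]; intro q
    by_cases hc : a < p ∧ (p:ℝ) < q ∧ q < b
    · filter_upwards [(ae_restrict_iff' measurableSet_Ioo).1 (h p q hc.1 hc.2.1 hc.2.2)] with x hx
      intro _ _ _ hm; exact hx hm
    · exact Eventually.of_forall fun x h1 h2 h3 => absurd ⟨h1, h2, h3⟩ hc
  rw [ae_restrict_iff' measurableSet_Ioo]
  filter_upwards [h1] with x hx hm
  obtain ⟨p, hp1, hp2⟩ := exists_rat_btwn hm.1
  obtain ⟨q, hq1, hq2⟩ := exists_rat_btwn hm.2
  exact hx p q hp1 (hp2.trans hq1) hq2 ⟨hp2, hq1⟩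

theorem integrableOn_mul_rpow_far {u : ℝ → ℝ} {p q x α : ℝ} (h0 : 0 < α)
    (hu : IntegrableOn u (Ioo p q)) (hq : q < x) :
    IntegrableOn (fun y => u y * (x - y) ^ (-1 - α)) (Ioo p q) :=
  integrableOn_mul_of_bound (M := (x - q) ^ (-1 - α)) measurableSet_Ioo hu
    ((measurable_const.sub measurable_id).pow_const _) fun y hy => by
      rw [abs_of_nonneg (Real.rpow_nonneg (by linarith [hy.2]) _)]
      exact Real.rpow_le_rpow_of_nonpos (by linarith) (by linarith [hy.2]) (by linarith)

/-- The truncated Marchaud derivative near a point, in terms of the local density. -/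
theorem IsWeakFracDeriv.ae_marchaudTrunc_eq {α a b : ℝ} (hab : a < b) (h0 : 0 < α) (h1 : α < 1)
    {u v : ℝ → ℝ} (hv : IsWeakFracDeriv .left α a b u v) :
    ∀ᵐ c ∂(volume.restrict (Ioo a b)), ∀ d, c < d → d < b →
      IntegrableOn (localDensity a c α u v) (Ioo c d) ∧
      ∀ᵐ x ∂(volume.restrict (Ioo c d)), ∀ ε, 0 < ε → ε < x - c →
        betaConst α * marchaudTrunc a α ε u x
          = betaConst α * (Real.Gamma (1 - α) * v x - localDensity a c α u v x)
            + ∫ t in Ioi (0 : ℝ), (Ioo c d).indicator (localDensity a c α u v) (x - ε * t)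
              * marchaudKernel α t := by
  filter_upwards [hv.ae_abelIntegral_eq hab h0 h1, ae_restrict_mem measurableSet_Ioo]
    with c hc hcm d hcd hdb
  have hh := hc.1 d hdb
  have hu : IntegrableOn u (Ioo c d) := hv.integrableOn.mono_set (Ioo_subset_Ioo hcm.1.le hdb.le)
  have hA := abel_inversion h0 h1 hcd hu hh
    (ae_restrict_of_ae_restrict_of_subset (Ioo_subset_Ioo le_rfl hdb.le) hc.2)
  refine ⟨hh, ?_⟩
  filter_upwards [hA, ae_restrict_mem measurableSet_Ioo] with x hx hxm ε hε hεx
  have hae := (ae_restrict_of_ae_restrict_of_subset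
    (Ioo_subset_Ioo le_rfl hxm.2.le : Ioo c x ⊆ Ioo c d) hA).mono fun y hy => hy.2
  have e := marchaudTrunc_eq h0 hh hxm hε hεx hx.1 hx.2 hae
  -- The truncations based at `a` and at `c` differ by `-α` times the integral over `(a, c)`. This
  -- is independent of `ε` and equals `Γ(1 - α) v x` minus the local density.
  have e2 := setIntegral_Ioo_split (k := fun y => u y * (x - y) ^ (-1 - α)) hcm.1
    (show c < x - ε by linarith) (integrableOn_mul_rpow_far h0 (hv.integrableOn.mono_set
      (Ioo_subset_Ioo le_rfl (by linarith [hxm.2]))) (by linarith))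
  rw [← e, marchaudTrunc, marchaudTrunc, e2, localDensity]
  ring

/-- The truncated Marchaud derivatives converge almost everywhere to the weak derivative. -/
theorem IsWeakFracDeriv.ae_tendsto_marchaudTrunc {α a b : ℝ} (hab : a < b) (h0 : 0 < α)
    (h1 : α < 1) {u v : ℝ → ℝ} (hv : IsWeakFracDeriv .left α a b u v) :
    ∀ᵐ x ∂(volume.restrict (Ioo a b)),
      Tendsto (fun ε => marchaudTrunc a α ε u x) (𝓝[>] 0) (𝓝 (Real.Gamma (1 - α) * v x)) := by
  refine ae_restrict_Ioo_of_forall fun p q hp hpq hq => ?_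
  obtain ⟨c, hc, hcg⟩ := exists_mem_Ioo_of_ae hp (ae_restrict_of_ae_restrict_of_subset
    (Ioo_subset_Ioo le_rfl (hpq.trans hq).le) (hv.ae_marchaudTrunc_eq hab h0 h1))
  obtain ⟨hh, hf⟩ := hcg q (hc.2.trans hpq) hq
  have hH : Integrable ((Ioo c q).indicator (localDensity a c α u v)) :=
    (integrable_indicator_iff measurableSet_Ioo).2 hh
  have hB := betaConst_pos h0 h1
  filter_upwards [ae_restrict_of_ae_restrict_of_subset (Ioo_subset_Ioo hc.2.le le_rfl) hf,
    ae_restrict_mem measurableSet_Ioo,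
    ae_restrict_of_ae (ae_tendsto_integral_marchaudKernel h0 h1 hH)] with x hx hxm hxt
  have hxc : c < x := hc.2.trans hxm.1
  rw [indicator_of_mem (show x ∈ Ioo c q from ⟨hxc, hxm.2⟩)] at hxt
  -- The averages tend to `betaConst α` times the local density, which cancels against the same term
  -- in the constant part; only `Γ(1 - α) v x` survives.
  have hlim := (hxt.const_add (betaConst α *
    (Real.Gamma (1 - α) * v x - localDensity a c α u v x))).const_mul (betaConst α)⁻¹
  have e : (betaConst α)⁻¹ * (betaConst α * (Real.Gamma (1 - α) * v x - localDensity a c α u v x)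
      + betaConst α * localDensity a c α u v x) = Real.Gamma (1 - α) * v x := by
    field_simp; ring
  rw [e] at hlim
  refine hlim.congr' ?_
  filter_upwards [Ioo_mem_nhdsGT (show 0 < x - c by linarith)] with ε hε
  rw [← hx ε hε.1 hε.2]
  field_simp

/-- The truncated Marchaud derivatives converge weakly to the weak derivative. -/
theorem IsWeakFracDeriv.tendsto_integral_marchaudTrunc {α a b : ℝ} (hab : a < b) (h0 : 0 < α)
    (h1 : α < 1) {u v : ℝ → ℝ} (hv : IsWeakFracDeriv .left α a b u v) {ψ : ℝ → ℝ}
    (hψ : Continuous ψ) (hψc : HasCompactSupport ψ) (hψs : tsupport ψ ⊆ Ioo a b) :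
    Tendsto (fun ε => ∫ x in Ioo a b, ψ x * marchaudTrunc a α ε u x) (𝓝[>] 0)
      (𝓝 (Real.Gamma (1 - α) * ∫ x in Ioo a b, ψ x * v x)) := by
  obtain ⟨p, q, hp, hpq, hq, hs⟩ := exists_Icc_of_tsupport hab hψc hψs
  obtain ⟨M, hM⟩ := hψc.exists_bound_of_continuous hψ
  obtain ⟨c, hc, hcg⟩ := exists_mem_Ioo_of_ae hp (ae_restrict_of_ae_restrict_of_subset
    (Ioo_subset_Ioo le_rfl (hpq.trans hq).le) (hv.ae_marchaudTrunc_eq hab h0 h1))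
  set d := (q + b) / 2
  have hqd : q < d := by simp only [d]; linarith
  have hdb : d < b := by simp only [d]; linarith
  have hcp : c < p := hc.2
  obtain ⟨hh, hf⟩ := hcg d (by linarith) hdb
  set h := localDensity a c α u v with hhd
  have hH : Integrable ((Ioo c d).indicator h) := (integrable_indicator_iff measurableSet_Ioo).2 hh
  have hB := betaConst_pos h0 h1
  obtain ⟨hwi, hw⟩ := tendsto_integral_mul_marchaudKernel h0 h1 hH hψ hM
  have hsub : Ioo c d ⊆ Ioo a b := Ioo_subset_Ioo hc.1.le hdb.le
  have hIcc : Icc p q ⊆ Ioo c d := fun x hx => ⟨hcp.trans_le hx.1, hx.2.trans_lt hqd⟩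
  have hrestr : ∀ k : ℝ → ℝ, ∫ x in Ioo a b, ψ x * k x = ∫ x in Ioo c d, ψ x * k x := fun k =>
    setIntegral_eq_of_subset_of_forall_sdiff_eq_zero measurableSet_Ioo hsub fun x hx => by
      rw [hs x fun h' => hx.2 (hIcc h'), zero_mul]
  have hrestr' : ∀ k : ℝ → ℝ, ∫ x, ψ x * k x = ∫ x in Ioo c d, ψ x * k x := fun k =>
    (setIntegral_eq_integral_of_forall_compl_eq_zero fun x hx => by
      rw [hs x fun h' => hx (hIcc h'), zero_mul]).symm
  have hvi : IntegrableOn v (Ioo c d) :=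
    (integrableOn_Icc_of_locallyIntegrableOn hv.locallyIntegrableOn hc.1 hdb).mono_set
      Ioo_subset_Icc_self
  have hbi : ∀ k : ℝ → ℝ, IntegrableOn k (Ioo c d) → IntegrableOn (fun x => ψ x * k x) (Ioo c d) :=
    fun k hk => Integrable.bdd_mul hk hψ.aestronglyMeasurable (Eventually.of_forall hM)
  have e1 : ∫ x, ψ x * (Ioo c d).indicator h x = ∫ x in Ioo c d, ψ x * h x := by
    rw [hrestr']
    exact setIntegral_congr_fun measurableSet_Ioo fun x hx => by simp only [indicator_of_mem hx]
  rw [e1] at hw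
  have hlim := (hw.const_add (betaConst α * ((Real.Gamma (1 - α) * ∫ x in Ioo c d, ψ x * v x)
    - ∫ x in Ioo c d, ψ x * h x))).const_mul (betaConst α)⁻¹
  have e2 : (betaConst α)⁻¹ * (betaConst α * ((Real.Gamma (1 - α) * ∫ x in Ioo c d, ψ x * v x)
      - ∫ x in Ioo c d, ψ x * h x) + betaConst α * ∫ x in Ioo c d, ψ x * h x)
      = Real.Gamma (1 - α) * ∫ x in Ioo a b, ψ x * v x := by
    rw [hrestr v]; field_simp; ring
  rw [e2] at hlim
  refine hlim.congr' ?_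
  -- Since `ψ` vanishes to the left of `p`, the choice `ε < p - c` makes the pointwise formula
  -- available a.e. where `ψ` is not zero.
  filter_upwards [Ioo_mem_nhdsGT (show 0 < p - c by linarith)] with ε hε
  have hε0 : 0 < ε := hε.1
  rw [hrestr (marchaudTrunc a α ε u), hrestr' fun x => ∫ t in Ioi (0:ℝ),
    (Ioo c d).indicator h (x - ε * t) * marchaudKernel α t]
  have hvh : IntegrableOn (fun x => betaConst α * (Real.Gamma (1 - α) * (ψ x * v x) - ψ x * h x))
      (Ioo c d) := (((hbi v hvi).const_mul _).sub (hbi h hh)).const_mul _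
  rw [inv_mul_eq_div, div_eq_iff hB.ne', ← integral_const_mul, ← integral_sub
    ((hbi v hvi).const_mul _) (hbi h hh), ← integral_const_mul, ← integral_add hvh (hwi ε hε0).integrableOn,
    ← integral_mul_const]
  refine integral_congr_ae ?_
  filter_upwards [hf] with x hx
  by_cases hxp : x ∈ Icc p q
  · have := hx ε hε0 (by linarith [hxp.1, hε.2])
    linear_combination (-ψ x) * this
  · rw [hs x hxp]; ring

/-! ### Pairing truncated derivatives of integrable functions with test functions -/

/-- The adjoint of the truncated Marchaud derivative, applied to a test function. -/
def marchaudAdj (b α ε : ℝ) (η : ℝ → ℝ) (y : ℝ) : ℝ :=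
  ε ^ (-α) * η y - α * ∫ x in Ioo y b, if y < x - ε then η x * (x - y) ^ (-1 - α) else 0

/-- The truncation bounds the kernel by `ε ^ (-1 - α)`, so Fubini needs only integrability of `u`.
Encoding `y < x - ε` as a case distinction in the kernel brings the exchange under
`triangle_fubini`. -/
theorem integral_mul_marchaudTrunc {α a b ε : ℝ} (h0 : 0 < α) (hε : 0 < ε) {u η : ℝ → ℝ}
    (hu : IntegrableOn u (Ioo a b)) (hη : Continuous η) {M : ℝ} (hM : ∀ x, ‖η x‖ ≤ M) :
    IntegrableOn (fun x => η x * marchaudTrunc a α ε u x) (Ioo a b) ∧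
    ∫ x in Ioo a b, η x * marchaudTrunc a α ε u x = ∫ y in Ioo a b, u y * marchaudAdj b α ε η y := by
  have hM0 : 0 ≤ M := (norm_nonneg _).trans (hM 0)
  set G : ℝ → ℝ → ℝ := fun x y => if y < x - ε then η x * (x - y) ^ (-1 - α) else 0 with hG
  have hGm : Measurable (Function.uncurry G) :=
    Measurable.ite (measurableSet_lt measurable_snd (measurable_fst.sub measurable_const))
      ((hη.measurable.comp measurable_fst).mul ((measurable_fst.sub measurable_snd).pow_const _))
      measurable_const
  have hGb : ∀ x y, |G x y| ≤ M * ε ^ (-1 - α) := by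
    intro x y
    simp only [hG]
    split_ifs with h
    · rw [abs_mul]
      have : 0 ≤ (x - y) ^ (-1 - α) := Real.rpow_nonneg (by linarith) _
      rw [abs_of_nonneg this]
      exact mul_le_mul (hM x) (Real.rpow_le_rpow_of_nonpos hε (by linarith) (by linarith)) this hM0
    · rw [abs_zero]; positivity
  have hGi : ∀ z ∈ Ioo a b, IntegrableOn (fun x => G x z) (Ioo z b) := fun z _ =>
    Integrable.mono' (integrable_const (M * ε ^ (-1 - α)))
      (hGm.comp measurable_prodMk_right).aestronglyMeasurable
      (Eventually.of_forall fun x => hGb x z)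
  have hF := (triangle_fubini (C := M * ε ^ (-1 - α) * (b - a)) hu hGm hGi (fun z hz => by
    refine (setIntegral_mono_on (hGi z hz).abs (integrable_const (M * ε ^ (-1 - α)))
      measurableSet_Ioo fun x _ => hGb x z).trans ?_
    simp only [integral_const, smul_eq_mul, MeasurableSet.univ, measureReal_restrict_apply,
      univ_inter, Real.volume_real_Ioo_of_le hz.2.le]
    have : 0 ≤ M * ε ^ (-1 - α) := by positivity
    nlinarith [hz.1])).2
  have hin : ∀ x, η x * ∫ y in Ioo a (x - ε), u y * (x - y) ^ (-1 - α)
      = ∫ y in Ioo a x, u y * G x y := by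
    intro x
    rw [← integral_const_mul]
    have : ∀ y, u y * G x y = (Iio (x - ε)).indicator
        (fun y => η x * (u y * (x - y) ^ (-1 - α))) y := by
      intro y
      by_cases h : y < x - ε
      · rw [indicator_of_mem (show y ∈ Iio (x - ε) from h)]; simp only [hG, if_pos h]; ring
      · rw [indicator_of_notMem (show y ∉ Iio (x - ε) from h)]; simp only [hG, if_neg h, mul_zero]
    simp only [this]
    rw [setIntegral_indicator measurableSet_Iio, Ioo_inter_Iio, min_eq_right (by linarith)]
  have hrw : ∀ x, η x * marchaudTrunc a α ε u x
      = ε ^ (-α) * (u x * η x) - α * ∫ y in Ioo a x, u y * G x y := by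
    intro x; rw [← hin, marchaudTrunc]; ring
  have hui : IntegrableOn (fun x => u x * η x) (Ioo a b) :=
    integrableOn_mul_of_bound measurableSet_Ioo hu hη.measurable fun y _ => hM y
  simp only [hrw]
  refine ⟨(hui.const_mul _).sub (hF.1.const_mul _), ?_⟩
  have huG : IntegrableOn (fun y => u y * ∫ x in Ioo y b, G x y) (Ioo a b) := by
    have hm : StronglyMeasurable fun y => ∫ x in Ioo y b, G x y := by
      have : ∀ y, ∫ x in Ioo y b, G x y = ∫ x, {p : ℝ × ℝ | p.1 < p.2 ∧ p.2 < b}.indicator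
          (fun p => G p.2 p.1) (y, x) := by
        intro y
        rw [← integral_indicator measurableSet_Ioo]
        rfl
      simp only [this]
      refine StronglyMeasurable.integral_prod_right' (f := {p : ℝ × ℝ | p.1 < p.2 ∧ p.2 < b}.indicator
          (fun p => G p.2 p.1)) (Measurable.stronglyMeasurable ?_)
      exact (hGm.comp measurable_swap).indicator
        ((measurableSet_lt measurable_fst measurable_snd).inter
          (measurableSet_lt measurable_snd measurable_const))
    refine integrableOn_mul_of_bound (M := M * ε ^ (-1 - α) * (b - a)) measurableSet_Ioo hu
      hm.measurable fun y hy => ?_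
    refine (abs_integral_le_integral_abs).trans ?_
    refine (setIntegral_mono_on (hGi y hy).abs (integrable_const (M * ε ^ (-1 - α)))
      measurableSet_Ioo fun x _ => hGb x y).trans ?_
    simp only [integral_const, smul_eq_mul, MeasurableSet.univ, measureReal_restrict_apply,
      univ_inter, Real.volume_real_Ioo_of_le hy.2.le]
    have : 0 ≤ M * ε ^ (-1 - α) := by positivity
    nlinarith [hy.1]
  rw [integral_sub (hui.const_mul _) (hF.1.const_mul _), integral_const_mul, integral_const_mul,
    hF.2, ← integral_const_mul, ← integral_const_mul,
    ← integral_sub (hui.const_mul _) (huG.const_mul _)]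
  congr 1; ext y
  simp only [marchaudAdj, hG]; ring

/-- Integration by parts on `(ε, b - a + 1)` leaves the boundary term `-ε ^ (-α) η(y + ε)`. With `ε
^ (-α) η(y)` it forms `-ε ^ (-α)` times the integral of `deriv η (y + s)` over `(0, ε)`, so the
kernel is merely frozen below `ε`. Since `max s ε ^ (-α) ≤ s ^ (-α)`, this form is dominated as `ε →
0`. The length `b - a + 1` carries `y + s` past `b` and exceeds every `ε < 1`. -/
theorem marchaudAdj_eq {α a b ε y : ℝ} (hε : 0 < ε) (hε1 : ε < 1) (hy : y ∈ Ioo a b)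
    {η : ℝ → ℝ} (hη : ContDiff ℝ ((⊤ : ℕ∞) : WithTop ℕ∞) η) (hs : tsupport η ⊆ Ioo a b) :
    marchaudAdj b α ε η y
      = -∫ s in Ioo 0 (b - a + 1), deriv η (y + s) * (max s ε) ^ (-α) := by
  set L := b - a + 1 with hL
  have hεL : ε < L := by have := hy.1.trans hy.2; simp only [hL]; linarith
  have hyL : b ≤ y + L := by have := hy.1; simp only [hL]; linarith
  have hsup : ∀ x, b ≤ x → η x = 0 := fun x hx =>
    image_eq_zero_of_notMem_tsupport fun h => absurd (hs h).2 (not_lt.2 hx)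
  have hcd : Continuous (deriv η) := hη.continuous_deriv (by simp)
  have hcdy : Continuous fun s => deriv η (y + s) := hcd.comp (continuous_const.add continuous_id)
  have hder : ∀ s, HasDerivAt (fun s => η (y + s)) (deriv η (y + s)) s := fun s =>
    ((hη.differentiable (by simp) (y + s)).hasDerivAt).comp_const_add y s
  have hn : (0:ℝ) ∉ uIcc ε L := by rw [uIcc_of_le hεL.le]; intro h; linarith [h.1]
  have hpi : ∀ p : ℝ, IntervalIntegrable (fun s : ℝ => s ^ p) volume ε L := fun p =>
    intervalIntegral.intervalIntegrable_rpow (Or.inr hn)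
  have e1 : ∫ x in Ioo y b, (if y < x - ε then η x * (x - y) ^ (-1 - α) else 0)
      = ∫ s in ε..L, η (y + s) * s ^ (-1 - α) := by
    have a1 : ∫ x in Ioo y b, (if y < x - ε then η x * (x - y) ^ (-1 - α) else 0)
        = ∫ x in Ioi y, (if y < x - ε then η x * (x - y) ^ (-1 - α) else 0) := by
      refine (setIntegral_eq_of_subset_of_forall_sdiff_eq_zero measurableSet_Ioi
        (fun x hx => hx.1) fun x hx => ?_).symm
      rw [hsup x (not_lt.1 fun h => hx.2 ⟨hx.1, h⟩), zero_mul, ite_self]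
    rw [a1, setIntegral_Ioi_comp_add, intervalIntegral.integral_of_le hεL.le]
    symm
    have a2 : ∫ s in Ioc ε L, η (y + s) * s ^ (-1 - α) = ∫ s in Ioc ε L,
        (if y < y + s - ε then η (y + s) * (y + s - y) ^ (-1 - α) else 0) := by
      refine setIntegral_congr_fun measurableSet_Ioc fun s hs => ?_
      rw [if_pos (by linarith [hs.1]), add_sub_cancel_left]
    rw [a2]
    refine (setIntegral_eq_of_subset_of_forall_sdiff_eq_zero measurableSet_Ioi
        (fun x hx => hε.trans hx.1) fun s hs => ?_).symm
    split_ifs with h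
    · rw [hsup (y + s), zero_mul]
      have : L < s := not_le.1 fun h' => hs.2 ⟨by linarith, h'⟩
      linarith
    · rfl
  have e2 : ∫ s in ε..L, η (y + s) * (-α * s ^ (-1 - α))
      = η (y + L) * L ^ (-α) - η (y + ε) * ε ^ (-α) - ∫ s in ε..L, deriv η (y + s) * s ^ (-α) := by
    refine intervalIntegral.integral_mul_deriv_eq_deriv_mul
      (v := fun s => s ^ (-α)) (v' := fun s => -α * s ^ (-1 - α)) (fun s _ => hder s) (fun s hs => ?_)
      (hcdy.intervalIntegrable _ _) ((hpi _).const_mul _)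
    have : s ≠ 0 := fun h => hn (h ▸ hs)
    have := (hasDerivAt_id s).rpow_const (p := -α) (Or.inl this)
    refine this.congr_deriv ?_
    simp only [id_eq]; rw [show -1 - α = -α - 1 by ring]; ring
  have e3 : ∫ s in ε..L, η (y + s) * (-α * s ^ (-1 - α))
      = -α * ∫ s in ε..L, η (y + s) * s ^ (-1 - α) := by
    rw [← intervalIntegral.integral_const_mul]; congr 1; ext s; ring
  have hmc : Continuous fun s : ℝ => deriv η (y + s) * (max s ε) ^ (-α) :=
    hcdy.mul ((continuous_id.max continuous_const).rpow_const fun s => Or.inl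
      (ne_of_gt (lt_of_lt_of_le hε (le_max_right _ _))))
  have e4 : ∫ s in Ioo 0 L, deriv η (y + s) * (max s ε) ^ (-α)
      = ε ^ (-α) * (η (y + ε) - η y) + ∫ s in ε..L, deriv η (y + s) * s ^ (-α) := by
    rw [← integral_Ioc_eq_integral_Ioo, ← intervalIntegral.integral_of_le (hε.trans hεL).le,
      ← intervalIntegral.integral_add_adjacent_intervals (b := ε) (hmc.intervalIntegrable _ _)
        (hmc.intervalIntegrable _ _)]
    congr 1
    · have b1 : ∫ s in (0:ℝ)..ε, deriv η (y + s) = η (y + ε) - η (y + 0) :=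
        intervalIntegral.integral_eq_sub_of_hasDerivAt (fun s _ => hder s)
          (hcdy.intervalIntegrable _ _)
      rw [add_zero] at b1
      rw [← b1, ← intervalIntegral.integral_const_mul]
      refine intervalIntegral.integral_congr fun s hs => ?_
      rw [uIcc_of_le hε.le] at hs
      simp only [max_eq_right hs.2]; ring
    · refine intervalIntegral.integral_congr fun s hs => ?_
      rw [uIcc_of_le hεL.le] at hs
      simp only [max_eq_left hs.1]
  rw [marchaudAdj, e1, e4]
  rw [hsup _ hyL, zero_mul, e3] at e2
  linear_combination e2

/-- The truncated Marchaud derivatives of an integrable function, tested against a test function,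
converge to the pairing with its Liouville derivative. -/
theorem tendsto_integral_mul_marchaudTrunc {α a b : ℝ} (hab : a < b) (h0 : 0 < α) (h1 : α < 1)
    {u η : ℝ → ℝ} (hu : IntegrableOn u (Ioo a b)) (hη : ContDiff ℝ ((⊤ : ℕ∞) : WithTop ℕ∞) η)
    (hc : HasCompactSupport η) (hs : tsupport η ⊆ Ioo a b) :
    Tendsto (fun ε => ∫ x in Ioo a b, η x * marchaudTrunc a α ε u x) (𝓝[>] 0)
      (𝓝 (Real.Gamma (1 - α) * ∫ x in Ioo a b, u x * liouvilleDeriv .right α η x)) := by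
  obtain ⟨M, hM0, hM⟩ := exists_bound_deriv hη hc
  obtain ⟨M', hM'⟩ := hc.exists_bound_of_continuous hη.continuous
  have hcd : Continuous (deriv η) := hη.continuous_deriv (by simp)
  have hG : 0 < Real.Gamma (1 - α) := Real.Gamma_pos_of_pos (by linarith)
  set L := b - a + 1 with hL
  have hL0 : 0 ≤ L := by simp only [hL]; linarith
  have hsupd : ∀ x, b ≤ x → deriv η x = 0 := fun x hx =>
    deriv_eq_zero_of_notMem hs fun h => absurd h.2 (not_lt.2 hx)
  have hpi : IntegrableOn (fun s : ℝ => s ^ (-α)) (Ioo 0 L) := by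
    simpa using (integral_sub_rpow (z := 0) (T := L) (p := -α) (by linarith) hL0).1
  have hlim : Tendsto (fun ε => ∫ y in Ioo a b, u y *
      -∫ s in Ioo 0 L, deriv η (y + s) * (max s ε) ^ (-α)) (𝓝[>] 0)
      (𝓝 (∫ y in Ioo a b, u y * -∫ s in Ioo 0 L, deriv η (y + s) * s ^ (-α))) := by
    have hbd : ∀ ε y, ∀ s ∈ Ioo 0 L, ‖deriv η (y + s) * (max s ε) ^ (-α)‖ ≤ M * s ^ (-α) := by
      intro ε y s hs
      have hm : s ≤ max s ε := le_max_left _ _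
      have hp : 0 ≤ (max s ε) ^ (-α) := Real.rpow_nonneg (hs.1.le.trans hm) _
      rw [norm_mul, Real.norm_of_nonneg hp]
      exact mul_le_mul (hM _) (Real.rpow_le_rpow_of_nonpos hs.1 hm (by linarith)) hp hM0
    have hjm : ∀ ε, Measurable fun p : ℝ × ℝ => deriv η (p.1 + p.2) * (max p.2 ε) ^ (-α) := fun ε =>
      (hcd.measurable.comp (measurable_fst.add measurable_snd)).mul
        ((measurable_snd.max measurable_const).pow_const _)
    refine tendsto_integral_filter_of_dominated_convergence
      (fun y => ‖u y‖ * ∫ s in Ioo 0 L, M * s ^ (-α)) (Eventually.of_forall fun ε => ?_)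
      (Eventually.of_forall fun ε => Eventually.of_forall fun y => ?_) (hu.norm.mul_const _)
      (Eventually.of_forall fun y => ?_)
    · exact hu.aestronglyMeasurable.mul
        (hjm ε).stronglyMeasurable.integral_prod_right'.neg.aestronglyMeasurable
    · rw [norm_mul, norm_neg]
      refine mul_le_mul_of_nonneg_left ?_ (norm_nonneg _)
      refine norm_integral_le_of_norm_le (hpi.const_mul M) ?_
      filter_upwards [ae_restrict_mem measurableSet_Ioo] with s hs using hbd ε y s hs
    · refine Tendsto.const_mul _ (Tendsto.neg ?_)
      refine tendsto_integral_filter_of_dominated_convergence (fun s => M * s ^ (-α))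
        (Eventually.of_forall fun ε => ?_) (Eventually.of_forall fun ε => ?_) (hpi.const_mul M) ?_
      · exact ((hjm ε).comp measurable_prodMk_left).aestronglyMeasurable
      · filter_upwards [ae_restrict_mem measurableSet_Ioo] with s hs using hbd ε y s hs
      · filter_upwards [ae_restrict_mem measurableSet_Ioo] with s hs
        refine tendsto_const_nhds.congr' ?_
        filter_upwards [Ioo_mem_nhdsGT hs.1] with ε hε
        rw [max_eq_left hε.2.le]
  have e : ∫ y in Ioo a b, u y * -∫ s in Ioo 0 L, deriv η (y + s) * s ^ (-α)
      = Real.Gamma (1 - α) * ∫ x in Ioo a b, u x * liouvilleDeriv .right α η x := by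
    rw [← integral_const_mul]
    refine setIntegral_congr_fun measurableSet_Ioo fun y hy => ?_
    have : ∫ s in Ioi (0:ℝ), deriv η (y + s) * s ^ (-α)
        = ∫ s in Ioo 0 L, deriv η (y + s) * s ^ (-α) := by
      refine setIntegral_eq_of_subset_of_forall_sdiff_eq_zero measurableSet_Ioi
        (fun x hx => hx.1) fun s hs => ?_
      have h2 : L ≤ s := not_lt.1 fun h' => hs.2 ⟨hs.1, h'⟩
      rw [hsupd (y + s), zero_mul]
      have := hy.1
      simp only [hL] at h2; linarith
    simp only [liouvilleDeriv_right h1 hη hc hs, this]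
    field_simp
  rw [e] at hlim
  refine hlim.congr' ?_
  filter_upwards [Ioo_mem_nhdsGT one_pos] with ε hε
  rw [(integral_mul_marchaudTrunc h0 hε.1 hu hη.continuous hM').2]
  exact setIntegral_congr_fun measurableSet_Ioo fun y hy => by
    simp only [marchaudAdj_eq hε.1 hε.2 hy hη hs, hL]

/-! ### The product identity and the left-sided chain rule -/

theorem tendsto_setIntegral_Ioo_sub {k : ℝ → ℝ} {a x : ℝ} (hk : IntegrableOn k (Ioo a x)) :
    Tendsto (fun ε => ∫ y in Ioo a (x - ε), k y) (𝓝[>] 0) (𝓝 (∫ y in Ioo a x, k y)) := by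
  have e : ∀ᶠ ε in 𝓝[>] (0:ℝ), ∫ y in Ioo a x, (Iio (x - ε)).indicator k y
      = ∫ y in Ioo a (x - ε), k y := by
    filter_upwards [self_mem_nhdsWithin] with ε hε
    have hε : 0 < ε := hε
    rw [setIntegral_indicator measurableSet_Iio, Ioo_inter_Iio, min_eq_right (by linarith)]
  refine Tendsto.congr' e ?_
  refine tendsto_integral_filter_of_dominated_convergence (fun y => ‖k y‖)
    (Eventually.of_forall fun ε => hk.aestronglyMeasurable.indicator measurableSet_Iio)
    (Eventually.of_forall fun ε => Eventually.of_forall fun y => norm_indicator_le_norm_self _ _)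
    hk.norm ?_
  filter_upwards [ae_restrict_mem measurableSet_Ioo] with y hy
  refine tendsto_const_nhds.congr' ?_
  filter_upwards [Ioo_mem_nhdsGT (sub_pos.2 hy.2)] with ε hε
  rw [indicator_of_mem]
  have := hε.2
  simp only [mem_Iio]; linarith

theorem quotient_mul_self {φ : ℝ → ℝ} (hφ0 : φ 0 = 0) (f : ℝ → ℝ) (x : ℝ) :
    quotient φ f x * f x = φ (f x) := by
  unfold quotient; split_ifs with h
  · rw [h, hφ0, mul_zero]
  · field_simp

/-- The quotient is `dslope φ 0` composed with `f`, and this slope is continuous because `φ` is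
continuous and differentiable at `0`. -/
theorem continuousOn_quotient {φ f : ℝ → ℝ} {s : Set ℝ} (hφ : ContDiff ℝ 1 φ) (hφ0 : φ 0 = 0)
    (hf : ContinuousOn f s) : ContinuousOn (quotient φ f) s := by
  have h1 : Continuous (dslope φ 0) := by
    rw [← continuousOn_univ, continuousOn_dslope univ_mem]
    exact ⟨hφ.continuous.continuousOn, hφ.differentiable (by simp) 0⟩
  have h2 : quotient φ f = fun x => dslope φ 0 (f x) := by
    ext x
    by_cases h : f x = 0
    · rw [quotient, if_pos h, h, dslope_same]
    · rw [quotient, if_neg h, dslope_of_ne _ h, slope_def_field, hφ0, sub_zero, sub_zero]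
  rw [h2]
  exact h1.comp_continuousOn hf

/-- The functional equation `Γ(1 - α) = -α Γ(-α)` matches the constant of the remainder with the
Marchaud normalisation. -/
theorem neg_one_div_Gamma_neg {α : ℝ} (h0 : 0 < α) :
    -1 / Real.Gamma (-α) = α / Real.Gamma (1 - α) := by
  have h := Real.Gamma_add_one (s := -α) (by linarith)
  rw [show 1 - α = -α + 1 by ring, h]
  have : α / (-α * Real.Gamma (-α)) = (α / -α) / Real.Gamma (-α) := by rw [div_div]
  rw [this, div_neg, div_self h0.ne']

theorem remainderIntegrand_eq {α x y : ℝ} {f g : ℝ → ℝ} (hy : y < x) :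
    remainderIntegrand α f g x y
      = g x * (f y * (x - y) ^ (-1 - α)) - (g y * f y) * (x - y) ^ (-1 - α) := by
  have p : 0 < x - y := by linarith
  rw [remainderIntegrand, abs_of_pos p, show -1 - α = -(1 + α) by ring, Real.rpow_neg p.le,
    div_eq_mul_inv]
  ring

/-- The truncated Marchaud derivative of a product. -/
theorem marchaudTrunc_mul {α a b x ε : ℝ} (h0 : 0 < α) (hε : 0 < ε) (hx : x ∈ Ioo a b)
    {f g : ℝ → ℝ} (hf : IntegrableOn f (Ioo a b))
    (hgf : IntegrableOn (fun y => g y * f y) (Ioo a b)) :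
    marchaudTrunc a α ε (fun y => g y * f y) x = g x * marchaudTrunc a α ε f x
      + α * ∫ y in Ioo a (x - ε), remainderIntegrand α f g x y := by
  have hsub : Ioo a (x - ε) ⊆ Ioo a b := Ioo_subset_Ioo le_rfl (by linarith [hx.2])
  have i1 := integrableOn_mul_rpow_far (x := x) h0 (hf.mono_set hsub) (by linarith)
  have i2 := integrableOn_mul_rpow_far (x := x) h0 (hgf.mono_set hsub) (by linarith)
  -- Away from the singularity the two halves of the remainder are separately integrable. The terms
  -- `ε ^ (-α) g x f x` on the two sides agree, so only these integrals have to be compared.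
  have e : ∫ y in Ioo a (x - ε), remainderIntegrand α f g x y
      = g x * (∫ y in Ioo a (x - ε), f y * (x - y) ^ (-1 - α))
        - ∫ y in Ioo a (x - ε), (g y * f y) * (x - y) ^ (-1 - α) := by
    rw [← integral_const_mul, ← integral_sub (i1.const_mul _) i2]
    exact setIntegral_congr_fun measurableSet_Ioo fun y hy =>
      remainderIntegrand_eq (by linarith [hy.2])
  rw [e, marchaudTrunc, marchaudTrunc]
  ring

/-- Extension by zero turns `f` and `g`, known to be continuous on the interval only, into Borel
functions, so that the integrand is jointly measurable. For `e ≥ 0` the variable `y` stays inside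
`(a, b)` and the extension is invisible. -/
theorem aestronglyMeasurable_truncated_remainder {α a b e : ℝ} (he : 0 ≤ e) {f g : ℝ → ℝ}
    (hf : ContinuousOn f (Ioo a b)) (hg : ContinuousOn g (Ioo a b)) :
    AEStronglyMeasurable (fun x => ∫ y in Ioo a (x - e), remainderIntegrand α f g x y)
      (volume.restrict (Ioo a b)) := by
  classical
  have hm : ∀ k : ℝ → ℝ, ContinuousOn k (Ioo a b) → Measurable ((Ioo a b).piecewise k 0) :=
    fun k hk => hk.measurable_piecewise continuousOn_const measurableSet_Ioo
  set f' := (Ioo a b).piecewise f 0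
  set g' := (Ioo a b).piecewise g 0
  have hF : StronglyMeasurable fun x => ∫ y, {p : ℝ × ℝ | a < p.2 ∧ p.2 < p.1 - e}.indicator
      (fun p => remainderIntegrand α f' g' p.1 p.2) (x, y) := by
    refine StronglyMeasurable.integral_prod_right' (f := {p : ℝ × ℝ | a < p.2 ∧
      p.2 < p.1 - e}.indicator (fun p => remainderIntegrand α f' g' p.1 p.2))
      (Measurable.stronglyMeasurable ?_)
    refine Measurable.indicator ?_ ((measurableSet_lt measurable_const measurable_snd).inter
      (measurableSet_lt measurable_snd (measurable_fst.sub measurable_const)))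
    exact (((hm f hf).comp measurable_snd).mul (((hm g hg).comp measurable_fst).sub
      ((hm g hg).comp measurable_snd))).div
        ((measurable_fst.sub measurable_snd).norm.pow_const _)
  refine hF.aestronglyMeasurable.congr ?_
  filter_upwards [ae_restrict_mem measurableSet_Ioo] with x hx
  have : (fun y => {p : ℝ × ℝ | a < p.2 ∧ p.2 < p.1 - e}.indicator
      (fun p => remainderIntegrand α f' g' p.1 p.2) (x, y))
      = (Ioo a (x - e)).indicator (fun y => remainderIntegrand α f' g' x y) := rfl
  rw [this, integral_indicator measurableSet_Ioo]
  refine setIntegral_congr_fun measurableSet_Ioo fun y hy => ?_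
  have hy' : y ∈ Ioo a b := ⟨hy.1, by linarith [hy.2, hx.2]⟩
  simp only [remainderIntegrand, f', g', piecewise_eq_of_mem _ _ _ hx,
    piecewise_eq_of_mem _ _ _ hy']

/-- The chain rule on the left, if both weak derivatives exist. -/
theorem chain_rule_left_of_exists {a b α : ℝ} (hab : a < b) (h0 : 0 < α) (h1 : α < 1)
    {φ f v w : ℝ → ℝ} (hφ0 : φ 0 = 0)
    (hv : IsWeakFracDeriv .left α a b f v)
    (hw : IsWeakFracDeriv .left α a b (fun x => φ (f x)) w) :
    ∀ᵐ x ∂(volume.restrict (Ioo a b)),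
      IsImproperRemainder .left α a b f (quotient φ f) x (w x - quotient φ f x * v x) := by
  have hG : 0 < Real.Gamma (1 - α) := Real.Gamma_pos_of_pos (by linarith)
  have hφf : (fun x => φ (f x)) = fun x => quotient φ f x * f x :=
    funext fun x => (quotient_mul_self hφ0 f x).symm
  filter_upwards [hv.ae_tendsto_marchaudTrunc hab h0 h1, hw.ae_tendsto_marchaudTrunc hab h0 h1,
    ae_restrict_mem measurableSet_Ioo] with x hvx hwx hx
  -- The difference of the truncated derivative of `φ(f)` and the quotient times that of `f` is, by
  -- the product identity, the truncated remainder up to constants; so the remainder inherits its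
  -- limit.
  have hlim := (hwx.sub (hvx.const_mul (quotient φ f x))).const_mul (Real.Gamma (1 - α))⁻¹
  have e : (Real.Gamma (1 - α))⁻¹ * (Real.Gamma (1 - α) * w x
      - quotient φ f x * (Real.Gamma (1 - α) * v x)) = w x - quotient φ f x * v x := by
    field_simp
  rw [e] at hlim
  refine hlim.congr' ?_
  filter_upwards [self_mem_nhdsWithin] with ε hε
  have hm := marchaudTrunc_mul h0 hε hx hv.integrableOn (hφf ▸ hw.integrableOn)
  rw [hφf, hm, neg_one_div_Gamma_neg h0]
  simp only [Side.truncPart]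
  field_simp
  ring

theorem improperRemainder_left_of_integrableOn {a b α x : ℝ} {f g : ℝ → ℝ}
    (h : IntegrableOn (remainderIntegrand α f g x) (Ioo a x)) :
    IsImproperRemainder .left α a b f g x (remainder .left α a b f g x) :=
  (tendsto_setIntegral_Ioo_sub h).const_mul _

/-- The chain rule on the left, if the remainder is locally integrable. -/
theorem chain_rule_left_of_integrable {a b α : ℝ} (hab : a < b) (h0 : 0 < α) (h1 : α < 1)
    {φ f v : ℝ → ℝ} (hφ : ContDiff ℝ 1 φ) (hφ0 : φ 0 = 0) (hf : ContinuousOn f (Ioo a b))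
    (hv : IsWeakFracDeriv .left α a b f v) (hφf : IntegrableOn (fun x => φ (f x)) (Ioo a b))
    (hR : ∀ᵐ x ∂(volume.restrict (Ioo a b)),
      IntegrableOn (remainderIntegrand α f (quotient φ f) x) (Ioo a x))
    (hRl : LocallyIntegrableOn
      (fun x => ∫ y in Ioo a x, |remainderIntegrand α f (quotient φ f) x y|) (Ioo a b)) :
    IsWeakFracDeriv .left α a b (fun x => φ (f x))
      (fun x => quotient φ f x * v x + remainder .left α a b f (quotient φ f) x) := by
  have hG : 0 < Real.Gamma (1 - α) := Real.Gamma_pos_of_pos (by linarith)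
  set g := quotient φ f with hgdef
  have hg : ContinuousOn g (Ioo a b) := continuousOn_quotient hφ hφ0 hf
  have hgf : (fun x => φ (f x)) = fun x => g x * f x :=
    funext fun x => (quotient_mul_self hφ0 f x).symm
  -- The value `e = 0` is admitted: `T 0` is the full integral, the limit of `T ε`. All of them are
  -- dominated by `Q`.
  set T : ℝ → ℝ → ℝ := fun e x => ∫ y in Ioo a (x - e), remainderIntegrand α f g x y with hT
  set Q : ℝ → ℝ := fun x => ∫ y in Ioo a x, |remainderIntegrand α f g x y| with hQ
  have hTm : ∀ e, 0 ≤ e → AEStronglyMeasurable (T e) (volume.restrict (Ioo a b)) := fun e he =>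
    aestronglyMeasurable_truncated_remainder he hf hg
  have hTQ : ∀ᵐ x ∂(volume.restrict (Ioo a b)), ∀ e, 0 ≤ e → ‖T e x‖ ≤ Q x := by
    filter_upwards [hR] with x hx e he
    have hsub : Ioo a (x - e) ⊆ Ioo a x := Ioo_subset_Ioo le_rfl (by linarith)
    refine (norm_integral_le_integral_norm _).trans ?_
    exact setIntegral_mono_set hx.norm (Eventually.of_forall fun _ => norm_nonneg _)
      (Eventually.of_forall hsub)
  have hrem : ∀ x, remainder .left α a b f g x = α / Real.Gamma (1 - α) * T 0 x := fun x => by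
    simp only [remainder, Side.part, hT, sub_zero, neg_one_div_Gamma_neg h0]
  have hgv : LocallyIntegrableOn (fun x => g x * v x) (Ioo a b) :=
    locallyIntegrableOn_Ioo_of_Icc fun c d hc hd =>
      (integrableOn_Icc_of_locallyIntegrableOn hv.locallyIntegrableOn hc hd).continuousOn_mul
        (hg.mono fun x hx => ⟨hc.trans_le hx.1, hx.2.trans_lt hd⟩) isCompact_Icc
  have hT0 : LocallyIntegrableOn (T 0) (Ioo a b) := by
    refine locallyIntegrableOn_Ioo_of_Icc fun c d hc hd => ?_
    have hsub : Icc c d ⊆ Ioo a b := fun x hx => ⟨hc.trans_le hx.1, hx.2.trans_lt hd⟩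
    refine Integrable.mono' (integrableOn_Icc_of_locallyIntegrableOn hRl hc hd)
      ((hTm 0 le_rfl).mono_set hsub) ?_
    filter_upwards [ae_restrict_of_ae_restrict_of_subset hsub hTQ] with x hx using hx 0 le_rfl
  have hT0' : LocallyIntegrableOn (fun x => α / Real.Gamma (1 - α) * T 0 x) (Ioo a b) :=
    hT0.smul (α / Real.Gamma (1 - α))
  simp only [hrem]
  refine ⟨hφf, hgv.add hT0', fun η hη hc hs => ?_⟩
  obtain ⟨c, d, hac, hcd, hdb, hI⟩ := exists_Icc_of_tsupport hab hc hs
  have hsub : Icc c d ⊆ Ioo a b := fun x hx => ⟨hac.trans_le hx.1, hx.2.trans_lt hdb⟩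
  obtain ⟨M, hM⟩ := hc.exists_bound_of_continuous hη.continuous
  have hηi : ∀ k : ℝ → ℝ, LocallyIntegrableOn k (Ioo a b) →
      IntegrableOn (fun x => η x * k x) (Ioo a b) := by
    intro k hk
    have : IntegrableOn (fun x => η x * k x) (Icc c d) :=
      (integrableOn_Icc_of_locallyIntegrableOn hk hac hdb).continuousOn_mul
        hη.continuous.continuousOn isCompact_Icc
    refine ((integrableOn_iff_integrable_of_support_subset (s := Icc c d) ?_).1 this).integrableOn
    intro x hx
    by_contra hx'
    exact hx (by simp [hI x hx'])
  have hηQ : IntegrableOn (fun x => ‖η x * Q x‖) (Ioo a b) := (hηi Q hRl).norm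
  have hηm : ∀ e, 0 ≤ e → AEStronglyMeasurable (fun x => η x * T e x)
      (volume.restrict (Ioo a b)) := fun e he =>
    hη.continuous.aestronglyMeasurable.mul (hTm e he)
  have hbd : ∀ᵐ x ∂(volume.restrict (Ioo a b)), ∀ e, 0 ≤ e → ‖η x * T e x‖ ≤ ‖η x * Q x‖ := by
    filter_upwards [hTQ] with x hx e he
    rw [norm_mul, norm_mul]
    exact mul_le_mul_of_nonneg_left ((hx e he).trans (le_abs_self _)) (norm_nonneg _)
  have hηT : ∀ e, 0 ≤ e → IntegrableOn (fun x => η x * T e x) (Ioo a b) := fun e he =>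
    Integrable.mono' hηQ (hηm e he) (hbd.mono fun x hx => hx e he)
  have l3 : Tendsto (fun ε => ∫ x in Ioo a b, η x * T ε x) (𝓝[>] 0)
      (𝓝 (∫ x in Ioo a b, η x * T 0 x)) := by
    refine tendsto_integral_filter_of_dominated_convergence (fun x => ‖η x * Q x‖) ?_ ?_ hηQ ?_
    · filter_upwards [self_mem_nhdsWithin] with ε hε using hηm ε (le_of_lt hε)
    · filter_upwards [self_mem_nhdsWithin] with ε hε
      exact hbd.mono fun x hx => hx ε (le_of_lt hε)
    · filter_upwards [hR] with x hx
      have := (tendsto_setIntegral_Ioo_sub hx).const_mul (η x)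
      simpa only [hT, sub_zero] using this
  -- As `g` is only continuous, `η g` is not a smooth test function. For this reason the weak
  -- convergence of the truncated derivatives is needed for all continuous functions of compact
  -- support.
  set ψ : ℝ → ℝ := fun x => η x * g x with hψ
  have hψs : tsupport ψ ⊆ tsupport η := tsupport_mul_subset_left
  have hψc : Continuous ψ := continuous_of_tsupport fun x hx =>
    hη.continuous.continuousAt.mul (hg.continuousAt (isOpen_Ioo.mem_nhds (hs (hψs hx))))
  have hψcs : HasCompactSupport ψ := hc.mul_right
  obtain ⟨M', hM'⟩ := hψcs.exists_bound_of_continuous hψc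
  have l2 := hv.tendsto_integral_marchaudTrunc hab h0 h1 hψc hψcs (hψs.trans hs)
  have l1 := tendsto_integral_mul_marchaudTrunc hab h0 h1 hφf hη hc hs
  have hsplit : ∀ᶠ ε in 𝓝[>] (0:ℝ), (∫ x in Ioo a b, ψ x * marchaudTrunc a α ε f x)
      + α * ∫ x in Ioo a b, η x * T ε x
      = ∫ x in Ioo a b, η x * marchaudTrunc a α ε (fun x => φ (f x)) x := by
    filter_upwards [self_mem_nhdsWithin] with ε hε
    have i1 := (integral_mul_marchaudTrunc h0 hε hv.integrableOn hψc hM').1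
    rw [← integral_const_mul, ← integral_add i1 ((hηT ε (le_of_lt hε)).const_mul α)]
    refine setIntegral_congr_fun measurableSet_Ioo fun x hx => ?_
    rw [hgf] at hφf ⊢
    simp only [marchaudTrunc_mul h0 hε hx hv.integrableOn hφf, hψ, hT]
    ring
  -- The tested truncated derivative of `φ(f)` has two limits: the sum from the product identity,
  -- and the pairing of `φ(f)` with the Liouville derivative of `η`. Their equality is the weak
  -- derivative condition times `Γ(1 - α)`.
  have key := tendsto_nhds_unique ((l2.add (l3.const_mul α)).congr' hsplit) l1
  have e1 : ∫ x in Ioo a b, (g x * v x + α / Real.Gamma (1 - α) * T 0 x) * η x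
      = (∫ x in Ioo a b, ψ x * v x)
        + α / Real.Gamma (1 - α) * ∫ x in Ioo a b, η x * T 0 x := by
    have j1 : IntegrableOn (fun x => ψ x * v x) (Ioo a b) := by
      have := hηi _ hgv
      simpa only [hψ, mul_assoc] using this
    rw [← integral_const_mul, ← integral_add j1 ((hηT 0 le_rfl).const_mul _)]
    congr 1; ext x; simp only [hψ]; ring
  rw [e1]
  simp only [Side.opp]
  refine mul_left_cancel₀ hG.ne' ?_
  rw [← key]
  field_simp

/-! ### Reflection and the right-sided case -/

theorem setIntegral_comp_neg (F : ℝ → ℝ) (s : Set ℝ) : ∫ x in s, F (-x) = ∫ x in -s, F x := by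
  have := (Measure.measurePreserving_neg (volume : Measure ℝ)).setIntegral_preimage_emb
    (MeasurableEquiv.neg ℝ).measurableEmbedding F (-s)
  rw [← this]
  simp

theorem integrableOn_comp_neg {F : ℝ → ℝ} {s : Set ℝ} :
    IntegrableOn (fun x => F (-x)) s ↔ IntegrableOn F (-s) := by
  have := (Measure.measurePreserving_neg (volume : Measure ℝ)).integrableOn_comp_preimage
    (MeasurableEquiv.neg ℝ).measurableEmbedding (f := F) (s := -s)
  rw [← this]
  simp [Function.comp_def]

theorem ae_restrict_comp_neg {P : ℝ → Prop} {s : Set ℝ} (hs : MeasurableSet s)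
    (h : ∀ᵐ x ∂(volume.restrict (-s)), P x) : ∀ᵐ x ∂(volume.restrict s), P (-x) := by
  rw [ae_restrict_iff' hs]
  filter_upwards [(Measure.measurePreserving_neg (volume : Measure ℝ)).quasiMeasurePreserving.ae
    ((ae_restrict_iff' hs.neg).1 h)] with x hx hxs
  exact hx (by simpa using hxs)

theorem locallyIntegrableOn_comp_neg {V : ℝ → ℝ} {a b : ℝ} (hV : LocallyIntegrableOn V (Ioo a b)) :
    LocallyIntegrableOn (fun x => V (-x)) (Ioo (-b) (-a)) :=
  locallyIntegrableOn_Ioo_of_Icc fun c d hc hd => by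
    rw [integrableOn_comp_neg, neg_Icc]
    exact integrableOn_Icc_of_locallyIntegrableOn hV (by linarith) (by linarith)

theorem neg_ray (s : Side) (x : ℝ) : -(s.opp.ray x) = s.ray (-x) := by
  cases s <;> simp [Side.opp, Side.ray]

theorem neg_part (s : Side) (a b x : ℝ) : -(s.part a b x) = s.opp.part (-b) (-a) (-x) := by
  cases s <;> simp [Side.opp, Side.part]

theorem neg_truncPart (s : Side) (a b x ε : ℝ) :
    -(s.truncPart a b x ε) = s.opp.truncPart (-b) (-a) (-x) ε := by
  cases s <;> simp [Side.opp, Side.truncPart, sub_eq_add_neg, add_comm]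

theorem Side.opp_opp (s : Side) : s.opp.opp = s := by cases s <;> rfl

theorem liouvilleIntegral_opp (s : Side) (σ : ℝ) (η : ℝ → ℝ) (x : ℝ) :
    liouvilleIntegral s.opp σ η x = liouvilleIntegral s σ (fun y => η (-y)) (-x) := by
  rw [liouvilleIntegral, liouvilleIntegral, ← neg_ray, ← setIntegral_comp_neg]
  congr 1
  refine integral_congr_ae (Eventually.of_forall fun y => ?_)
  simp only [neg_neg]
  rw [show -x - -y = -(x - y) by ring, abs_neg]

/-- The sign produced by differentiating along `x ↦ -x` is the minus sign in the definition of the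
right derivative. -/
theorem liouvilleDeriv_opp (s : Side) (α : ℝ) (η : ℝ → ℝ) (x : ℝ) :
    liouvilleDeriv s.opp α η x = liouvilleDeriv s α (fun y => η (-y)) (-x) := by
  cases s
  · have : liouvilleIntegral .right (1 - α) η
        = fun x => liouvilleIntegral .left (1 - α) (fun y => η (-y)) (-x) :=
      funext (liouvilleIntegral_opp .left (1 - α) η)
    simp only [liouvilleDeriv, Side.opp]
    rw [this, deriv_comp_neg, neg_neg]
  · have : liouvilleIntegral .left (1 - α) η
        = fun x => liouvilleIntegral .right (1 - α) (fun y => η (-y)) (-x) :=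
      funext (liouvilleIntegral_opp .right (1 - α) η)
    simp only [liouvilleDeriv, Side.opp]
    rw [this, deriv_comp_neg]

/-- Reflection exchanges left and right weak derivatives. -/
theorem IsWeakFracDeriv.comp_neg {s : Side} {α a b : ℝ} {u v : ℝ → ℝ}
    (h : IsWeakFracDeriv s α a b u v) :
    IsWeakFracDeriv s.opp α (-b) (-a) (fun x => u (-x)) (fun x => v (-x)) := by
  refine ⟨?_, locallyIntegrableOn_comp_neg h.locallyIntegrableOn, fun η hη hc hs => ?_⟩
  · rw [integrableOn_comp_neg, neg_Ioo, neg_neg, neg_neg]; exact h.integrableOn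
  · have hc' : HasCompactSupport fun y => η (-y) := hc.comp_homeomorph (Homeomorph.neg ℝ)
    have hs' : tsupport (fun y => η (-y)) ⊆ Ioo a b := by
      have : tsupport (fun y => η (-y)) = (fun y => -y) ⁻¹' tsupport η :=
        tsupport_comp_eq_preimage η (Homeomorph.neg ℝ)
      rw [this]
      intro x hx
      have := hs hx
      exact ⟨by linarith [this.2], by linarith [this.1]⟩
    have e := h.integral_eq _ (hη.comp contDiff_neg) hc' hs'
    have e1 := setIntegral_comp_neg (fun x => v x * η (-x)) (Ioo (-b) (-a))
    have e2 := setIntegral_comp_neg (fun x => u x * liouvilleDeriv s.opp α (fun y => η (-y)) x)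
      (Ioo (-b) (-a))
    simp only [neg_neg, neg_Ioo] at e1 e2
    rw [e1]
    simp only [liouvilleDeriv_opp s.opp]
    rw [e2]
    exact e

theorem remainderIntegrand_comp_neg (α : ℝ) (f g : ℝ → ℝ) (x y : ℝ) :
    remainderIntegrand α (fun t => f (-t)) (fun t => g (-t)) x y
      = remainderIntegrand α f g (-x) (-y) := by
  simp only [remainderIntegrand]
  rw [show -x - -y = -(x - y) by ring, abs_neg]

theorem remainder_comp_neg (s : Side) (α a b : ℝ) (f g : ℝ → ℝ) (x : ℝ) :
    remainder s.opp α (-b) (-a) (fun t => f (-t)) (fun t => g (-t)) x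
      = remainder s α a b f g (-x) := by
  have := neg_part s.opp (-b) (-a) x
  rw [Side.opp_opp, neg_neg, neg_neg] at this
  simp only [remainder, remainderIntegrand_comp_neg]
  rw [setIntegral_comp_neg (fun y => remainderIntegrand α f g (-x) y), this]

theorem isImproperRemainder_comp_neg (s : Side) (α a b : ℝ) (f g : ℝ → ℝ) (x r : ℝ) :
    IsImproperRemainder s.opp α (-b) (-a) (fun t => f (-t)) (fun t => g (-t)) x r
      ↔ IsImproperRemainder s α a b f g (-x) r := by
  have : ∀ ε, -(s.opp.truncPart (-b) (-a) x ε) = s.truncPart a b (-x) ε := fun ε => by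
    have := neg_truncPart s.opp (-b) (-a) x ε
    rwa [Side.opp_opp, neg_neg, neg_neg] at this
  simp only [IsImproperRemainder, remainderIntegrand_comp_neg]
  simp only [setIntegral_comp_neg (fun y => remainderIntegrand α f g (-x) y), this]

theorem chain_rule_of_exists {s : Side} {a b α : ℝ} (hab : a < b) (h0 : 0 < α) (h1 : α < 1)
    {φ f v w : ℝ → ℝ} (hφ0 : φ 0 = 0) (hv : IsWeakFracDeriv s α a b f v)
    (hw : IsWeakFracDeriv s α a b (fun x => φ (f x)) w) :
    ∀ᵐ x ∂(volume.restrict (Ioo a b)),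
      IsImproperRemainder s α a b f (quotient φ f) x (w x - quotient φ f x * v x) := by
  cases s
  · exact chain_rule_left_of_exists hab h0 h1 hφ0 hv hw
  · have h := ae_restrict_comp_neg (s := Ioo a b) measurableSet_Ioo (by
      rw [neg_Ioo]
      exact chain_rule_left_of_exists (neg_lt_neg hab) h0 h1 hφ0 hv.comp_neg hw.comp_neg)
    filter_upwards [h] with x hx
    have := (isImproperRemainder_comp_neg .right α a b f (quotient φ f) (-x) _).1 hx
    simpa only [neg_neg, quotient] using this

theorem improperRemainder_of_integrableOn {s : Side} {a b α x : ℝ} {f g : ℝ → ℝ}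
    (h : IntegrableOn (remainderIntegrand α f g x) (s.part a b x)) :
    IsImproperRemainder s α a b f g x (remainder s α a b f g x) := by
  cases s
  · exact improperRemainder_left_of_integrableOn h
  · have e := remainder_comp_neg .right α a b f g (-x)
    rw [neg_neg] at e
    have := (isImproperRemainder_comp_neg .right α a b f g (-x) (remainder .right α a b f g x)).1
    rw [neg_neg] at this
    refine this ?_
    rw [← e]
    refine improperRemainder_left_of_integrableOn ?_
    have h2 : IntegrableOn (remainderIntegrand α f g x) (-(Ioo (-b) (-x))) := by
      rw [neg_Ioo, neg_neg, neg_neg]; exact h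
    rw [← integrableOn_comp_neg] at h2
    refine h2.congr_fun (fun y _ => ?_) measurableSet_Ioo
    simp only [remainderIntegrand_comp_neg, neg_neg]

theorem chain_rule_of_integrable {s : Side} {a b α : ℝ} (hab : a < b) (h0 : 0 < α) (h1 : α < 1)
    {φ f v : ℝ → ℝ} (hφ : ContDiff ℝ 1 φ) (hφ0 : φ 0 = 0) (hf : ContinuousOn f (Ioo a b))
    (hv : IsWeakFracDeriv s α a b f v) (hφf : IntegrableOn (fun x => φ (f x)) (Ioo a b))
    (hR : ∀ᵐ x ∂(volume.restrict (Ioo a b)),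
      IntegrableOn (remainderIntegrand α f (quotient φ f) x) (s.part a b x))
    (hRl : LocallyIntegrableOn
      (fun x => ∫ y in s.part a b x, |remainderIntegrand α f (quotient φ f) x y|) (Ioo a b)) :
    IsWeakFracDeriv s α a b (fun x => φ (f x))
      (fun x => quotient φ f x * v x + remainder s α a b f (quotient φ f) x) := by
  cases s
  · exact chain_rule_left_of_integrable hab h0 h1 hφ hφ0 hf hv hφf hR hRl
  · have hI : ∀ x, Ioo (-b) x = -(Ioo (-x) b) := fun x => by rw [neg_Ioo, neg_neg]
    have hq : ∀ x, quotient φ (fun t => f (-t)) x = quotient φ f (-x) := fun _ => rfl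
    have hri : ∀ x y, remainderIntegrand α (fun t => f (-t)) (quotient φ fun t => f (-t)) x y
        = remainderIntegrand α f (quotient φ f) (-x) (-y) :=
      remainderIntegrand_comp_neg α f (quotient φ f)
    have hf' : ContinuousOn (fun t => f (-t)) (Ioo (-b) (-a)) :=
      hf.comp continuous_neg.continuousOn fun x hx => ⟨by linarith [hx.2], by linarith [hx.1]⟩
    have key := chain_rule_left_of_integrable (neg_lt_neg hab) h0 h1 hφ hφ0 hf' hv.comp_neg
      (by
        rw [integrableOn_comp_neg (F := fun x => φ (f x)), neg_Ioo, neg_neg, neg_neg]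
        exact hφf)
      (by
        have := ae_restrict_comp_neg (s := Ioo (-b) (-a)) measurableSet_Ioo (by
          rw [neg_Ioo, neg_neg, neg_neg]; exact hR)
        filter_upwards [this] with x hx
        simp only [Side.part] at hx
        have h2 : IntegrableOn (fun y => remainderIntegrand α f (quotient φ f) (-x) (-y))
            (Ioo (-b) x) := by
          rw [integrableOn_comp_neg (F := remainderIntegrand α f (quotient φ f) (-x)), hI,
            neg_neg]
          exact hx
        exact h2.congr_fun (fun y _ => (hri x y).symm) measurableSet_Ioo)
      (by
        refine (locallyIntegrableOn_comp_neg hRl).congr (Eventually.of_forall fun x => ?_)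
        simp only [Side.part, hri]
        rw [setIntegral_comp_neg (fun y => |remainderIntegrand α f (quotient φ f) (-x) y|), hI,
          neg_neg])
    have k2 := key.comp_neg
    have er : ∀ x, remainder .left α (-b) (-a) (fun t => f (-t)) (quotient φ fun t => f (-t)) (-x)
        = remainder .right α a b f (quotient φ f) x := fun x => by
      have := remainder_comp_neg .right α a b f (quotient φ f) (-x)
      rwa [neg_neg] at this
    simpa only [neg_neg, hq, er, Side.opp] using k2

end WeakFrac

end

/-! ### The chain rule for both signs -/

theorem mainTheorem7 (a b α : ℝ) (hab : a < b) (hα0 : 0 < α) (hα1 : α < 1)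
    (φ : ℝ → ℝ) (hφ : ContDiff ℝ 1 φ) (hφ0 : φ 0 = 0)
    (f : ℝ → ℝ) (hf : ContinuousOn f (Ioo a b))
    (s : WeakFrac.Side) (v : ℝ → ℝ) (hv : WeakFrac.IsWeakFracDeriv s α a b f v) :
    (∀ w : ℝ → ℝ, WeakFrac.IsWeakFracDeriv s α a b (fun x => φ (f x)) w →
      ∀ᵐ x ∂(volume.restrict (Ioo a b)),
        (∃ r : ℝ, WeakFrac.IsImproperRemainder s α a b f (WeakFrac.quotient φ f) x r ∧
          w x = WeakFrac.quotient φ f x * v x + r) ∧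
        (IntegrableOn (WeakFrac.remainderIntegrand α f (WeakFrac.quotient φ f) x)
            (s.part a b x) →
          w x = WeakFrac.quotient φ f x * v x
            + WeakFrac.remainder s α a b f (WeakFrac.quotient φ f) x)) ∧
    (IntegrableOn (fun x => φ (f x)) (Ioo a b) →
      (∀ᵐ x ∂(volume.restrict (Ioo a b)),
        IntegrableOn (WeakFrac.remainderIntegrand α f (WeakFrac.quotient φ f) x)
          (s.part a b x)) →
      LocallyIntegrableOn
        (fun x => ∫ y in s.part a b x,
          |WeakFrac.remainderIntegrand α f (WeakFrac.quotient φ f) x y|) (Ioo a b) →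
      WeakFrac.IsWeakFracDeriv s α a b (fun x => φ (f x))
        (fun x => WeakFrac.quotient φ f x * v x
          + WeakFrac.remainder s α a b f (WeakFrac.quotient φ f) x)) := by
  refine ⟨fun w hw => ?_, fun h1 h2 h3 =>
    WeakFrac.chain_rule_of_integrable hab hα0 hα1 hφ hφ0 hf hv h1 h2 h3⟩
  filter_upwards [WeakFrac.chain_rule_of_exists hab hα0 hα1 hφ0 hv hw] with x hx
  refine ⟨⟨_, hx, by ring⟩, fun hi => ?_⟩
  -- Where the integrand is integrable, the improper value and the Lebesgue value are limits of the
  -- same truncated integrals.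
  have := tendsto_nhds_unique hx (WeakFrac.improperRemainder_of_integrableOn hi)
  linarith
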